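/- Let $d\ge 1$, $0<\alpha\le 2$, and let $V\in\mathcal S(\mathbb R^d)$ be real valued. Let $p_t^{(\alpha)}(x,y)=p_t^{(\alpha)}(x-y)$, $t>0$, be the transition density of the rotationally invariant $\alpha$-stable process, determined by $\int_{\mathbb R^d}e^{-iy\cdot\xi}p_t^{(\alpha)}(y)\,dy=e^{-t|\xi|^\alpha}$. For $t>0$ and $x,y\in\mathbb R^d$ let $\mathbb E^t_{x,y}$ be the expectation for the stable bridge $(X_s)_{0\le s\le t}$, that is, the càdlàg process with $X_0=x$, $X_t=y$ almost surely such that for $0<s_1<\dots<s_k<t$ the vector $(X_{s_1},\dots,X_{s_k})$ has the density $p_t^{(\alpha)}(x,y)^{-1}\prod_{j=0}^{k}p^{(\alpha)}_{s_{j+1}-s_j}(z_j,z_{j+1})$, where $s_0=0$, $s_{k+1}=t$, $z_0=x$, $z_{k+1}=y$. Let $$p_t^{H_V}(x,y)=p_t^{(\alpha)}(x,y)\,\mathbb E^t_{x,y}\Big[e^{-\int_0^tV(X_s)\,ds}\Big],\qquad Q_V^{(\alpha)}(t)=\int_{\mathbb R^d}\int_{\mathbb R^d}\big(p_t^{H_V}(x,y)-p_t^{(\alpha)}(x,y)\big)\,dx\,dy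 .$$ Let $(-\Delta)^{\alpha/2}$ be the operator with $\widehat{(-\Delta)^{\alpha/2}f}(\xi)=|\xi|^\alpha\widehat f(\xi)$, write $(-\Delta)^{\alpha/2}_2=(-\Delta)^{\alpha/2}\circ(-\Delta)^{\alpha/2}$, and let $$\mathcal E_\alpha(f)=\frac{C_{d,\alpha}}2\int_{\mathbb R^d}\int_{\mathbb R^d}\frac{|f(x)-f(y)|^2}{|x-y|^{d+\alpha}}\,dx\,dy\quad(0<\alpha<2),\qquad \mathcal E_2(f)=\int_{\mathbb R^d}|\nabla f(x)|^2\,dx,$$ where $C_{d,\alpha}=\Big(\int_{\mathbb R^d}\frac{1-\cos z_1}{|z|^{d+\alpha}}\,dz\Big)^{-1}$ is the constant for which $(-\Delta)^{\alpha/2}f(x)=C_{d,\alpha}\,\mathrm{p.v.}\!\int_{\mathbb R^d}\frac{f(x)-f(y)}{|x-y|^{d+\alpha}}\,dy$. Then the double integral defining $Q_V^{(\alpha)}(t)$ converges absolutely for every $t>0$, and, as $t\downarrow 0$, \begin{align*} Q_V^{(\alpha)}(t)=&-t\int_{\mathbb R^d} V\,d\theta+\frac{t^2}{2!}\int_{\mathbb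 R^d} V^2\,d\theta-\frac{t^3}{3!}\Big(\int_{\mathbb R^d} V^3\,d\theta+\mathcal E_\alpha(V)\Big)\\ &+\frac{t^4}{4!}\Big(\int_{\mathbb R^d} V^4\,d\theta+2\int_{\mathbb R^d} V^2\,(-\Delta)^{\alpha/2}V\,d\theta+\int_{\mathbb R^d}\big|(-\Delta)^{\alpha/2}V\big|^2\,d\theta\Big)\\ &-\frac{t^5}{5!}\Big(\int_{\mathbb R^d} V^5\,d\theta+2\int_{\mathbb R^d} V^3\,(-\Delta)^{\alpha/2}V\,d\theta+2\int_{\mathbb R^d} V^2\,(-\Delta)^{\alpha/2}_2V\,d\theta\\ &\qquad+\int_{\mathbb R^d} V\,\big|(-\Delta)^{\alpha/2}V\big|^2\,d\theta+\mathcal E_\alpha\big((-\Delta)^{\alpha/2}V\big)+\mathcal E_\alpha(V^2)\Big)+\mathcal O(t^6). \end{align*} -/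

import Mathlib

open MeasureTheory Filter Topology Set
open scoped FourierTransform SchwartzMap

noncomputable section

namespace HeatContent

/-- The Euclidean space `ℝ^d`. -/
abbrev Rd (d : ℕ) : Type := EuclideanSpace ℝ (Fin d)

/-- The transition density `p_t^{(α)}(x)` of the rotationally invariant `α`-stable process, that is
the function whose Fourier transform `∫ exp(-i y·ξ) p_t(y) dy` is `exp(-t|ξ|^α)`. It is given by
Fourier inversion. Mathlib's transform has the kernel `exp(-2πi y·η)`, so `ξ = 2πη`. The inverse
transform is real because the symbol is even. -/
def stableDensity {d : ℕ} (α t : ℝ) (x : Rd d) : ℝ :=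
  (𝓕⁻ (fun η : Rd d => ((Real.exp (-t * (2 * Real.pi * ‖η‖) ^ α) : ℝ) : ℂ)) x).re

/-- The fractional Laplacian `(-Δ)^{α/2}`, i.e. the Fourier multiplier with symbol `|ξ|^α`
(`ξ = 2πη` in Mathlib's normalisation), acting on real functions. -/
def fracLaplacian {d : ℕ} (α : ℝ) (f : Rd d → ℝ) (x : Rd d) : ℝ :=
  (𝓕⁻ (fun η : Rd d =>
    (((2 * Real.pi * ‖η‖) ^ α : ℝ) : ℂ) * 𝓕 (fun y : Rd d => (f y : ℂ)) η) x).re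

/-- The normalising constant `C_{d,α}`, `0 < α < 2`, of the singular integral
`(-Δ)^{α/2} f(x) = C_{d,α} p.v.∫ (f(x) - f(y)) / |x - y|^{d+α} dy`:
the inverse of `∫ (1 - cos z₁) / |z|^{d+α} dz`. -/
def normConst (d : ℕ) [NeZero d] (α : ℝ) : ℝ :=
  (∫ z : Rd d, (1 - Real.cos (z 0)) / ‖z‖ ^ ((d : ℝ) + α))⁻¹

/-- The Dirichlet form `E_α(f)` of `(-Δ)^{α/2}`: the double integral of squared differences for
`0 < α < 2`, and the classical Dirichlet integral for `α = 2`. -/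
def dirichletForm {d : ℕ} [NeZero d] (α : ℝ) (f : Rd d → ℝ) : ℝ :=
  if α = 2 then ∫ x : Rd d, ‖gradient f x‖ ^ 2
  else normConst d α / 2 *
    ∫ z : Rd d × Rd d, |f z.1 - f z.2| ^ 2 / ‖z.1 - z.2‖ ^ ((d : ℝ) + α)

/-- For times `s = (s₀ < ⋯ < s_{k-1})` in `(0,t)`, the joint density at `z = (z₀, …, z_{k-1})` of
the stable bridge from `x` to `y` in time `t`:
`p_{s₀}(z₀ - x) p_{s₁-s₀}(z₁ - z₀) ⋯ p_{t-s_{k-1}}(y - z_{k-1}) / p_t(y - x)`. -/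
def bridgeDensity {d : ℕ} (α t : ℝ) (x y : Rd d) {k : ℕ} (s : Fin k → ℝ) (z : Fin k → Rd d) : ℝ :=
  let τ : Fin (k + 2) → ℝ := Fin.cons (α := fun _ => ℝ) 0 (Fin.snoc (α := fun _ => ℝ) s t)
  let ζ : Fin (k + 2) → Rd d :=
    Fin.cons (α := fun _ => Rd d) x (Fin.snoc (α := fun _ => Rd d) z y)
  (∏ i : Fin (k + 1),
    stableDensity α (τ i.succ - τ i.castSucc) (ζ i.succ - ζ i.castSucc)) /
      stableDensity α t (y - x)

/-- Under the probability measure `P`, the process `(X s)`, `0 ≤ s ≤ t`, is the `α`-stable bridge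
that starts at `x` and is conditioned to be at `y` at time `t`: it has càdlàg paths and the
finite-dimensional distributions of the bridge. -/
structure IsStableBridge {d : ℕ} {Ω : Type*} [MeasurableSpace Ω] (α t : ℝ) (x y : Rd d)
    (P : Measure Ω) (X : ℝ → Ω → Rd d) : Prop where
  isProbabilityMeasure : IsProbabilityMeasure P
  measurable : ∀ s ∈ Icc 0 t, Measurable (X s)
  rightCont : ∀ ω, ∀ s ∈ Ico 0 t, ContinuousWithinAt (fun r => X r ω) (Ici s) s
  leftLim : ∀ ω, ∀ s ∈ Ioc 0 t, ∃ l : Rd d, Tendsto (fun r => X r ω) (𝓝[<] s) (𝓝 l)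
  start : ∀ᵐ ω ∂P, X 0 ω = x
  finish : ∀ᵐ ω ∂P, X t ω = y
  law : ∀ (k : ℕ) (s : Fin k → ℝ), StrictMono s → (∀ i, s i ∈ Ioo 0 t) →
    P.map (fun ω i => X (s i) ω) =
      (volume : Measure (Fin k → Rd d)).withDensity
        (fun z => ENNReal.ofReal (bridgeDensity α t x y s z))

/-- The heat kernel of `(-Δ)^{α/2} + V`, by the Feynman-Kac formula
`p_t^{(α)}(x,y) E^t_{x,y}[exp(-∫_0^t V(X_s) ds)]`, where `P t x y` is the measure under which
`X` is the bridge from `x` to `y` in time `t`. -/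
def schrodingerKernel {d : ℕ} {Ω : Type*} [MeasurableSpace Ω] (α : ℝ) (V : Rd d → ℝ)
    (P : ℝ → Rd d → Rd d → Measure Ω) (X : ℝ → Ω → Rd d) (t : ℝ) (x y : Rd d) : ℝ :=
  stableDensity α t (x - y) * ∫ ω, Real.exp (-∫ s in (0 : ℝ)..t, V (X s ω)) ∂(P t x y)

/-- The heat content `Q_V^{(α)}(t) = ∬ (p_t^{H_V}(x,y) - p_t^{(α)}(x,y)) dx dy`. -/
def heatContent {d : ℕ} {Ω : Type*} [MeasurableSpace Ω] (α : ℝ) (V : Rd d → ℝ)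
    (P : ℝ → Rd d → Rd d → Measure Ω) (X : ℝ → Ω → Rd d) (t : ℝ) : ℝ :=
  ∫ z : Rd d × Rd d, (schrodingerKernel α V P X t z.1 z.2 - stableDensity α t (z.1 - z.2))

end HeatContent

end

/-!
The heat content is expanded in two stages.

*Probabilistic stage.* Let `A = ∫₀ᵗ V(X_s) ds`. The Taylor expansion of `exp (-A)` turns the
Feynman-Kac kernel into an alternating sum of the moments `E[Aᵏ/k!]`, with a remainder after
the terms `k ≤ n` that is at most a constant times `tⁿ` times the first moment of `|V|`; this gives
absolute convergence as well as the error term (`abs_schrodingerKernel_sub_sum_le`). The divided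
power `Aᵏ/k!` is the integral of `V(X_{s₀}) ⋯ V(X_{s_{k-1}})` over ordered times
(`integral_simplex_prod`), so its expectation is given by the finite-dimensional distributions of
the bridge. Integrating over both end points removes the first and the last transition density, and
leaves the correlation integrals
`∫ V P_{s_{k-1}-s_{k-2}} V ⋯ P_{s₁-s₀} V` of the stable semigroup (`integral_pinnedChain`,
`integral_bridgeMoment`, `abs_heatContent_sub_sum_le`).

*Analytic stage.* On the Fourier side the semigroup is multiplication by `exp (-u |ξ|^α)`, so it has
a Taylor expansion in `u` whose coefficients are the multipliers `|ξ|^{jα}` (`lapPow`), with a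
uniform remainder because the Fourier transform of `V` decays rapidly
(`FourierDecay.abs_heatOp_sub_le`). As `P_u` and the multipliers are symmetric, the correlations of
up to five factors can be expanded to the order that matters (`exists_two_point_bound` to
`exists_five_point_bound`), and the resulting polynomials in the gaps are integrated over the
ordered times (`exists_integral_correlation_two` to `exists_integral_correlation_five`).

It remains to recognise the coefficients. The Dirichlet form equals `∫ f (-Δ)^{α/2} f` by Plancherel
(`dirichletForm_schwartz`, `dirichletForm_lapPow_one`). Moving `(-Δ)^{α/2}` across an integral and
iterating it require `(-Δ)^{α/2} V` to be integrable, although its Fourier transform is not smooth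
at the origin; this holds because `(V - P_t V) / t` stays bounded in `L¹`, by an estimate of second
differences (`integrable_lapPow_one`). Positivity of the transition densities, used throughout, follows from the
existence of the bridges (`positiveDensities_of_bridges`).
-/

noncomputable section

namespace HeatContent

section

/-! ### The symbol and Fourier transforms of real functions -/

/-- The symbol `|ξ|^α` of the fractional Laplacian at `ξ = 2πη`. -/
def symb {d : ℕ} (α : ℝ) (η : Rd d) : ℝ := (2 * Real.pi * ‖η‖) ^ α

/-- Mathlib's Fourier transform of a real function. -/
def fourierReal {d : ℕ} (f : Rd d → ℝ) : Rd d → ℂ := 𝓕 (fun y : Rd d => (f y : ℂ))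

/-- The `j`-th power of the fractional Laplacian, as the Fourier multiplier with symbol
`|ξ|^{jα}`. -/
def lapPow {d : ℕ} (α : ℝ) (j : ℕ) (f : Rd d → ℝ) (x : Rd d) : ℝ :=
  (𝓕⁻ (fun η : Rd d => ((symb α η ^ j : ℝ) : ℂ) * fourierReal f η) x).re

variable {d : ℕ} {α : ℝ}

lemma symb_nonneg (η : Rd d) : 0 ≤ symb α η := by unfold symb; positivity

@[simp] lemma symb_neg (η : Rd d) : symb α (-η) = symb α η := by simp [symb]

lemma continuous_symb (hα : 0 < α) : Continuous (symb α : Rd d → ℝ) := by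
  unfold symb
  exact (continuous_const.mul continuous_norm).rpow_const (fun _ => Or.inr hα.le)

lemma fracLaplacian_eq_lapPow (f : Rd d → ℝ) : fracLaplacian α f = lapPow α 1 f := by
  ext x; simp [fracLaplacian, lapPow, symb, fourierReal]

/-- The integrand of a Fourier transform of an integrable function is integrable. -/
lemma integrable_fourierInv_kernel {h : Rd d → ℂ} (hh : Integrable h) (x : Rd d) :
    Integrable (fun v : Rd d => Complex.exp (↑(2 * Real.pi * inner ℝ v x) * Complex.I) • h v) := by
  refine hh.bdd_mul (c := 1) (by fun_prop) (Eventually.of_forall fun v => ?_)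
  rw [Complex.norm_exp_ofReal_mul_I]

/-- Multiplication formula: the inverse Fourier transform is its own transpose. -/
lemma integral_fourierInv_mul {f g : Rd d → ℂ} (hf : Integrable f) (hg : Integrable g) :
    ∫ x, 𝓕⁻ f x * g x = ∫ η, f η * 𝓕⁻ g η := by
  have h : ∫ x, 𝓕 f x * g x = ∫ η, f η * 𝓕 g η := by
    simpa using! VectorFourier.integral_fourierIntegral_smul_eq_flip (L := innerₗ (Rd d))
      Real.continuous_fourierChar continuous_inner hf hg
  have h' : ∫ x, 𝓕 f x * g (-x) = ∫ η, f η * 𝓕 (fun x => g (-x)) η := by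
    simpa using! VectorFourier.integral_fourierIntegral_smul_eq_flip (L := innerₗ (Rd d))
      Real.continuous_fourierChar continuous_inner hf hg.comp_neg
  rw [← Real.fourierInv_eq_fourier_comp_neg] at h'
  rw [← h', ← integral_neg_eq_self]
  simp [Real.fourierInv_eq_fourier_neg]

/-- The inverse Fourier transform of a Hermitian function is real. -/
lemma ofReal_re_fourierInv {h : Rd d → ℂ} (hh : ∀ η, h (-η) = starRingEnd ℂ (h η)) (x : Rd d) :
    (((𝓕⁻ h x).re : ℝ) : ℂ) = 𝓕⁻ h x := by
  apply Complex.conj_eq_iff_re.mp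
  rw [Real.fourierInv_eq', ← integral_conj, ← integral_neg_eq_self]
  congr 1
  ext v
  simp only [smul_eq_mul, map_mul, hh, Complex.conj_conj, ← Complex.exp_conj, Complex.conj_ofReal,
    Complex.conj_I, inner_neg_left]
  congr 2
  push_cast
  ring

lemma fourierReal_neg (f : Rd d → ℝ) (η : Rd d) :
    fourierReal f (-η) = starRingEnd ℂ (fourierReal f η) := by
  rw [fourierReal, Real.fourier_eq', Real.fourier_eq', ← integral_conj]
  congr 1
  ext v
  simp only [smul_eq_mul, map_mul, ← Complex.exp_conj, Complex.conj_ofReal,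
    Complex.conj_I, inner_neg_right]
  congr 2
  push_cast
  ring

lemma norm_fourierInv_le (h : Rd d → ℂ) (x : Rd d) : ‖𝓕⁻ h x‖ ≤ ∫ η, ‖h η‖ := by
  rw [Real.fourierInv_eq']
  refine (norm_integral_le_integral_norm _).trans_eq ?_
  congr 1; ext v
  rw [norm_smul, Complex.norm_exp_ofReal_mul_I, one_mul]

lemma continuous_fourierInv {h : Rd d → ℂ} (hh : Integrable h) : Continuous (𝓕⁻ h) := by
  have := VectorFourier.fourierIntegral_continuous (L := innerₗ (Rd d))
      Real.continuous_fourierChar continuous_inner hh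
  have h2 : 𝓕⁻ h = fun x => 𝓕 h (-x) := by ext x; exact Real.fourierInv_eq_fourier_neg h x
  rw [h2]
  exact Continuous.comp (g := 𝓕 h) this continuous_neg

lemma continuous_fourierReal {f : Rd d → ℝ} (hf : Integrable f) : Continuous (fourierReal f) :=
  VectorFourier.fourierIntegral_continuous (L := innerₗ (Rd d))
      Real.continuous_fourierChar continuous_inner hf.ofReal

lemma fourierInv_fourierReal {f : Rd d → ℝ} (hf : Integrable f) (hc : Continuous f)
    (hf' : Integrable (fourierReal f)) (x : Rd d) : 𝓕⁻ (fourierReal f) x = f x :=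
  congrFun ((Complex.continuous_ofReal.comp hc).fourierInv_fourier_eq hf.ofReal hf') x

lemma ofReal_lapPow (j : ℕ) (f : Rd d → ℝ) (x : Rd d) :
    (lapPow α j f x : ℂ)
      = 𝓕⁻ (fun η : Rd d => ((symb α η ^ j : ℝ) : ℂ) * fourierReal f η) x :=
  ofReal_re_fourierInv (fun η => by simp [fourierReal_neg]) x

/-- Parseval's formula, for a function times an inverse Fourier transform. -/
lemma integral_mul_fourierInv_re {f : Rd d → ℝ} {h : Rd d → ℂ} (hf : Integrable f)
    (hh : Integrable h) :
    ∫ x, f x * (𝓕⁻ h x).re = (∫ η, starRingEnd ℂ (fourierReal f η) * h η).re := by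
  have h1 := integral_fourierInv_mul hh (hf.ofReal (𝕜 := ℂ))
  have h2 : ∀ η, 𝓕⁻ (fun x => (f x : ℂ)) η = starRingEnd ℂ (fourierReal f η) := by
    intro η
    rw [Real.fourierInv_eq_fourier_neg, ← fourierReal_neg]; rfl
  have hint : Integrable (fun x => 𝓕⁻ h x * (f x : ℂ)) := by
    refine (hf.ofReal (𝕜 := ℂ)).bdd_mul (c := ∫ η, ‖h η‖)
      (continuous_fourierInv hh).aestronglyMeasurable
      (Eventually.of_forall fun v => norm_fourierInv_le _ _)
  calc ∫ x, f x * (𝓕⁻ h x).re = ∫ x, (𝓕⁻ h x * (f x : ℂ)).re := by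
        congr 1; ext x; simp [mul_comm]
    _ = (∫ x, 𝓕⁻ h x * (f x : ℂ)).re := integral_re hint
    _ = _ := by
        refine (congrArg Complex.re h1).trans ?_
        congr 2; ext η; rw [mul_comm]; exact congrArg (· * h η) (h2 η)

/-! ### The stable density -/

lemma integrable_exp_neg_symb (hα : 0 < α) {t : ℝ} (ht : 0 < t) :
    Integrable (fun η : Rd d => Real.exp (-t * symb α η)) := by
  rcases Nat.eq_zero_or_pos d with rfl | hd
  · have : Finite (Rd 0) := Finite.of_subsingleton
    have : IsFiniteMeasure (volume : Measure (Rd 0)) := CompactSpace.isFiniteMeasure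
    exact Integrable.of_bound (Continuous.aestronglyMeasurable
      (by have := continuous_symb (d := 0) hα; fun_prop)) 1
      (Eventually.of_forall fun η => by
        rw [Real.norm_eq_abs, Real.abs_exp, Real.exp_le_one_iff]
        have := symb_nonneg (α := α) η
        nlinarith)
  · have : Nonempty (Fin d) := ⟨⟨0, hd⟩⟩
    have h := (integrable_fun_norm_addHaar (volume : Measure (Rd d))
      (f := fun r => Real.exp (-t * (2 * Real.pi * r) ^ α))).mpr ?_
    · exact h
    · have hb : 0 < t * (2 * Real.pi) ^ α := by positivity
      refine (integrableOn_rpow_mul_exp_neg_mul_rpow (s := ((d - 1 : ℕ) : ℝ))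
        (by have : (0 : ℝ) ≤ ((d - 1 : ℕ) : ℝ) := by positivity
            linarith) hα hb).congr_fun ?_ measurableSet_Ioi
      intro r hr
      simp only [smul_eq_mul, finrank_euclideanSpace, Fintype.card_fin, Real.rpow_natCast]
      rw [Real.mul_rpow (by positivity) (le_of_lt hr)]
      ring_nf

lemma ofReal_stableDensity (t : ℝ) (x : Rd d) :
    (stableDensity α t x : ℂ) = 𝓕⁻ (fun η : Rd d => ((Real.exp (-t * symb α η) : ℝ) : ℂ)) x :=
  ofReal_re_fourierInv (fun η => by rw [Complex.conj_ofReal, norm_neg]) x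

@[simp] lemma stableDensity_neg (t : ℝ) (x : Rd d) :
    stableDensity α t (-x) = stableDensity α t x := by
  rw [stableDensity, stableDensity, Real.fourierInv_eq_fourier_neg, neg_neg,
    Real.fourierInv_eq_fourier_comp_neg]
  simp

lemma continuous_stableDensity (hα : 0 < α) {t : ℝ} (ht : 0 < t) :
    Continuous (stableDensity α t : Rd d → ℝ) :=
  Complex.continuous_re.comp (continuous_fourierInv (integrable_exp_neg_symb hα ht).ofReal)

lemma measurable_stableDensity (hα : 0 < α) :
    Measurable (fun q : ℝ × Rd d => stableDensity α q.1 q.2) := by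
  have hc := continuous_symb (d := d) hα
  simp only [stableDensity, Real.fourierInv_eq']
  refine Complex.measurable_re.comp (StronglyMeasurable.measurable ?_)
  apply StronglyMeasurable.integral_prod_right
    (f := fun q : ℝ × Rd d => fun v : Rd d =>
      Complex.exp (↑(2 * Real.pi * inner ℝ v q.2) * Complex.I) •
        ((Real.exp (-q.1 * (2 * Real.pi * ‖v‖) ^ α) : ℝ) : ℂ))
  refine Continuous.stronglyMeasurable ?_
  have h2 : Continuous (fun q : (ℝ × Rd d) × Rd d => (2 * Real.pi * ‖q.2‖) ^ α) :=
    hc.comp continuous_snd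
  unfold Function.uncurry
  fun_prop

lemma stableDensity_zero_pos (hα : 0 < α) {t : ℝ} (ht : 0 < t) :
    0 < stableDensity α t (0 : Rd d) := by
  have h1 : stableDensity α t (0 : Rd d) = ∫ η : Rd d, Real.exp (-t * symb α η) := by
    have := ofReal_stableDensity (α := α) t (0 : Rd d)
    rw [Real.fourierInv_eq'] at this
    simp only [inner_zero_right, mul_zero, Complex.ofReal_zero, zero_mul, Complex.exp_zero,
      one_smul, integral_complex_ofReal] at this
    exact_mod_cast this
  rw [h1]
  exact integral_exp_pos (integrable_exp_neg_symb hα ht)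

/-- A nowhere vanishing stable density is positive, since it is continuous and positive at `0`. -/
lemma stableDensity_pos_of_ne_zero (hα : 0 < α) {t : ℝ} (ht : 0 < t)
    (h : ∀ x : Rd d, stableDensity α t x ≠ 0) (x : Rd d) : 0 < stableDensity α t x := by
  by_contra hx
  push Not at hx
  obtain ⟨y, hy⟩ := mem_range_of_exists_le_of_exists_ge (continuous_stableDensity hα ht)
    ⟨x, hx⟩ ⟨0, (stableDensity_zero_pos hα ht).le⟩
  exact h y hy

/-- The Gaussian mean of the stable density, computed on the Fourier side. -/
lemma integral_stableDensity_mul_gaussian (hα : 0 < α) {t : ℝ} (ht : 0 < t) {c : ℝ} (hc : 0 < c) :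
    ((∫ x : Rd d, stableDensity α t x * Real.exp (-c⁻¹ * ‖x‖ ^ 2) : ℝ) : ℂ) =
      ∫ η : Rd d, ((Real.pi * c : ℂ) ^ (Module.finrank ℝ (Rd d) / 2 : ℂ) *
        Complex.exp (-Real.pi ^ 2 * c * ‖(0 : Rd d) - η‖ ^ 2)) •
          ((Real.exp (-t * symb α η) : ℝ) : ℂ) := by
  have hc' : 0 < (c⁻¹ : ℂ).re := by rw [← Complex.ofReal_inv, Complex.ofReal_re]; positivity
  have hG : Integrable (fun x : Rd d => Complex.exp (-(c⁻¹ : ℂ) * ‖x‖ ^ 2)) := by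
    simpa using GaussianFourier.integrable_cexp_neg_mul_sq_norm_add hc' 0 (0 : Rd d)
  have h1 := integral_fourierInv_mul
    ((integrable_exp_neg_symb (d := d) hα ht).ofReal (𝕜 := ℂ)) hG
  rw [← integral_complex_ofReal]
  calc _ = ∫ x, 𝓕⁻ (fun η : Rd d => ((Real.exp (-t * symb α η) : ℝ) : ℂ)) x *
        Complex.exp (-(c⁻¹ : ℂ) * ‖x‖ ^ 2) := by
        congr 1; ext x
        push_cast
        rw [ofReal_stableDensity]
        simp
    _ = _ := h1
    _ = _ := by
        congr 1; ext η
        rw [Real.fourierInv_eq_fourier_neg, fourier_gaussian_innerProductSpace hc']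
        simp only [norm_neg, zero_sub, smul_eq_mul, div_inv_eq_mul]
        rw [mul_comm]
        congr 3
        ring

lemma integrable_gaussian {b : ℝ} (hb : 0 < b) :
    Integrable (fun x : Rd d => Real.exp (-b * ‖x‖ ^ 2)) := by
  have := (GaussianFourier.integrable_cexp_neg_mul_sq_norm_add (b := b) (by simpa) 0 (0 : Rd d)).re
  refine this.congr (Eventually.of_forall fun x => ?_)
  simp only [zero_mul, add_zero]
  rw [← Complex.exp_ofReal_re]
  simp

lemma integrable_stableDensity_mul_gaussian (hα : 0 < α) {t : ℝ} (ht : 0 < t) {b : ℝ}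
    (hb : 0 < b) :
    Integrable (fun x : Rd d => stableDensity α t x * Real.exp (-b * ‖x‖ ^ 2)) := by
  refine (integrable_gaussian hb).bdd_mul
    (c := ∫ η : Rd d, ‖((Real.exp (-t * symb α η) : ℝ) : ℂ)‖)
    (continuous_stableDensity hα ht).aestronglyMeasurable (Eventually.of_forall fun x => ?_)
  exact (Complex.abs_re_le_norm _).trans (norm_fourierInv_le _ x)

/-- A positive stable density has total mass one: a Gaussian cut-off makes the integral computable
on the Fourier side, and monotone convergence removes it. Integrability of the density is not known
beforehand, hence the statement with values in `[0, ∞]`. -/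
lemma lintegral_stableDensity (hα : 0 < α) {t : ℝ} (ht : 0 < t)
    (hpos : ∀ x : Rd d, 0 < stableDensity α t x) :
    ∫⁻ x : Rd d, ENNReal.ofReal (stableDensity α t x) = 1 := by
  have hcp := continuous_stableDensity (d := d) hα ht
  set F : ℕ → Rd d → ENNReal := fun n x =>
    ENNReal.ofReal (stableDensity α t x * Real.exp (-((n : ℝ) + 1)⁻¹ * ‖x‖ ^ 2)) with hF
  have hmono : ∀ᵐ x : Rd d, Monotone fun n => F n x := by
    refine Eventually.of_forall fun x n m hnm => ENNReal.ofReal_le_ofReal ?_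
    refine mul_le_mul_of_nonneg_left (Real.exp_le_exp.mpr ?_) (hpos x).le
    have : ((m : ℝ) + 1)⁻¹ ≤ ((n : ℝ) + 1)⁻¹ := by gcongr
    nlinarith [sq_nonneg ‖x‖]
  have hlim : ∀ᵐ x : Rd d, Tendsto (fun n => F n x) atTop
      (𝓝 (ENNReal.ofReal (stableDensity α t x))) := by
    refine Eventually.of_forall fun x => ENNReal.tendsto_ofReal ?_
    have h0 : Tendsto (fun n : ℕ => ((n : ℝ) + 1)⁻¹) atTop (𝓝 0) := by
      simpa using tendsto_one_div_add_atTop_nhds_zero_nat (𝕜 := ℝ)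
    have : Tendsto (fun n : ℕ => stableDensity α t x * Real.exp (-((n : ℝ) + 1)⁻¹ * ‖x‖ ^ 2))
        atTop (𝓝 (stableDensity α t x * Real.exp (-0 * ‖x‖ ^ 2))) :=
      ((Real.continuous_exp.tendsto _).comp (h0.neg.mul_const _)).const_mul _
    simpa using this
  have h1 := lintegral_tendsto_of_tendsto_of_monotone
    (fun n => (Continuous.measurable (by fun_prop)).ennreal_ofReal.aemeasurable) hmono hlim
  refine tendsto_nhds_unique h1 ?_
  have h2 : ∀ n, ∫⁻ x, F n x
      = ENNReal.ofReal
        (∫ x : Rd d, stableDensity α t x * Real.exp (-((n : ℝ) + 1)⁻¹ * ‖x‖ ^ 2)) := by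
    intro n
    rw [ofReal_integral_eq_lintegral_ofReal]
    · exact integrable_stableDensity_mul_gaussian hα ht (by positivity)
    · exact Eventually.of_forall fun x => mul_nonneg (hpos x).le (Real.exp_nonneg _)
  -- On the Fourier side the cut-off is an approximate identity at `0`, where the symbol vanishes.
  have h3 := (Real.tendsto_integral_gaussian_smul'
    ((integrable_exp_neg_symb (d := d) hα ht).ofReal (𝕜 := ℂ)) (v := 0)
    (Continuous.continuousAt (by have := continuous_symb (d := d) hα; fun_prop))).comp
    (tendsto_natCast_atTop_atTop.atTop_add (tendsto_const_nhds (x := (1 : ℝ))))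
  have h4 : Tendsto (fun n : ℕ => (∫ x : Rd d, stableDensity α t x *
      Real.exp (-((n : ℝ) + 1)⁻¹ * ‖x‖ ^ 2))) atTop (𝓝 1) := by
    have h5 := (Complex.continuous_re.tendsto _).comp h3
    have h0 : symb α (0 : Rd d) = 0 := by simp [symb, Real.zero_rpow hα.ne']
    simp only [RCLike.ofReal_eq_complex_ofReal, h0, mul_zero, Real.exp_zero, Complex.ofReal_one,
      Complex.one_re] at h5
    refine h5.congr fun n => ?_
    have h6 := congrArg Complex.re
      (integral_stableDensity_mul_gaussian (d := d) hα ht (by positivity : (0 : ℝ) < n + 1))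
    rw [Complex.ofReal_re] at h6
    exact h6.symm
  refine Tendsto.congr (fun n => (h2 n).symm) ?_
  simpa using ENNReal.tendsto_ofReal h4

end

section

/-! ### The stable semigroup -/

/-- Positivity of all stable densities of index `α` in dimension `d`. -/
def PositiveDensities (d : ℕ) (α : ℝ) : Prop :=
  ∀ t : ℝ, 0 < t → ∀ x : Rd d, 0 < stableDensity α t x

/-- The stable semigroup `P_u f(x) = ∫ p_u(x - y) f(y) dy`. -/
def heatOp {d : ℕ} (α u : ℝ) (f : Rd d → ℝ) (x : Rd d) : ℝ :=
  ∫ y, stableDensity α u (x - y) * f y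

variable {d : ℕ} {α : ℝ}

lemma stableDensity_sub_comm (t : ℝ) (x y : Rd d) :
    stableDensity α t (x - y) = stableDensity α t (y - x) := by
  rw [← stableDensity_neg, neg_sub]

lemma integrable_stableDensity (hα : 0 < α) (hp : PositiveDensities d α) {t : ℝ} (ht : 0 < t) :
    Integrable (stableDensity α t : Rd d → ℝ) := by
  refine ⟨(continuous_stableDensity hα ht).aestronglyMeasurable, ?_⟩
  rw [hasFiniteIntegral_iff_ofReal (Eventually.of_forall fun x => (hp t ht x).le),
    lintegral_stableDensity hα ht (hp t ht)]
  exact ENNReal.one_lt_top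

lemma integral_stableDensity (hα : 0 < α) (hp : PositiveDensities d α) {t : ℝ} (ht : 0 < t) :
    ∫ x : Rd d, stableDensity α t x = 1 := by
  rw [integral_eq_lintegral_of_nonneg_ae (Eventually.of_forall fun x => (hp t ht x).le)
    (continuous_stableDensity hα ht).aestronglyMeasurable,
    lintegral_stableDensity hα ht (hp t ht), ENNReal.toReal_one]

lemma integrable_stableDensity_sub (hα : 0 < α) (hp : PositiveDensities d α) {t : ℝ} (ht : 0 < t)
    (x : Rd d) : Integrable (fun y => stableDensity α t (x - y)) :=
  (integrable_stableDensity hα hp ht).comp_sub_left x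

lemma integral_stableDensity_sub (hα : 0 < α) (hp : PositiveDensities d α) {t : ℝ} (ht : 0 < t)
    (x : Rd d) : ∫ y, stableDensity α t (x - y) = 1 := by
  rw [integral_sub_left_eq_self (fun y => stableDensity α t y), integral_stableDensity hα hp ht]

lemma integrable_stableDensity_mul (hα : 0 < α) (hp : PositiveDensities d α) {t : ℝ} (ht : 0 < t)
    (x : Rd d) {f : Rd d → ℝ} (hf : Measurable f) {M : ℝ} (hM : ∀ y, |f y| ≤ M) :
    Integrable (fun y => stableDensity α t (x - y) * f y) :=
  (integrable_stableDensity_sub hα hp ht x).mul_bdd hf.aestronglyMeasurable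
    (Eventually.of_forall hM)

lemma heatOp_const (hα : 0 < α) (hp : PositiveDensities d α) {t : ℝ} (ht : 0 < t) (c : ℝ) :
    heatOp α t (fun _ : Rd d => c) = fun _ => c := by
  ext x
  rw [heatOp, integral_mul_const, integral_stableDensity_sub hα hp ht, one_mul]

/-- The semigroup is a contraction for the supremum norm. -/
lemma abs_heatOp_le (hα : 0 < α) (hp : PositiveDensities d α) {t : ℝ} (ht : 0 < t)
    {f : Rd d → ℝ} {M : ℝ} (hM : ∀ y, |f y| ≤ M) (x : Rd d) :
    |heatOp α t f x| ≤ M := by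
  have h := norm_integral_le_of_norm_le (f := fun y => stableDensity α t (x - y) * f y)
    ((integrable_stableDensity_sub hα hp ht x).mul_const M) (Eventually.of_forall fun y => by
      rw [Real.norm_eq_abs, abs_mul, abs_of_pos (hp t ht _)]
      exact mul_le_mul_of_nonneg_left (hM y) (hp t ht _).le)
  rwa [integral_mul_const, integral_stableDensity_sub hα hp ht, one_mul] at h

lemma abs_heatOp_sub_le (hα : 0 < α) (hp : PositiveDensities d α) {t : ℝ} (ht : 0 < t)
    {f g : Rd d → ℝ} (hf : Measurable f) (hg : Measurable g) {A B M : ℝ} (hA : ∀ y, |f y| ≤ A)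
    (hB : ∀ y, |g y| ≤ B) (hM : ∀ y, |f y - g y| ≤ M) (x : Rd d) :
    |heatOp α t f x - heatOp α t g x| ≤ M := by
  have : heatOp α t f x - heatOp α t g x = heatOp α t (fun y => f y - g y) x := by
    rw [heatOp, heatOp, heatOp, ← integral_sub (integrable_stableDensity_mul hα hp ht x hf hA)
      (integrable_stableDensity_mul hα hp ht x hg hB)]
    congr 1; ext y; ring
  rw [this]
  exact abs_heatOp_le hα hp ht hM x

lemma measurable_heatOp (hα : 0 < α) {f : Rd d → ℝ} (hf : Measurable f) :
    Measurable (fun q : ℝ × Rd d => heatOp α q.1 f q.2) := by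
  have h1 : Measurable (fun q : (ℝ × Rd d) × Rd d => stableDensity α q.1.1 (q.1.2 - q.2)) :=
    (measurable_stableDensity hα).comp (f := fun q : (ℝ × Rd d) × Rd d => (q.1.1, q.1.2 - q.2))
      (by fun_prop)
  have h2 : StronglyMeasurable
      (fun q : (ℝ × Rd d) × Rd d => stableDensity α q.1.1 (q.1.2 - q.2) * f q.2) :=
    (h1.mul (hf.comp measurable_snd)).stronglyMeasurable
  exact h2.integral_prod_right'.measurable

lemma measurable_heatOp_apply (hα : 0 < α) (t : ℝ) {f : Rd d → ℝ} (hf : Measurable f) :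
    Measurable (heatOp α t f) :=
  (measurable_heatOp hα hf).comp (f := fun x : Rd d => (t, x)) (by fun_prop)

lemma integrable_mul_stableDensity_prod (hα : 0 < α) (hp : PositiveDensities d α) {t : ℝ}
    (ht : 0 < t) {g : Rd d → ℝ} (hg : Integrable g) :
    Integrable (fun q : Rd d × Rd d => g q.1 * stableDensity α t (q.1 - q.2)) := by
  have hm : AEStronglyMeasurable (fun q : Rd d × Rd d => g q.1 * stableDensity α t (q.1 - q.2))
      (volume.prod volume) :=
    hg.1.comp_fst.mul ((continuous_stableDensity hα ht).comp
      (continuous_fst.sub continuous_snd)).aestronglyMeasurable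
  refine (integrable_prod_iff hm).mpr
    ⟨Eventually.of_forall fun x =>
      (integrable_stableDensity_sub hα hp ht x).const_mul (g x), ?_⟩
  refine hg.norm.congr (Eventually.of_forall fun x => ?_)
  simp only [norm_mul, integral_const_mul]
  simp only [Real.norm_eq_abs, abs_of_pos (hp t ht _), integral_stableDensity_sub hα hp ht,
    mul_one]

/-- The semigroup is symmetric. -/
lemma integral_heatOp_mul (hα : 0 < α) (hp : PositiveDensities d α) {t : ℝ} (ht : 0 < t)
    {f g : Rd d → ℝ} (hf : Measurable f) (hg : Integrable g) {M : ℝ} (hM : ∀ y, |f y| ≤ M) :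
    ∫ x, heatOp α t f x * g x = ∫ x, f x * heatOp α t g x := by
  have h1 : ∀ x, heatOp α t f x * g x = ∫ y, stableDensity α t (x - y) * f y * g x := by
    intro x; rw [heatOp, integral_mul_const]
  have h2 : ∀ y, f y * heatOp α t g y = ∫ x, stableDensity α t (x - y) * f y * g x := by
    intro y
    rw [heatOp, ← integral_const_mul]
    congr 1; ext x; rw [stableDensity_sub_comm]; ring
  simp_rw [h1, h2]
  refine integral_integral_swap ?_
  refine ((integrable_mul_stableDensity_prod hα hp ht hg).mul_bdd (g := fun q => f q.2) (c := M)
    (hf.comp measurable_snd).aestronglyMeasurable (Eventually.of_forall fun q => hM q.2)).congr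
    (Eventually.of_forall fun q => ?_)
  simp only [Function.uncurry]; ring

/-- The semigroup is the Fourier multiplier with symbol `exp (-t |ξ|^α)`. -/
lemma ofReal_heatOp (hα : 0 < α) {t : ℝ} (ht : 0 < t) {f : Rd d → ℝ} (hf : Integrable f)
    (x : Rd d) :
    (heatOp α t f x : ℂ)
      = 𝓕⁻ (fun η => ((Real.exp (-t * symb α η) : ℝ) : ℂ) * fourierReal f η) x := by
  have hφ := (integrable_exp_neg_symb (d := d) hα ht).ofReal (𝕜 := ℂ)
  rw [heatOp, ← integral_complex_ofReal]
  simp only [Complex.ofReal_mul (stableDensity _ _ _), ofReal_stableDensity, Real.fourierInv_eq',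
    fourierReal, Real.fourier_eq']
  simp_rw [← integral_mul_const, smul_eq_mul, ← integral_const_mul]
  rw [integral_integral_swap]
  · congr 1; ext η; congr 1; ext y
    rw [inner_sub_right, real_inner_comm η y]
    have : Complex.exp (↑(2 * Real.pi * (inner ℝ η x - inner ℝ η y)) * Complex.I)
      = Complex.exp (↑(2 * Real.pi * inner ℝ η x) * Complex.I)
        * Complex.exp (↑(-2 * Real.pi * inner ℝ η y) * Complex.I) := by
      rw [← Complex.exp_add]; congr 1; push_cast; ring
    rw [this]; ring
  · refine (((hf.ofReal (𝕜 := ℂ)).mul_prod hφ).bdd_mul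
      (f := fun q : Rd d × Rd d =>
        Complex.exp (↑(2 * Real.pi * inner ℝ q.2 (x - q.1)) * Complex.I)) (c := 1)
      (Continuous.aestronglyMeasurable (by fun_prop))
      (Eventually.of_forall fun v => by rw [Complex.norm_exp_ofReal_mul_I])).congr
      (Eventually.of_forall fun q => ?_)
    simp only [Function.uncurry, RCLike.ofReal_eq_complex_ofReal]
    ring_nf

/-! ### Functions whose Fourier transform decays, and powers of the fractional Laplacian -/

/-- Continuous integrable functions `f` for which every `|ξ|^{jα} f̂(ξ)` is integrable: on this
class every power of `(-Δ)^{α/2}` is given by an absolutely convergent integral. -/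
structure FourierDecay {d : ℕ} (α : ℝ) (f : Rd d → ℝ) : Prop where
  continuous : Continuous f
  integrable : Integrable f
  symb_integrable : ∀ j : ℕ, Integrable (fun η => symb α η ^ j * ‖fourierReal f η‖)

namespace FourierDecay

variable {f g : Rd d → ℝ}

lemma integrable_mul (hα : 0 < α) (hf : FourierDecay α f) (j : ℕ) :
    Integrable (fun η => ((symb α η ^ j : ℝ) : ℂ) * fourierReal f η) := by
  refine (integrable_norm_iff ?_).mp ((hf.symb_integrable j).congr
    (Eventually.of_forall fun η => ?_))
  · have h1 := continuous_symb (d := d) hα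
    have h2 := continuous_fourierReal hf.integrable
    exact Continuous.aestronglyMeasurable (by fun_prop)
  · simp [abs_of_nonneg (symb_nonneg (α := α) η)]

lemma fourier_integrable (hα : 0 < α) (hf : FourierDecay α f) : Integrable (fourierReal f) := by
  simpa using hf.integrable_mul hα 0

lemma lapPow_zero (hα : 0 < α) (hf : FourierDecay α f) (x : Rd d) : lapPow α 0 f x = f x := by
  have h := ofReal_lapPow (α := α) 0 f x
  simp only [pow_zero, Complex.ofReal_one, one_mul] at h
  have h2 := fourierInv_fourierReal hf.integrable hf.continuous (hf.fourier_integrable hα) x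
  exact_mod_cast h.trans h2

lemma continuous_lapPow (hα : 0 < α) (hf : FourierDecay α f) (j : ℕ) :
    Continuous (lapPow α j f) :=
  Complex.continuous_re.comp (continuous_fourierInv (hf.integrable_mul hα j))

lemma abs_lapPow_le (j : ℕ) (f : Rd d → ℝ) (x : Rd d) :
    |lapPow α j f x| ≤ ∫ η, symb α η ^ j * ‖fourierReal f η‖ := by
  refine (Complex.abs_re_le_norm _).trans ((norm_fourierInv_le _ x).trans_eq ?_)
  congr 1; ext η
  simp [abs_of_nonneg (symb_nonneg (α := α) η)]

/-- The powers of the fractional Laplacian are symmetric. -/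
lemma integral_mul_lapPow_comm (hα : 0 < α) (hf : FourierDecay α f) (hg : FourierDecay α g)
    (j : ℕ) : ∫ x, f x * lapPow α j g x = ∫ x, lapPow α j f x * g x := by
  have h1 := integral_mul_fourierInv_re hf.integrable (hg.integrable_mul hα j)
  have h2 := integral_mul_fourierInv_re hg.integrable (hf.integrable_mul hα j)
  calc _ = _ := h1
    _ = (∫ η, starRingEnd ℂ (starRingEnd ℂ (fourierReal g η) *
          (((symb α η ^ j : ℝ) : ℂ) * fourierReal f η))).re := by
        congr 2; ext η
        simp only [map_mul, Complex.conj_conj, Complex.conj_ofReal]; ring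
    _ = _ := by rw [integral_conj, Complex.conj_re, ← h2]
    _ = _ := by congr 1; ext x; rw [mul_comm]; rfl

lemma integral_mul_lapPow (hα : 0 < α) (hf : FourierDecay α f) (j : ℕ) :
    ∫ x, f x * lapPow α j f x = ∫ η, symb α η ^ j * ‖fourierReal f η‖ ^ 2 := by
  have h1 := integral_mul_fourierInv_re hf.integrable (hf.integrable_mul hα j)
  refine h1.trans ?_
  have : ∀ η, starRingEnd ℂ (fourierReal f η) * (((symb α η ^ j : ℝ) : ℂ) * fourierReal f η)
      = ((symb α η ^ j * ‖fourierReal f η‖ ^ 2 : ℝ) : ℂ) := by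
    intro η
    have := Complex.conj_mul' (fourierReal f η)
    push_cast
    rw [← this]; ring
  simp_rw [this]
  rw [integral_complex_ofReal, Complex.ofReal_re]

lemma fourierReal_lapPow (hα : 0 < α) (hf : FourierDecay α f) (j : ℕ)
    (hi : Integrable (lapPow α j f)) (η : Rd d) :
    fourierReal (lapPow α j f) η = ((symb α η ^ j : ℝ) : ℂ) * fourierReal f η := by
  have h1 := continuous_symb (d := d) hα
  have h2 := continuous_fourierReal hf.integrable
  have hc : Continuous (fun η : Rd d => ((symb α η ^ j : ℝ) : ℂ) * fourierReal f η) := by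
    fun_prop
  have h3 : 𝓕⁻ (fun η : Rd d => ((symb α η ^ j : ℝ) : ℂ) * fourierReal f η)
      = fun x => (lapPow α j f x : ℂ) := by ext x; rw [ofReal_lapPow]
  have h5 : 𝓕 (fun η : Rd d => ((symb α η ^ j : ℝ) : ℂ) * fourierReal f η)
      = fun x => ((lapPow α j f (-x) : ℝ) : ℂ) := by
    ext x; rw [ofReal_lapPow, Real.fourierInv_eq_fourier_neg, neg_neg]
  have h4 := hc.fourier_fourierInv_eq (hf.integrable_mul hα j) (h5 ▸ hi.comp_neg.ofReal)
  rw [h3] at h4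
  exact congrFun h4 η

/-- Integrability of `(-Δ)^{α/2} f` is what allows the operator to be applied once more. -/
lemma of_lapPow_one (hα : 0 < α) (hf : FourierDecay α f) (hi : Integrable (lapPow α 1 f)) :
    FourierDecay α (lapPow α 1 f) where
  continuous := hf.continuous_lapPow hα 1
  integrable := hi
  symb_integrable j := (hf.symb_integrable (j + 1)).congr (Eventually.of_forall fun η => by
    simp only [hf.fourierReal_lapPow hα 1 hi, pow_one, norm_mul, Complex.norm_real,
      Real.norm_eq_abs, abs_of_nonneg (symb_nonneg (α := α) η)]
    ring)

lemma lapPow_lapPow_one (hα : 0 < α) (hf : FourierDecay α f) (hi : Integrable (lapPow α 1 f))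
    (j : ℕ) : lapPow α j (lapPow α 1 f) = lapPow α (j + 1) f := by
  ext x
  have h : (fun η => ((symb α η ^ j : ℝ) : ℂ) * fourierReal (lapPow α 1 f) η)
      = fun η => ((symb α η ^ (j + 1) : ℝ) : ℂ) * fourierReal f η := by
    ext η
    rw [hf.fourierReal_lapPow hα 1 hi]
    push_cast
    ring
  rw [lapPow, lapPow, h]

end FourierDecay

/-- Taylor's formula for `exp (-x)` at `0`, with a remainder that is uniform in `x ≥ 0`. -/
lemma abs_exp_neg_sub_sum_le (n : ℕ) {x : ℝ} (hx : 0 ≤ x) :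
    |Real.exp (-x) - ∑ j ∈ Finset.range n, (-x) ^ j / j.factorial| ≤ (n + 3) * x ^ n := by
  -- For `x ≥ 1` every term of the sum, and `exp (-x)` itself, is at most `x ^ n`.
  rcases le_total x 1 with h | h
  · have h1 := Complex.norm_exp_sub_sum_le_norm_mul_exp ((-x : ℝ) : ℂ) n
    have h2 : Complex.exp ((-x : ℝ) : ℂ) -
        ∑ m ∈ Finset.range n, ((-x : ℝ) : ℂ) ^ m / (m.factorial : ℂ)
        = ((Real.exp (-x) - ∑ j ∈ Finset.range n, (-x) ^ j / j.factorial : ℝ) : ℂ) := by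
      push_cast; rfl
    rw [h2, Complex.norm_real, Complex.norm_real, norm_neg, Real.norm_eq_abs, Real.norm_eq_abs,
      abs_of_nonneg hx] at h1
    have h3 : Real.exp x ≤ n + 3 := by
      have := (Real.exp_le_exp.mpr h).trans Real.exp_one_lt_d9.le
      have : (0 : ℝ) ≤ n := by positivity
      linarith
    calc _ ≤ _ := h1
      _ ≤ x ^ n * (n + 3) := by gcongr
      _ = _ := mul_comm _ _
  · have h1 : (1 : ℝ) ≤ x ^ n := one_le_pow₀ h
    have h2 : |∑ j ∈ Finset.range n, (-x) ^ j / (j.factorial : ℝ)| ≤ n * x ^ n := by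
      refine (Finset.abs_sum_le_sum_abs _ _).trans ?_
      refine (Finset.sum_le_card_nsmul _ _ (x ^ n) fun j hj => ?_).trans_eq (by simp)
      rw [abs_div, abs_pow, abs_neg, abs_of_nonneg hx, Nat.abs_cast]
      have hj1 : (1 : ℝ) ≤ j.factorial := by exact_mod_cast j.factorial_pos
      exact (div_le_self (by positivity) hj1).trans
        (pow_le_pow_right₀ h (Finset.mem_range.mp hj).le)
    have h3 : |Real.exp (-x)| ≤ 1 := by
      rw [Real.abs_exp]; exact Real.exp_le_one_iff.mpr (by linarith)
    calc _ ≤ |Real.exp (-x)| + |∑ j ∈ Finset.range n, (-x) ^ j / (j.factorial : ℝ)| :=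
          abs_sub _ _
      _ ≤ x ^ n + n * x ^ n := by linarith
      _ ≤ _ := by nlinarith

/-- Taylor expansion of the semigroup at time `0`, uniformly in space. -/
lemma FourierDecay.abs_heatOp_sub_le (hα : 0 < α) {f : Rd d → ℝ} (hf : FourierDecay α f) (n : ℕ)
    {u : ℝ} (hu : 0 < u) (x : Rd d) :
    |heatOp α u f x - ∑ j ∈ Finset.range n, (-u) ^ j / j.factorial * lapPow α j f x|
      ≤ ((n + 3) * ∫ η, symb α η ^ n * ‖fourierReal f η‖) * u ^ n := by
  have hc := continuous_symb (d := d) hα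
  have hc2 := continuous_fourierReal hf.integrable
  set h : Rd d → ℂ := fun η =>
    ((Real.exp (-(u * symb α η)) - ∑ j ∈ Finset.range n, (-(u * symb α η)) ^ j / j.factorial :
      ℝ) : ℂ) * fourierReal f η with hh
  have e1 : ((heatOp α u f x - ∑ j ∈ Finset.range n, (-u) ^ j / j.factorial * lapPow α j f x : ℝ)
      : ℂ) = 𝓕⁻ h x := by
    have hint1 : Integrable (fun η => ((Real.exp (-u * symb α η) : ℝ) : ℂ) * fourierReal f η) := by
      refine (hf.fourier_integrable hα).bdd_mul (c := 1)
        (Continuous.aestronglyMeasurable (by fun_prop)) (Eventually.of_forall fun η => ?_)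
      rw [Complex.norm_real, Real.norm_eq_abs, Real.abs_exp, Real.exp_le_one_iff]
      have := symb_nonneg (α := α) η
      nlinarith
    have hh' : h = fun η => ((Real.exp (-u * symb α η) : ℝ) : ℂ) * fourierReal f η -
        ∑ j ∈ Finset.range n, (((-u) ^ j / j.factorial : ℝ) : ℂ) *
          (((symb α η ^ j : ℝ) : ℂ) * fourierReal f η) := by
      ext η
      simp only [hh]
      push_cast
      rw [sub_mul, Finset.sum_mul]
      congr 1
      · ring_nf
      · refine Finset.sum_congr rfl fun j _ => ?_
        rw [neg_mul_eq_neg_mul, mul_pow]; ring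
    push_cast
    rw [ofReal_heatOp hα hu hf.integrable, hh']
    simp only [ofReal_lapPow, Real.fourierInv_eq', smul_eq_mul]
    have hk := integrable_fourierInv_kernel hint1 x
    have hk2 := fun j => integrable_fourierInv_kernel (hf.integrable_mul hα j) x
    simp only [smul_eq_mul] at hk hk2
    simp_rw [mul_sub, Finset.mul_sum]
    rw [integral_sub hk, integral_finsetSum]
    · congr 1
      refine Finset.sum_congr rfl fun j _ => ?_
      rw [← integral_const_mul]
      congr 1; ext η; push_cast; ring
    · intro j _
      refine ((hk2 j).const_mul (((-u) ^ j / j.factorial : ℝ) : ℂ)).congr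
        (Eventually.of_forall fun η => ?_)
      simp only; ring
    · refine integrable_finsetSum _ fun j _ => ?_
      refine ((hk2 j).const_mul (((-u) ^ j / j.factorial : ℝ) : ℂ)).congr
        (Eventually.of_forall fun η => ?_)
      simp only; ring
  rw [← Real.norm_eq_abs, ← Complex.norm_real, e1]
  refine (norm_fourierInv_le h x).trans ?_
  rw [mul_right_comm, ← integral_const_mul]
  refine integral_mono_of_nonneg (Eventually.of_forall fun η => norm_nonneg _)
    ((hf.symb_integrable n).const_mul _) (Eventually.of_forall fun η => ?_)
  simp only [hh, norm_mul, Complex.norm_real, Real.norm_eq_abs]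
  have hs := mul_nonneg hu.le (symb_nonneg (α := α) η)
  calc _ ≤ ((n + 3) * (u * symb α η) ^ n) * ‖fourierReal f η‖ :=
        mul_le_mul_of_nonneg_right (abs_exp_neg_sub_sum_le n hs) (norm_nonneg _)
    _ = _ := by rw [mul_pow]; ring

/-- Schwartz functions have Fourier transforms that decay. -/
lemma fourierDecay_schwartz (hα : 0 < α) (V : 𝓢(Rd d, ℝ)) : FourierDecay α V where
  continuous := V.continuous
  integrable := V.integrable
  symb_integrable j := by
    set W : 𝓢(Rd d, ℂ) := 𝓕 (SchwartzMap.postcompCLM (𝕜 := ℝ) Complex.ofRealCLM V) with hW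
    have hWV : ∀ η, fourierReal V η = W η := by
      intro η
      rw [hW, SchwartzMap.fourier_coe]
      rfl
    obtain ⟨k, hk⟩ := exists_nat_ge (α * j)
    have hI := (W.integrable_pow_mul volume 0).add
      ((W.integrable_pow_mul volume k).const_mul ((2 * Real.pi) ^ k))
    have hc := continuous_symb (d := d) hα
    have hc2 := continuous_fourierReal (f := V) V.integrable
    refine hI.mono' (Continuous.aestronglyMeasurable (by fun_prop))
      (Eventually.of_forall fun η => ?_)
    have h0 : 0 ≤ 2 * Real.pi * ‖η‖ := by positivity
    have h1 : symb α η ^ j ≤ 1 + (2 * Real.pi * ‖η‖) ^ k := by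
      rw [symb, ← Real.rpow_natCast, ← Real.rpow_mul h0]
      rcases le_total (2 * Real.pi * ‖η‖) 1 with h | h
      · have := Real.rpow_le_one h0 h (by positivity : 0 ≤ α * j)
        have h2 : 0 ≤ (2 * Real.pi * ‖η‖) ^ k := by positivity
        linarith
      · have := Real.rpow_le_rpow_of_exponent_le h hk
        rw [Real.rpow_natCast] at this
        linarith
    rw [Real.norm_eq_abs, abs_of_nonneg (mul_nonneg (pow_nonneg (symb_nonneg η) _)
      (norm_nonneg _)), hWV]
    calc _ ≤ (1 + (2 * Real.pi * ‖η‖) ^ k) * ‖W η‖ := by gcongr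
      _ = _ := by simp only [Pi.add_apply, pow_zero, mul_pow]; ring

end

section

/-! ### Integrability of the fractional Laplacian of a Schwartz function -/

variable {d : ℕ} {α : ℝ}

/-- The `L¹` modulus of continuity of a `C¹` function is controlled by the `L¹` norm of its
derivative. -/
lemma lintegral_enorm_translate_sub_le {F : Type*} [NormedAddCommGroup F] [NormedSpace ℝ F]
    [CompleteSpace F] {W : Rd d → F} (hW : ContDiff ℝ 1 W) (z : Rd d) :
    ∫⁻ x, ‖W (x + z) - W x‖ₑ ≤ ‖z‖ₑ * ∫⁻ x, ‖fderiv ℝ W x‖ₑ := by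
  have hc : Continuous (fderiv ℝ W) := hW.continuous_fderiv one_ne_zero
  have h1 : ∀ x, ‖W (x + z) - W x‖ₑ ≤ ∫⁻ r in Ioc (0 : ℝ) 1, ‖fderiv ℝ W (x + r • z)‖ₑ * ‖z‖ₑ := by
    intro x
    have h2 : ∫ r in (0 : ℝ)..1, fderiv ℝ W (x + r • z) z = W (x + z) - W x := by
      have := intervalIntegral.integral_eq_sub_of_hasDerivAt (a := 0) (b := 1)
        (f := fun r : ℝ => W (x + r • z)) (f' := fun r => fderiv ℝ W (x + r • z) z)
        (fun r _ => by
          have h3 : HasDerivAt (fun r : ℝ => x + r • z) z r := by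
            simpa using ((hasDerivAt_id r).smul_const z).const_add x
          exact ((hW.differentiable one_ne_zero _).hasFDerivAt).comp_hasDerivAt r h3)
        (Continuous.intervalIntegrable (by fun_prop) _ _)
      simpa using this
    rw [← h2, intervalIntegral.integral_of_le zero_le_one]
    refine (enorm_integral_le_lintegral_enorm _).trans (lintegral_mono fun r => ?_)
    exact ContinuousLinearMap.le_opENorm _ _
  calc _ ≤ ∫⁻ x, ∫⁻ r in Ioc (0 : ℝ) 1, ‖fderiv ℝ W (x + r • z)‖ₑ * ‖z‖ₑ := lintegral_mono h1
    _ = ∫⁻ r in Ioc (0 : ℝ) 1, ∫⁻ x, ‖fderiv ℝ W (x + r • z)‖ₑ * ‖z‖ₑ := by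
        refine lintegral_lintegral_swap (Continuous.aemeasurable ?_)
        simp only [Function.uncurry_def]
        exact (ENNReal.continuous_mul_const enorm_ne_top).comp (by fun_prop)
    _ = ∫⁻ r in Ioc (0 : ℝ) 1, ‖z‖ₑ * ∫⁻ x, ‖fderiv ℝ W x‖ₑ := by
        congr 1; ext r
        rw [lintegral_mul_const' _ _ enorm_ne_top, mul_comm,
          lintegral_add_right_eq_self (fun x => ‖fderiv ℝ W x‖ₑ)]
    _ = _ := by simp

/-- Second differences of a Schwartz function are of order `min (1, |z|²)` in `L¹`. -/
lemma exists_lintegral_second_difference_le (V : 𝓢(Rd d, ℝ)) :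
    ∃ C : ℝ, 0 ≤ C ∧ ∀ z : Rd d, ∫⁻ x, ‖V (x + z) + V (x - z) - 2 * V x‖ₑ
      ≤ ENNReal.ofReal (C * (1 - Real.exp (-‖z‖ ^ 2))) := by
  -- `A` bounds the `L¹` norm of a second difference outright, and `B ‖z‖²` by two
  -- applications of the modulus of continuity.
  set A : ℝ := 4 * ∫ x, ‖V x‖
  set W : 𝓢(Rd d, Rd d →L[ℝ] ℝ) := SchwartzMap.fderivCLM ℝ (Rd d) ℝ V with hW
  set U := SchwartzMap.fderivCLM ℝ (Rd d) (Rd d →L[ℝ] ℝ) W with hU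
  set B : ℝ := ∫ x, ‖U x‖
  have hA0 : 0 ≤ A := by positivity
  have hB0 : 0 ≤ B := by positivity
  have hA : ∀ z : Rd d, ∫⁻ x, ‖V (x + z) + V (x - z) - 2 * V x‖ₑ ≤ ENNReal.ofReal A := by
    intro z
    have hV : ENNReal.ofReal (∫ x, ‖V x‖) = ∫⁻ x, ‖V x‖ₑ :=
      ofReal_integral_norm_eq_lintegral_enorm V.integrable
    have hm : Measurable fun x => ‖V x‖ₑ := V.continuous.measurable.enorm
    calc _ ≤ ∫⁻ x, ((‖V (x + z)‖ₑ + ‖V (x - z)‖ₑ) + 2 * ‖V x‖ₑ) := by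
          refine lintegral_mono fun x => ?_
          refine (enorm_sub_le).trans (add_le_add (enorm_add_le _ _) ?_)
          rw [enorm_mul]; gcongr
          simp [enorm_eq_nnnorm]
      _ = (∫⁻ x, ‖V x‖ₑ) + (∫⁻ x, ‖V x‖ₑ) + 2 * ∫⁻ x, ‖V x‖ₑ := by
          rw [lintegral_add_right _ (hm.const_mul 2), lintegral_const_mul 2 hm,
            lintegral_add_left (f := fun x => ‖V (x + z)‖ₑ) (hm.comp (measurable_add_const z)),
            lintegral_add_right_eq_self (fun x => ‖V x‖ₑ),
            lintegral_sub_right_eq_self (fun x => ‖V x‖ₑ)]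
      _ = _ := by
          rw [ENNReal.ofReal_mul (by norm_num), hV, ENNReal.ofReal_ofNat]; ring
  have hB : ∀ z : Rd d, ∫⁻ x, ‖V (x + z) + V (x - z) - 2 * V x‖ₑ
      ≤ ENNReal.ofReal (B * ‖z‖ ^ 2) := by
    intro z
    have hVd : ∀ x, fderiv ℝ V x = W x := fun x => (SchwartzMap.fderivCLM_apply ℝ V x).symm
    have hWd : ∀ x, fderiv ℝ W x = U x := fun x => (SchwartzMap.fderivCLM_apply ℝ W x).symm
    have h1 := lintegral_enorm_translate_sub_le (W := fun x => V (x + z) - V x)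
      (((V.smooth 1).comp (contDiff_id.add contDiff_const)).sub (V.smooth 1)) (-z)
    have h2 := lintegral_enorm_translate_sub_le (W.smooth 1) z
    have h3 : ∀ x, fderiv ℝ (fun x => V (x + z) - V x) x = W (x + z) - W x := by
      intro x
      rw [fderiv_fun_sub, fderiv_comp_add_right, hVd, hVd]
      · exact (V.differentiable _).comp x (by fun_prop)
      · exact V.differentiable _
    simp_rw [h3] at h1
    simp_rw [hWd] at h2
    calc _ = ∫⁻ x, ‖V (x + -z + z) - V (x + -z) - (V (x + z) - V x)‖ₑ := by
          congr 1; ext x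
          rw [← enorm_neg, neg_add_cancel_right, ← sub_eq_add_neg]; congr 1; ring
      _ ≤ ‖z‖ₑ * (‖z‖ₑ * ∫⁻ x, ‖U x‖ₑ) := by
          refine h1.trans ?_
          rw [enorm_neg]; gcongr
      _ = _ := by
          rw [mul_comm B, ENNReal.ofReal_mul (by positivity),
            ofReal_integral_norm_eq_lintegral_enorm U.integrable, ← mul_assoc, ← sq,
            ENNReal.ofReal_pow (norm_nonneg _), ofReal_norm]
  refine ⟨A + B, by positivity, fun z => ?_⟩
  rcases le_total A (B * ‖z‖ ^ 2) with h | h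
  · refine (hA z).trans (ENNReal.ofReal_le_ofReal ?_)
    -- `1 - exp (-r)` is comparable to `min 1 r`, through `1 - 1 / (1 + r)`.
    have h1 : Real.exp (-‖z‖ ^ 2) ≤ 1 / (1 + ‖z‖ ^ 2) := by
      rw [Real.exp_neg, ← one_div]
      exact one_div_le_one_div_of_le (by positivity)
        (by rw [add_comm]; exact Real.add_one_le_exp _)
    calc A ≤ (A + B) * (1 - 1 / (1 + ‖z‖ ^ 2)) := by
          field_simp; nlinarith [sq_nonneg ‖z‖]
      _ ≤ _ := by gcongr
  · refine (hB z).trans (ENNReal.ofReal_le_ofReal ?_)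
    have h1 : Real.exp (-‖z‖ ^ 2) ≤ 1 / (1 + ‖z‖ ^ 2) := by
      rw [Real.exp_neg, ← one_div]
      exact one_div_le_one_div_of_le (by positivity)
        (by rw [add_comm]; exact Real.add_one_le_exp _)
    calc B * ‖z‖ ^ 2 ≤ (A + B) * (1 - 1 / (1 + ‖z‖ ^ 2)) := by
          field_simp; nlinarith [sq_nonneg ‖z‖, mul_le_mul_of_nonneg_left h (sq_nonneg ‖z‖)]
      _ ≤ _ := by gcongr

/-- The stable law at time `t` gives mean `O(t)` to `1 - exp (-|z|²)`, whatever the index. -/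
lemma integral_stableDensity_one_sub_gaussian_le (hα : 0 < α) (hα2 : α ≤ 2)
    (hp : PositiveDensities d α) :
    ∃ K : ℝ, 0 ≤ K ∧ ∀ t : ℝ, 0 < t →
      ∫ z : Rd d, stableDensity α t z * (1 - Real.exp (-‖z‖ ^ 2)) ≤ K * t := by
  -- `G` is the Fourier transform of `exp (-|z|²)`; it has integral one, and `|ξ|^α` is
  -- integrable against it.
  set G : Rd d → ℝ := fun η =>
    Real.pi ^ ((d : ℝ) / 2) * Real.exp (-Real.pi ^ 2 * ‖η‖ ^ 2) with hG
  have hGi : Integrable G :=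
    (integrable_gaussian (d := d) (by positivity : 0 < Real.pi ^ 2)).const_mul _
  have hG1 : ∫ η, G η = 1 := by
    rw [hG, integral_const_mul, GaussianFourier.integral_rexp_neg_mul_sq_norm (by positivity)]
    rw [finrank_euclideanSpace, Fintype.card_fin, ← Real.mul_rpow (by positivity) (by positivity)]
    have : Real.pi * (Real.pi / Real.pi ^ 2) = 1 := by
      have := Real.pi_pos
      field_simp
    rw [this, Real.one_rpow]
  have hc := continuous_symb (d := d) hα
  have hGm : Integrable (fun η => G η * symb α η) := by
    refine (hGi.add ((integrable_gaussian (d := d)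
      (by positivity : 0 < Real.pi ^ 2 / 2)).const_mul (8 * Real.pi ^ ((d : ℝ) / 2)))).mono'
      (Continuous.aestronglyMeasurable (by fun_prop)) (Eventually.of_forall fun η => ?_)
    have h0 : 0 ≤ 2 * Real.pi * ‖η‖ := by positivity
    have h1 : symb α η ≤ 1 + 4 * (Real.pi ^ 2 * ‖η‖ ^ 2) := by
      rw [symb]
      rcases le_total (2 * Real.pi * ‖η‖) 1 with h | h
      · have := Real.rpow_le_one h0 h hα.le
        have h2 : 0 ≤ Real.pi ^ 2 * ‖η‖ ^ 2 := by positivity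
        linarith
      · have := Real.rpow_le_rpow_of_exponent_le h hα2
        rw [Real.rpow_two] at this
        linarith
    have h2 : Real.pi ^ 2 * ‖η‖ ^ 2 ≤ 2 * Real.exp (Real.pi ^ 2 / 2 * ‖η‖ ^ 2) := by
      have := Real.add_one_le_exp (Real.pi ^ 2 / 2 * ‖η‖ ^ 2)
      linarith
    have h3 : Real.exp (Real.pi ^ 2 / 2 * ‖η‖ ^ 2) * Real.exp (-Real.pi ^ 2 * ‖η‖ ^ 2)
        = Real.exp (-(Real.pi ^ 2 / 2) * ‖η‖ ^ 2) := by
      rw [← Real.exp_add]; congr 1; ring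
    have h4 : 0 ≤ G η := by positivity
    rw [Real.norm_eq_abs, abs_of_nonneg (mul_nonneg h4 (symb_nonneg _))]
    calc G η * symb α η ≤ G η * (1 + 8 * Real.exp (Real.pi ^ 2 / 2 * ‖η‖ ^ 2)) := by
          gcongr; linarith
      _ = _ := by
          simp only [Pi.add_apply, hG, ← h3]; ring
  refine ⟨∫ η, G η * symb α η, integral_nonneg fun η => mul_nonneg (by positivity)
    (symb_nonneg _), fun t ht => ?_⟩
  have h1 := integral_stableDensity_mul_gaussian (d := d) hα ht one_pos
  have h2 : ∀ η : Rd d, ((Real.pi * (1 : ℝ) : ℂ) ^ (Module.finrank ℝ (Rd d) / 2 : ℂ) *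
        Complex.exp (-Real.pi ^ 2 * (1 : ℝ) * ‖(0 : Rd d) - η‖ ^ 2)) •
          ((Real.exp (-t * symb α η) : ℝ) : ℂ) = ((G η * Real.exp (-t * symb α η) : ℝ) : ℂ) := by
    intro η
    rw [hG, smul_eq_mul, zero_sub, norm_neg, finrank_euclideanSpace, Fintype.card_fin]
    push_cast
    rw [Complex.ofReal_cpow Real.pi_pos.le]
    push_cast
    simp
  simp_rw [h2] at h1
  rw [integral_complex_ofReal] at h1
  have h3 : ∫ x : Rd d, stableDensity α t x * Real.exp (-‖x‖ ^ 2)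
      = ∫ η, G η * Real.exp (-t * symb α η) := by
    have := Complex.ofReal_injective h1
    simpa using this
  have h4 : Integrable (fun x : Rd d => stableDensity α t x * Real.exp (-‖x‖ ^ 2)) := by
    simpa using integrable_stableDensity_mul_gaussian (d := d) hα ht one_pos
  have h5 : Integrable (fun η => G η * Real.exp (-t * symb α η)) := by
    refine hGi.mul_bdd (c := 1) (Continuous.aestronglyMeasurable (by fun_prop))
      (Eventually.of_forall fun η => ?_)
    rw [Real.norm_eq_abs, Real.abs_exp, Real.exp_le_one_iff]
    have := symb_nonneg (α := α) η
    nlinarith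
  calc _ = (∫ x : Rd d, stableDensity α t x)
        - ∫ x : Rd d, stableDensity α t x * Real.exp (-‖x‖ ^ 2) := by
        rw [← integral_sub (integrable_stableDensity hα hp ht) h4]
        congr 1; ext z; ring
    _ = ∫ η, (G η - G η * Real.exp (-t * symb α η)) := by
        rw [integral_stableDensity hα hp ht, h3, integral_sub hGi h5, hG1]
    _ ≤ ∫ η, G η * symb α η * t := by
        refine integral_mono (hGi.sub h5) (hGm.mul_const t) fun η => ?_
        have h6 := Real.add_one_le_exp (-t * symb α η)
        have h7 : 0 ≤ G η := by positivity
        nlinarith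
    _ = _ := integral_mul_const _ _

/-- The fractional Laplacian of a Schwartz function is integrable. It is the limit of
`(f - P_t f) / t`, which stays bounded in `L¹` because `p_t` is a symmetric probability density
and second differences of `f` are small near `0`. -/
lemma integrable_lapPow_one (hα : 0 < α) (hα2 : α ≤ 2) (hp : PositiveDensities d α)
    (V : 𝓢(Rd d, ℝ)) : Integrable (lapPow α 1 V) := by
  have hV := fourierDecay_schwartz hα V
  obtain ⟨C, hC0, hC⟩ := exists_lintegral_second_difference_le V
  obtain ⟨K, hK0, hK⟩ := integral_stableDensity_one_sub_gaussian_le hα hα2 hp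
  have hVb : ∃ M, ∀ x, |V x| ≤ M := by
    refine ⟨∫ η, symb α η ^ 0 * ‖fourierReal V η‖, fun x => ?_⟩
    rw [← hV.lapPow_zero hα x]
    exact FourierDecay.abs_lapPow_le 0 V x
  obtain ⟨M, hM⟩ := hVb
  -- `‖V - P_t V‖₁ ≤ C K t`
  have key : ∀ t : ℝ, 0 < t → ∫⁻ x, ‖V x - heatOp α t V x‖ₑ ≤ ENNReal.ofReal (C * (K * t)) := by
    intro t ht
    have hpc := continuous_stableDensity (d := d) hα ht
    have h1 : ∀ x, ‖V x - heatOp α t V x‖ₑ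
        ≤ ∫⁻ z, ENNReal.ofReal (stableDensity α t z) * ‖V (x + z) + V (x - z) - 2 * V x‖ₑ := by
      intro x
      have i0 : Integrable fun z => stableDensity α t z * V (x - z) := by
        refine (integrable_stableDensity hα hp ht).mul_bdd (c := M)
          (Continuous.aestronglyMeasurable (by fun_prop)) (Eventually.of_forall fun z => hM _)
      have i1 : Integrable fun z => stableDensity α t z * V (x + z) := by
        refine (integrable_stableDensity hα hp ht).mul_bdd (c := M)
          (Continuous.aestronglyMeasurable (by fun_prop)) (Eventually.of_forall fun z => hM _)
      have e0 : heatOp α t V x = ∫ z, stableDensity α t z * V (x - z) := by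
        rw [heatOp, ← integral_sub_left_eq_self _ _ x]
        simp
      have e1 : heatOp α t V x = ∫ z, stableDensity α t z * V (x + z) := by
        rw [e0, ← integral_neg_eq_self]
        simp
      have e2 : V x - heatOp α t V x
          = -(1 / 2) * ∫ z, stableDensity α t z * (V (x + z) + V (x - z) - 2 * V x) := by
        have e3 : ∫ z, stableDensity α t z * (V (x + z) + V (x - z) - 2 * V x)
            = heatOp α t V x + heatOp α t V x - 2 * V x := by
          nth_rewrite 1 [e1]
          have e4 : ∫ z : Rd d, stableDensity α t z * (2 * V x) = 2 * V x := by
            rw [integral_mul_const, integral_stableDensity hα hp ht, one_mul]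
          have i2 : Integrable fun z => stableDensity α t z * V (x + z)
            + stableDensity α t z * V (x - z) := i1.add i0
          rw [e0, ← integral_add i1 i0, ← e4,
            ← integral_sub i2 ((integrable_stableDensity hα hp ht).mul_const _)]
          congr 1; ext z; rw [e4]; ring
        rw [e3]; ring
      rw [e2, enorm_mul]
      calc _ ≤ 1 * ‖∫ z, stableDensity α t z * (V (x + z) + V (x - z) - 2 * V x)‖ₑ := by
            gcongr
            rw [Real.enorm_eq_ofReal_abs, ← ENNReal.ofReal_one]
            exact ENNReal.ofReal_le_ofReal (by norm_num)
        _ ≤ _ := by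
            rw [one_mul]
            refine (enorm_integral_le_lintegral_enorm _).trans_eq ?_
            congr 1; ext z
            rw [enorm_mul, Real.enorm_eq_ofReal_abs, abs_of_pos (hp t ht z)]
    calc _ ≤ ∫⁻ x, ∫⁻ z, ENNReal.ofReal (stableDensity α t z)
            * ‖V (x + z) + V (x - z) - 2 * V x‖ₑ := lintegral_mono h1
      _ = ∫⁻ z, ∫⁻ x, ENNReal.ofReal (stableDensity α t z)
            * ‖V (x + z) + V (x - z) - 2 * V x‖ₑ := by
          refine lintegral_lintegral_swap (Measurable.aemeasurable ?_)
          simp only [Function.uncurry_def]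
          refine Measurable.mul ?_ (Continuous.measurable (by fun_prop)).enorm
          exact (hpc.comp continuous_snd).measurable.ennreal_ofReal
      _ ≤ ∫⁻ z, ENNReal.ofReal (stableDensity α t z * (C * (1 - Real.exp (-‖z‖ ^ 2)))) := by
          refine lintegral_mono fun z => ?_
          rw [lintegral_const_mul' _ _ ENNReal.ofReal_ne_top, ENNReal.ofReal_mul (hp t ht z).le]
          gcongr
          exact hC z
      _ = ENNReal.ofReal (∫ z, stableDensity α t z * (C * (1 - Real.exp (-‖z‖ ^ 2)))) := by
          rw [ofReal_integral_eq_lintegral_ofReal]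
          · refine (integrable_stableDensity hα hp ht).mul_bdd (c := C * 1)
              (Continuous.aestronglyMeasurable (by fun_prop)) (Eventually.of_forall fun z => ?_)
            rw [norm_mul, Real.norm_eq_abs, Real.norm_eq_abs, abs_of_nonneg hC0]
            gcongr
            have h1 := Real.exp_pos (-‖z‖ ^ 2)
            have h2 : Real.exp (-‖z‖ ^ 2) ≤ 1 := Real.exp_le_one_iff.mpr (by simp)
            rw [abs_le]; constructor <;> linarith
          · refine Eventually.of_forall fun z => ?_
            have h2 : Real.exp (-‖z‖ ^ 2) ≤ 1 := Real.exp_le_one_iff.mpr (by simp)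
            exact mul_nonneg (hp t ht z).le (mul_nonneg hC0 (by linarith))
      _ ≤ _ := by
          refine ENNReal.ofReal_le_ofReal ?_
          have : ∀ z : Rd d, stableDensity α t z * (C * (1 - Real.exp (-‖z‖ ^ 2)))
              = C * (stableDensity α t z * (1 - Real.exp (-‖z‖ ^ 2))) := fun z => by ring
          simp_rw [this]
          rw [integral_const_mul]
          exact mul_le_mul_of_nonneg_left (hK t ht) hC0
  refine ⟨(hV.continuous_lapPow hα 1).aestronglyMeasurable, ?_⟩
  set T : ℕ → ℝ := fun n => 1 / ((n : ℝ) + 1) with hT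
  have hT0 : ∀ n, 0 < T n := fun n => by positivity
  have hTlim : Tendsto T atTop (𝓝 0) := tendsto_one_div_add_atTop_nhds_zero_nat
  have hlim : ∀ x, Tendsto (fun n => ‖(T n)⁻¹ * (V x - heatOp α (T n) V x)‖ₑ) atTop
      (𝓝 ‖lapPow α 1 V x‖ₑ) := by
    intro x
    refine Filter.Tendsto.enorm ?_
    rw [tendsto_iff_norm_sub_tendsto_zero]
    set Q := ((2 : ℕ) + 3) * ∫ η, symb α η ^ 2 * ‖fourierReal V η‖ with hQ
    refine squeeze_zero (fun _ => norm_nonneg _) (fun n => ?_)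
      (by simpa using hTlim.const_mul Q : Tendsto (fun n => Q * T n) atTop (𝓝 0))
    have h2 := FourierDecay.abs_heatOp_sub_le hα hV 2 (hT0 n) x
    simp only [Finset.sum_range_succ, Finset.sum_range_zero, hV.lapPow_zero hα] at h2
    have h3 : (T n)⁻¹ * (V x - heatOp α (T n) V x) - lapPow α 1 V x
        = (T n)⁻¹ * -(heatOp α (T n) V x - (V x - T n * lapPow α 1 V x)) := by
      field_simp [(hT0 n).ne']; ring
    rw [h3, norm_mul, norm_neg, Real.norm_eq_abs, Real.norm_eq_abs, abs_inv, abs_of_pos (hT0 n),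
      inv_mul_le_iff₀ (hT0 n)]
    refine (le_of_eq ?_).trans (h2.trans_eq ?_)
    · congr 1; simp; ring
    · rw [hQ]; push_cast; ring
  have hm : ∀ n, Measurable fun x => ‖(T n)⁻¹ * (V x - heatOp α (T n) V x)‖ₑ := fun n =>
    ((V.continuous.measurable.sub
      (measurable_heatOp_apply hα (T n) V.continuous.measurable)).const_mul _).enorm
  -- Fatou's lemma carries the `L¹` bound over to the limit.
  have hF := lintegral_liminf_le (μ := volume) (u := atTop) hm
  simp_rw [fun x => (hlim x).liminf_eq] at hF
  refine (hF.trans (?_ : _ ≤ ENNReal.ofReal (C * K))).trans_lt ENNReal.ofReal_lt_top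
  refine Filter.liminf_le_of_le (by isBoundedDefault) fun b hb => ?_
  obtain ⟨n, hn⟩ := hb.exists
  refine hn.trans ?_
  simp_rw [enorm_mul]
  rw [lintegral_const_mul' _ _ enorm_ne_top]
  refine (mul_le_mul_right (key _ (hT0 n)) _).trans_eq ?_
  rw [Real.enorm_eq_ofReal_abs, ← ENNReal.ofReal_mul (abs_nonneg _), abs_inv, abs_of_pos (hT0 n)]
  congr 1
  field_simp [(hT0 n).ne']

end

section

/-! ### The Dirichlet form as a quadratic form -/

variable {d : ℕ} {α : ℝ}

lemma fourierReal_translate_sub {f : Rd d → ℝ} (hf : Integrable f) (z η : Rd d) :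
    fourierReal (fun x => f (x + z) - f x) η
      = (Complex.exp (↑(2 * Real.pi * inner ℝ η z) * Complex.I) - 1) * fourierReal f η := by
  have h1 := congrFun (VectorFourier.fourierIntegral_comp_add_right Real.fourierChar
    (volume : Measure (Rd d)) (innerₗ (Rd d)) (fun y : Rd d => (f y : ℂ)) z) η
  have hfc : Integrable (fun y => (f y : ℂ)) := hf.ofReal
  have hi := (Real.fourierIntegral_convergent_iff (μ := volume) η).mpr hfc
  have hi2 := (Real.fourierIntegral_convergent_iff (μ := volume) η).mpr (hfc.comp_add_right z)
  have h2 : fourierReal (fun x => f (x + z) - f x) η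
      = fourierReal (fun x => f (x + z)) η - fourierReal f η := by
    simp only [fourierReal, Real.fourier_eq]
    rw [← integral_sub hi2 hi]
    congr 1; ext v
    push_cast
    rw [smul_sub]
  rw [h2, sub_mul, one_mul]
  congr 1
  refine h1.trans ?_
  rw [innerₗ_apply_apply, Circle.smul_def, Real.fourierChar_apply, smul_eq_mul, real_inner_comm]
  rfl

lemma normSq_exp_sub_one (θ : ℝ) :
    ‖Complex.exp (θ * Complex.I) - 1‖ ^ 2 = 2 * (1 - Real.cos θ) := by
  rw [← Complex.normSq_eq_norm_sq, Complex.normSq_apply, Complex.exp_mul_I]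
  simp only [Complex.sub_re, Complex.add_re, Complex.cos_ofReal_re, Complex.mul_re,
    Complex.sin_ofReal_re, Complex.I_re, Complex.sin_ofReal_im, Complex.I_im, Complex.one_re,
    Complex.sub_im, Complex.add_im, Complex.cos_ofReal_im, Complex.mul_im, Complex.one_im]
  nlinarith [Real.sin_sq_add_cos_sq θ]

/-- Plancherel's theorem for the difference of a function and a translate of it. -/
lemma FourierDecay.lintegral_translate_sub_sq (hα : 0 < α) {f : Rd d → ℝ} (hf : FourierDecay α f)
    (z : Rd d) :
    ∫⁻ x, ENNReal.ofReal (|f (x + z) - f x| ^ 2) =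
      ∫⁻ η, ENNReal.ofReal (2 * (1 - Real.cos (2 * Real.pi * inner ℝ η z)) *
        ‖fourierReal f η‖ ^ 2) := by
  set g : Rd d → ℝ := fun x => f (x + z) - f x with hg
  have hn : ∀ η, ‖fourierReal g η‖ ^ 2
      = 2 * (1 - Real.cos (2 * Real.pi * inner ℝ η z)) * ‖fourierReal f η‖ ^ 2 := by
    intro η
    rw [hg, fourierReal_translate_sub hf.integrable, norm_mul, mul_pow, normSq_exp_sub_one]
  have hn2 : ∀ η, ‖fourierReal g η‖ ≤ 2 * ‖fourierReal f η‖ := by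
    intro η
    rw [hg, fourierReal_translate_sub hf.integrable, norm_mul]
    gcongr
    refine (norm_sub_le _ _).trans ?_
    rw [Complex.norm_exp_ofReal_mul_I, norm_one]; norm_num
  have hgi : Integrable g := (hf.integrable.comp_add_right z).sub hf.integrable
  have hgc : Continuous g := by have := hf.continuous; fun_prop
  have hc := continuous_symb (d := d) hα
  have hcg := continuous_fourierReal hgi
  have hgd : FourierDecay α g := ⟨hgc, hgi, fun j => by
    refine ((hf.symb_integrable j).const_mul 2).mono'
      (Continuous.aestronglyMeasurable (by fun_prop)) (Eventually.of_forall fun η => ?_)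
    have h0 := pow_nonneg (symb_nonneg (α := α) η) j
    rw [Real.norm_eq_abs, abs_of_nonneg (mul_nonneg h0 (norm_nonneg _))]
    calc _ ≤ symb α η ^ j * (2 * ‖fourierReal f η‖) := by gcongr; exact hn2 η
      _ = _ := by ring⟩
  have h1 := hgd.integral_mul_lapPow hα 0
  simp only [hgd.lapPow_zero hα, pow_zero, one_mul] at h1
  have hb : ∀ x, |g x| ≤ ∫ η, symb α η ^ 0 * ‖fourierReal g η‖ := fun x => by
    rw [← hgd.lapPow_zero hα x]; exact FourierDecay.abs_lapPow_le 0 g x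
  have hi1 : Integrable (fun x => g x * g x) :=
    hgi.mul_bdd hgc.aestronglyMeasurable (Eventually.of_forall hb)
  have hi2 : Integrable (fun η => ‖fourierReal g η‖ ^ 2) := by
    have := (hgd.fourier_integrable hα).norm.mul_bdd (c := ∫ x, ‖(g x : ℂ)‖)
      hcg.norm.aestronglyMeasurable
      (Eventually.of_forall fun η => by
        rw [norm_norm]
        exact VectorFourier.norm_fourierIntegral_le_integral_norm _ _ _ _ _)
    exact this.congr (Eventually.of_forall fun η => (sq _).symm)
  calc _ = ∫⁻ x, ENNReal.ofReal (g x * g x) := by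
        congr 1; ext x; rw [sq_abs, sq]
    _ = ∫⁻ η, ENNReal.ofReal (‖fourierReal g η‖ ^ 2) := by
        rw [← ofReal_integral_eq_lintegral_ofReal hi1
          (Eventually.of_forall fun x => mul_self_nonneg _),
          ← ofReal_integral_eq_lintegral_ofReal hi2
          (Eventually.of_forall fun x => sq_nonneg _), h1]
    _ = _ := by simp_rw [hn]

/-- The Laplacian of a Schwartz function is a Schwartz function. -/
lemma exists_schwartz_lapPow_two (V : 𝓢(Rd d, ℝ)) :
    ∃ W : 𝓢(Rd d, ℝ), ∀ x, W x = lapPow 2 1 V x := by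
  set U : 𝓢(Rd d, ℂ) := 𝓕 (SchwartzMap.postcompCLM (𝕜 := ℝ) Complex.ofRealCLM V) with hU
  have hUV : ∀ η, fourierReal V η = U η := by
    intro η
    rw [hU, SchwartzMap.fourier_coe]
    rfl
  have hg : (fun η : Rd d => (2 * Real.pi) ^ 2 * ‖η‖ ^ 2).HasTemperateGrowth := by fun_prop
  refine ⟨SchwartzMap.postcompCLM (𝕜 := ℝ) Complex.reCLM
    (𝓕⁻ (SchwartzMap.smulLeftCLM ℂ (fun η : Rd d => (2 * Real.pi) ^ 2 * ‖η‖ ^ 2) U)), fun x => ?_⟩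
  rw [SchwartzMap.postcompCLM_apply, SchwartzMap.fourierInv_coe, lapPow,
    SchwartzMap.smulLeftCLM_apply hg, Complex.reCLM_apply]
  congr 2
  simp [symb, hUV, mul_pow]

lemma levy_integrand_nonneg (z : Rd d) (θ : ℝ) :
    0 ≤ (1 - Real.cos θ) / ‖z‖ ^ ((d : ℝ) + α) :=
  div_nonneg (by linarith [Real.cos_le_one θ]) (by positivity)

lemma measurable_levy_integrand (g : Rd d → ℝ) (hg : Measurable g) :
    Measurable (fun z : Rd d => (1 - Real.cos (g z)) / ‖z‖ ^ ((d : ℝ) + α)) := by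
  fun_prop

/-- The integral that defines the normalising constant, in `[0, ∞]`. -/
def levyMass (d : ℕ) [NeZero d] (α : ℝ) : ENNReal :=
  ∫⁻ z : Rd d, ENNReal.ofReal ((1 - Real.cos (z 0)) / ‖z‖ ^ ((d : ℝ) + α))

variable [NeZero d]

lemma levyMass_ne_zero : levyMass d α ≠ 0 := by
  intro h
  rw [levyMass, lintegral_eq_zero_iff
    (measurable_levy_integrand _ (by fun_prop)).ennreal_ofReal] at h
  have hopen : IsOpen {z : Rd d | z 0 ∈ Ioo (0 : ℝ) 1} :=
    isOpen_Ioo.preimage (by fun_prop)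
  have hne : {z : Rd d | z 0 ∈ Ioo (0 : ℝ) 1}.Nonempty :=
    ⟨EuclideanSpace.single 0 (1 / 2), by simp; norm_num⟩
  refine (hopen.measure_pos volume hne).ne' (measure_mono_null (fun z hz => ?_) h)
  have hz0 : z ≠ 0 := by rintro rfl; simp at hz
  have hcos : Real.cos (z 0) < 1 := by
    rw [← Real.cos_zero]
    exact Real.cos_lt_cos_of_nonneg_of_le_pi le_rfl
      (hz.2.le.trans (by linarith [Real.pi_gt_three])) hz.1
  have hzn : 0 < ‖z‖ := norm_pos_iff.mpr hz0
  simp only [mem_compl_iff, mem_ofPred_eq, Pi.zero_apply, ENNReal.ofReal_eq_zero, not_le]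
  have : 0 < 1 - Real.cos (z 0) := by linarith
  positivity

/-- The integrand is at most `min 2 |z|² / |z|^{d+α}`, which is integrable for `0 < α < 2`. -/
lemma levyMass_ne_top (hα : 0 < α) (hα2 : α < 2) : levyMass d α ≠ ⊤ := by
  have hd1 : 1 ≤ d := Nat.one_le_iff_ne_zero.mpr (NeZero.ne d)
  have : Nonempty (Fin d) := ⟨0⟩
  set b : ℝ → ℝ := fun r => min 2 (r ^ 2) / r ^ ((d : ℝ) + α) with hb
  have h1 : Integrable (fun z : Rd d => b ‖z‖) := by
    refine (integrable_fun_norm_addHaar (volume : Measure (Rd d)) (f := b)).mpr ?_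
    rw [finrank_euclideanSpace, Fintype.card_fin, ← Ioc_union_Ioi_eq_Ioi zero_le_one]
    have hsimp : ∀ r : ℝ, 0 < r → r ^ (d - 1) * (r ^ 2 / r ^ ((d : ℝ) + α)) = r ^ (1 - α) := by
      intro r hr
      rw [← Real.rpow_natCast, ← Real.rpow_two, ← Real.rpow_sub hr, ← Real.rpow_add hr]
      congr 1; push_cast [Nat.cast_sub hd1]; ring
    have hsimp2 : ∀ r : ℝ, 0 < r → r ^ (d - 1) * (2 / r ^ ((d : ℝ) + α)) = 2 * r ^ (-1 - α) := by
      intro r hr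
      rw [mul_div_left_comm, ← Real.rpow_natCast, ← Real.rpow_sub hr]
      congr 2; push_cast [Nat.cast_sub hd1]; ring
    have hmeas : Measurable (fun r : ℝ => r ^ (d - 1) • b r) := by
      rw [hb]; fun_prop
    refine IntegrableOn.union ?_ ?_
    · have h2 : IntegrableOn (fun r : ℝ => r ^ (1 - α)) (Ioc 0 1) :=
        (intervalIntegrable_iff_integrableOn_Ioc_of_le zero_le_one).mp
          (intervalIntegral.intervalIntegrable_rpow' (by linarith))
      refine Integrable.mono' h2 hmeas.aestronglyMeasurable
        ((ae_restrict_iff' measurableSet_Ioc).mpr (Eventually.of_forall fun r hr => ?_))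
      have hr0 : 0 < r := hr.1
      rw [← hsimp r hr0, Real.norm_eq_abs, smul_eq_mul, abs_of_nonneg (by positivity)]
      exact mul_le_mul_of_nonneg_left (div_le_div_of_nonneg_right (min_le_right _ _)
        (by positivity)) (by positivity)
    · have h2 : IntegrableOn (fun r : ℝ => 2 * r ^ (-1 - α)) (Ioi 1) :=
        (integrableOn_Ioi_rpow_of_lt (by linarith) one_pos).const_mul 2
      refine Integrable.mono' h2 hmeas.aestronglyMeasurable
        ((ae_restrict_iff' measurableSet_Ioi).mpr (Eventually.of_forall fun r hr => ?_))
      have hr0 : 0 < r := one_pos.trans hr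
      rw [← hsimp2 r hr0, Real.norm_eq_abs, smul_eq_mul, abs_of_nonneg (by positivity)]
      exact mul_le_mul_of_nonneg_left (div_le_div_of_nonneg_right (min_le_left _ _)
        (by positivity)) (by positivity)
  refine ne_top_of_le_ne_top (h1.lintegral_lt_top.ne) (lintegral_mono fun z => ?_)
  refine ENNReal.ofReal_le_ofReal (div_le_div_of_nonneg_right (le_min ?_ ?_) (by positivity))
  · linarith [Real.neg_one_le_cos (z 0)]
  · have h2 := Real.one_sub_sq_div_two_le_cos (x := z 0)
    have h3 : |z 0| ≤ ‖z‖ := PiLp.norm_apply_le z 0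
    have h4 : (z 0) ^ 2 ≤ ‖z‖ ^ 2 := sq_le_sq' (by linarith [neg_abs_le (z 0)])
      (by linarith [le_abs_self (z 0)])
    nlinarith [sq_nonneg (z 0)]

/-- `levyMass` is positive and finite, so the inverse that defines `normConst` is not junk. -/
lemma normConst_mul_levyMass (hα : 0 < α) (hα2 : α < 2) :
    normConst d α * (levyMass d α).toReal = 1 := by
  have h : ∫ z : Rd d, (1 - Real.cos (z 0)) / ‖z‖ ^ ((d : ℝ) + α) = (levyMass d α).toReal := by
    rw [integral_eq_lintegral_of_nonneg_ae
      (Eventually.of_forall fun z => levy_integrand_nonneg z _)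
      (measurable_levy_integrand _ (by fun_prop)).aestronglyMeasurable, levyMass]
  rw [normConst, h]
  exact inv_mul_cancel₀ (ENNReal.toReal_ne_zero.mpr ⟨levyMass_ne_zero, levyMass_ne_top hα hα2⟩)

/-- The Lévy–Khintchine integral of the stable process is a multiple of its symbol, by rotation
invariance and scaling. -/
lemma lintegral_levy_eq (hα : 0 < α) (η : Rd d) :
    ∫⁻ z : Rd d, ENNReal.ofReal ((1 - Real.cos (2 * Real.pi * inner ℝ η z)) /
      ‖z‖ ^ ((d : ℝ) + α)) = ENNReal.ofReal (symb α η) * levyMass d α := by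
  rcases eq_or_ne η 0 with rfl | hη
  · simp [symb, Real.zero_rpow hα.ne']
  have hη0 : 0 < ‖η‖ := norm_pos_iff.mpr hη
  set a : ℝ := 2 * Real.pi * ‖η‖ with ha
  have ha0 : 0 < a := by positivity
  set e₀ : Rd d := EuclideanSpace.single 0 1 with he₀
  set e : Rd d := ‖η‖⁻¹ • η with he
  have hne : ‖e₀‖ = ‖e‖ := by
    rw [he₀, he, norm_smul, norm_inv, norm_norm, inv_mul_cancel₀ hη0.ne']; simp
  -- A reflection takes the first basis vector to the direction of `η`; dilation by `‖ξ‖⁻¹`, with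
  -- `ξ = 2πη`, then extracts the factor `‖ξ‖^α`.
  set ρ : Rd d ≃ₗᵢ[ℝ] Rd d := (ℝ ∙ (e₀ - e))ᗮ.reflection with hρ
  have hρe : ρ e₀ = e := Submodule.reflection_sub hne
  have hin : ∀ z, inner ℝ η (ρ z) = ‖η‖ * z 0 := by
    intro z
    have h1 : η = ‖η‖ • e := by rw [he, smul_smul, mul_inv_cancel₀ hη0.ne', one_smul]
    calc inner ℝ η (ρ z) = ‖η‖ * inner ℝ (ρ e₀) (ρ z) := by
          rw [hρe, ← real_inner_smul_left, ← h1]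
      _ = _ := by
          rw [LinearIsometryEquiv.inner_map_map, he₀, EuclideanSpace.inner_single_left]; simp
  set F : Rd d → ENNReal := fun z => ENNReal.ofReal
    ((1 - Real.cos (2 * Real.pi * inner ℝ η z)) / ‖z‖ ^ ((d : ℝ) + α)) with hF
  have hFm : Measurable F :=
    (measurable_levy_integrand _ (by fun_prop)).ennreal_ofReal
  have h1 : ∫⁻ z, F z = ∫⁻ z, F (ρ z) :=
    (ρ.measurePreserving.lintegral_comp hFm).symm
  have hai : a⁻¹ ≠ 0 := inv_ne_zero ha0.ne'
  have h2 : ∫⁻ z, F (ρ (a⁻¹ • z)) = ENNReal.ofReal (a ^ d) * ∫⁻ z, F (ρ z) := by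
    have h3 := Measure.map_addHaar_smul (volume : Measure (Rd d)) hai
    rw [← lintegral_map (f := fun z => F (ρ z)) (hFm.comp (by fun_prop))
      (measurable_const_smul a⁻¹), h3, lintegral_smul_measure,
      finrank_euclideanSpace, Fintype.card_fin, smul_eq_mul]
    congr 2
    rw [inv_pow, inv_inv, abs_of_pos (by positivity)]
  have h4 : ∀ z, F (ρ (a⁻¹ • z)) = ENNReal.ofReal (a ^ ((d : ℝ) + α)) *
      ENNReal.ofReal ((1 - Real.cos (z 0)) / ‖z‖ ^ ((d : ℝ) + α)) := by
    intro z
    rw [hF, ← ENNReal.ofReal_mul (by positivity)]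
    simp only [hin, LinearIsometryEquiv.norm_map, norm_smul, norm_inv, Real.norm_eq_abs,
      abs_of_pos ha0, PiLp.smul_apply, smul_eq_mul]
    congr 1
    rw [Real.mul_rpow (by positivity) (norm_nonneg _), Real.inv_rpow ha0.le]
    have : 2 * Real.pi * (‖η‖ * (a⁻¹ * z 0)) = z 0 := by
      rw [ha]; field_simp
    rw [this, div_mul_eq_div_div, div_inv_eq_mul, mul_comm, mul_div_assoc]
  simp_rw [h4] at h2
  rw [lintegral_const_mul _ (measurable_levy_integrand _ (by fun_prop)).ennreal_ofReal] at h2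
  rw [h1, symb, ← ha]
  have h5 : ENNReal.ofReal (a ^ ((d : ℝ) + α))
      = ENNReal.ofReal (a ^ d) * ENNReal.ofReal (a ^ α) := by
    rw [← ENNReal.ofReal_mul (by positivity), Real.rpow_add ha0, Real.rpow_natCast]
  rw [h5, mul_assoc] at h2
  exact ((ENNReal.mul_right_inj (by simp; positivity) ENNReal.ofReal_ne_top).mp h2).symm

/-- For `α < 2`, the Dirichlet form is the quadratic form of the fractional Laplacian. -/
lemma FourierDecay.dirichletForm_eq (hα : 0 < α) (hα2 : α < 2) {f : Rd d → ℝ}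
    (hf : FourierDecay α f) : dirichletForm α f = ∫ x, f x * lapPow α 1 f x := by
  have hc := hf.continuous
  have hcf := continuous_fourierReal hf.integrable
  have hcs := continuous_symb (d := d) hα
  have hm : Measurable fun q : Rd d × Rd d =>
      |f q.1 - f q.2| ^ 2 / ‖q.1 - q.2‖ ^ ((d : ℝ) + α) := by
    have := hc.measurable
    fun_prop
  have hm2 : Measurable fun q : Rd d × Rd d =>
      |f (q.2 + q.1) - f q.2| ^ 2 / ‖q.1‖ ^ ((d : ℝ) + α) := by
    have := hc.measurable
    fun_prop
  have hm3 : Measurable fun q : Rd d × Rd d =>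
      2 * (1 - Real.cos (2 * Real.pi * inner ℝ q.2 q.1)) *
          ‖fourierReal f q.2‖ ^ 2 / ‖q.1‖ ^ ((d : ℝ) + α) := by
    have := hcf.measurable
    fun_prop
  have key : ∫⁻ q : Rd d × Rd d, ENNReal.ofReal
      (|f q.1 - f q.2| ^ 2 / ‖q.1 - q.2‖ ^ ((d : ℝ) + α))
      = ENNReal.ofReal (2 * ∫ η, symb α η ^ 1 * ‖fourierReal f η‖ ^ 2) * levyMass d α := by
    -- Integrating over `y` first, Plancherel turns each difference into `2 (1 - cos) |f̂|²`, and
    -- the integral over `z` is then the Lévy–Khintchine integral.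
    calc _ = ∫⁻ y, ∫⁻ x, ENNReal.ofReal (|f x - f y| ^ 2 / ‖x - y‖ ^ ((d : ℝ) + α)) := by
          rw [Measure.volume_eq_prod, lintegral_prod_symm _ hm.ennreal_ofReal.aemeasurable]
      _ = ∫⁻ y, ∫⁻ z, ENNReal.ofReal (|f (y + z) - f y| ^ 2 / ‖z‖ ^ ((d : ℝ) + α)) := by
          congr 1; ext y
          rw [← lintegral_add_left_eq_self _ y]
          simp only [add_sub_cancel_left]
      _ = ∫⁻ z, ∫⁻ y, ENNReal.ofReal (|f (y + z) - f y| ^ 2 / ‖z‖ ^ ((d : ℝ) + α)) :=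
          (lintegral_lintegral_swap hm2.ennreal_ofReal.aemeasurable).symm
      _ = ∫⁻ z, ∫⁻ η, ENNReal.ofReal (2 * (1 - Real.cos (2 * Real.pi * inner ℝ η z)) *
          ‖fourierReal f η‖ ^ 2 / ‖z‖ ^ ((d : ℝ) + α)) := by
          congr 1; ext z
          simp_rw [fun a : ℝ => div_eq_mul_inv a (‖z‖ ^ ((d : ℝ) + α))]
          have h0 : 0 ≤ (‖z‖ ^ ((d : ℝ) + α))⁻¹ := by positivity
          simp_rw [fun a : ℝ => ENNReal.ofReal_mul' (p := a) h0]
          rw [lintegral_mul_const' _ _ ENNReal.ofReal_ne_top,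
            lintegral_mul_const' _ _ ENNReal.ofReal_ne_top, hf.lintegral_translate_sub_sq hα]
      _ = ∫⁻ η, ∫⁻ z, ENNReal.ofReal (2 * (1 - Real.cos (2 * Real.pi * inner ℝ η z)) *
          ‖fourierReal f η‖ ^ 2 / ‖z‖ ^ ((d : ℝ) + α)) :=
          lintegral_lintegral_swap hm3.ennreal_ofReal.aemeasurable
      _ = ∫⁻ η, ENNReal.ofReal (2 * (symb α η ^ 1 * ‖fourierReal f η‖ ^ 2)) * levyMass d α := by
          congr 1; ext η
          have : ∀ z : Rd d, ENNReal.ofReal (2 * (1 - Real.cos (2 * Real.pi * inner ℝ η z)) *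
              ‖fourierReal f η‖ ^ 2 / ‖z‖ ^ ((d : ℝ) + α))
              = ENNReal.ofReal (2 * ‖fourierReal f η‖ ^ 2) * ENNReal.ofReal
                ((1 - Real.cos (2 * Real.pi * inner ℝ η z)) / ‖z‖ ^ ((d : ℝ) + α)) := by
            intro z
            rw [← ENNReal.ofReal_mul (by positivity)]
            congr 1; ring
          simp_rw [this]
          rw [lintegral_const_mul' _ _ ENNReal.ofReal_ne_top, lintegral_levy_eq hα, ← mul_assoc,
            ← ENNReal.ofReal_mul (by positivity)]
          congr 2; ring
      _ = _ := by
          rw [lintegral_mul_const _ (Continuous.measurable (by fun_prop)).ennreal_ofReal,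
            ← integral_const_mul, ofReal_integral_eq_lintegral_ofReal]
          · refine Integrable.const_mul ?_ 2
            have := (hf.symb_integrable 1).mul_bdd (c := ∫ x, ‖(f x : ℂ)‖)
              (g := fun η => ‖fourierReal f η‖) hcf.norm.aestronglyMeasurable
              (Eventually.of_forall fun η => by
                rw [norm_norm]
                exact VectorFourier.norm_fourierIntegral_le_integral_norm _ _ _ _ _)
            exact this.congr (Eventually.of_forall fun η => by simp only; ring)
          · refine Eventually.of_forall fun η => ?_
            have := symb_nonneg (α := α) η
            positivity
  rw [dirichletForm, if_neg hα2.ne, integral_eq_lintegral_of_nonneg_ae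
    (Eventually.of_forall fun q => by positivity) hm.aestronglyMeasurable, key,
    hf.integral_mul_lapPow hα 1, ENNReal.toReal_mul, ENNReal.toReal_ofReal]
  · have := normConst_mul_levyMass (d := d) hα hα2
    linear_combination (∫ η, symb α η ^ 1 * ‖fourierReal f η‖ ^ 2) * this
  · refine mul_nonneg zero_le_two (integral_nonneg fun η => ?_)
    have := symb_nonneg (α := α) η
    positivity

/-- The classical Dirichlet integral of a Schwartz function. -/
lemma dirichletForm_two_eq (V : 𝓢(Rd d, ℝ)) :
    dirichletForm 2 V = ∫ x, V x * lapPow 2 1 V x := by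
  have hV := fourierDecay_schwartz (d := d) two_pos V
  set W : 𝓢(Rd d, ℂ) := SchwartzMap.postcompCLM (𝕜 := ℝ) Complex.ofRealCLM V with hW
  have hWV : ∀ η, fourierReal V η = 𝓕 W η := by
    intro η
    rw [hW, SchwartzMap.fourier_coe]
    rfl
  let e : Fin d → Rd d := fun i => EuclideanSpace.single i 1
  have hder : ∀ i x, LineDeriv.lineDerivOp (e i) W x = ((fderiv ℝ V x (e i) : ℝ) : ℂ) := by
    intro i x
    rw [SchwartzMap.lineDerivOp_apply_eq_fderiv]
    have : HasFDerivAt W (Complex.ofRealCLM.comp (fderiv ℝ V x)) x :=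
      Complex.ofRealCLM.hasFDerivAt.comp x (V.differentiable x).hasFDerivAt
    rw [this.fderiv]; rfl
  have hgrad : ∀ x, ‖gradient V x‖ ^ 2 = ∑ i, ‖LineDeriv.lineDerivOp (e i) W x‖ ^ 2 := by
    intro x
    rw [EuclideanSpace.norm_sq_eq]
    refine Finset.sum_congr rfl fun i _ => ?_
    rw [hder, Complex.norm_real]
    congr 2
    rw [← InnerProductSpace.toDual_symm_apply (𝕜 := ℝ), EuclideanSpace.inner_single_right]
    simp [gradient]
  have hfour : ∀ i η, ‖𝓕 (LineDeriv.lineDerivOp (e i) W) η‖ ^ 2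
      = (2 * Real.pi) ^ 2 * (η i) ^ 2 * ‖fourierReal V η‖ ^ 2 := by
    intro i η
    have hg : (fun x : Rd d => inner ℝ x (e i)).HasTemperateGrowth := by fun_prop
    rw [SchwartzMap.fourier_lineDerivOp_eq, smul_apply,
      SchwartzMap.smulLeftCLM_apply_apply hg, norm_smul, norm_smul, hWV]
    have : inner ℝ η (e i) = η i := by simp [e, EuclideanSpace.inner_single_right]
    rw [this]
    simp only [Complex.norm_mul, Complex.norm_ofNat, Complex.norm_real, Real.norm_eq_abs,
      Complex.norm_I, abs_of_pos Real.pi_pos, mul_one, mul_pow, sq_abs]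
    ring
  rw [dirichletForm, if_pos rfl]
  simp_rw [hgrad]
  have hL2 : ∀ U : 𝓢(Rd d, ℂ), Integrable (fun x => ‖U x‖ ^ 2) := fun U =>
    (U.memLp 2).integrable_norm_pow two_ne_zero
  rw [integral_finsetSum _ fun i _ => hL2 _]
  rw [Finset.sum_congr rfl fun i _ => (SchwartzMap.integral_norm_sq_fourier _).symm,
    ← integral_finsetSum _ fun i _ => hL2 _, hV.integral_mul_lapPow two_pos]
  congr 1; ext η
  simp_rw [hfour]
  rw [← Finset.sum_mul, ← Finset.mul_sum, pow_one, symb, Real.rpow_two,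
    mul_pow _ ‖η‖, EuclideanSpace.norm_sq_eq]
  simp

/-- The Dirichlet form is the quadratic form of the fractional Laplacian, for a Schwartz function
and for the fractional Laplacian of one. -/
lemma dirichletForm_schwartz (hα : 0 < α) (hα2 : α ≤ 2) (V : 𝓢(Rd d, ℝ)) :
    dirichletForm α V = ∫ x, V x * lapPow α 1 V x := by
  rcases hα2.lt_or_eq with h | rfl
  · exact (fourierDecay_schwartz hα V).dirichletForm_eq hα h
  · exact dirichletForm_two_eq V

lemma dirichletForm_lapPow_one (hα : 0 < α) (hα2 : α ≤ 2) (V : 𝓢(Rd d, ℝ))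
    (hi : Integrable (lapPow α 1 V)) :
    dirichletForm α (lapPow α 1 V) = ∫ x, V x * lapPow α 3 V x := by
  have hV := fourierDecay_schwartz hα V
  have hLV := hV.of_lapPow_one hα hi
  have h : dirichletForm α (lapPow α 1 V)
      = ∫ x, lapPow α 1 V x * lapPow α 1 (lapPow α 1 V) x := by
    rcases hα2.lt_or_eq with h | rfl
    · exact hLV.dirichletForm_eq hα h
    -- The form of index two is defined by a gradient; `ΔV` is smooth, being a Schwartz function.
    · obtain ⟨W, hW⟩ := exists_schwartz_lapPow_two V
      rw [← funext hW]
      exact dirichletForm_two_eq W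
  rw [h, hLV.integral_mul_lapPow hα 1, hV.integral_mul_lapPow hα 3]
  congr 1; ext η
  rw [hV.fourierReal_lapPow hα 1 hi, norm_mul, Complex.norm_real, Real.norm_eq_abs, mul_pow, sq_abs]
  ring

end

section

/-! ### Short-time expansions of the correlation integrals -/

variable {d : ℕ} {α : ℝ}

/-- Bounded measurable functions. -/
structure BoundedMeasurable {d : ℕ} (f : Rd d → ℝ) : Prop where
  measurable : Measurable f
  bounded : ∃ M, ∀ x, |f x| ≤ M

namespace BoundedMeasurable

variable {f g w : Rd d → ℝ}

lemma mul (hf : BoundedMeasurable f) (hg : BoundedMeasurable g) :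
    BoundedMeasurable (fun x => f x * g x) := by
  obtain ⟨A, hA⟩ := hf.bounded
  obtain ⟨B, hB⟩ := hg.bounded
  refine ⟨hf.measurable.mul hg.measurable, A * B, fun x => ?_⟩
  rw [abs_mul]
  exact mul_le_mul (hA x) (hB x) (abs_nonneg _) ((abs_nonneg _).trans (hA x))

lemma sub (hf : BoundedMeasurable f) (hg : BoundedMeasurable g) :
    BoundedMeasurable (fun x => f x - g x) := by
  obtain ⟨A, hA⟩ := hf.bounded
  obtain ⟨B, hB⟩ := hg.bounded
  exact ⟨hf.measurable.sub hg.measurable, A + B, fun x =>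
    (abs_sub _ _).trans (add_le_add (hA x) (hB x))⟩

lemma add (hf : BoundedMeasurable f) (hg : BoundedMeasurable g) :
    BoundedMeasurable (fun x => f x + g x) := by
  obtain ⟨A, hA⟩ := hf.bounded
  obtain ⟨B, hB⟩ := hg.bounded
  exact ⟨hf.measurable.add hg.measurable, A + B, fun x =>
    (abs_add_le _ _).trans (add_le_add (hA x) (hB x))⟩

lemma const (c : ℝ) : BoundedMeasurable (fun _ : Rd d => c) :=
  ⟨measurable_const, |c|, fun _ => le_rfl⟩

lemma const_mul (c : ℝ) (hf : BoundedMeasurable f) : BoundedMeasurable (fun x => c * f x) :=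
  (const c).mul hf

lemma heatOp (hα : 0 < α) (hp : PositiveDensities d α) {t : ℝ} (ht : 0 < t)
    (hf : BoundedMeasurable f) : BoundedMeasurable (heatOp α t f) := by
  obtain ⟨A, hA⟩ := hf.bounded
  exact ⟨measurable_heatOp_apply hα t hf.measurable, A, abs_heatOp_le hα hp ht hA⟩

lemma integrable_mul (hf : BoundedMeasurable f) (hw : Integrable w) :
    Integrable (fun x => w x * f x) := by
  obtain ⟨A, hA⟩ := hf.bounded
  exact hw.mul_bdd hf.measurable.aestronglyMeasurable (Eventually.of_forall hA)

lemma abs_integral_sub_le (hf : BoundedMeasurable f) (hg : BoundedMeasurable g)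
    (hw : Integrable w) {M : ℝ} (hM : ∀ x, |f x - g x| ≤ M) :
    |(∫ x, w x * f x) - ∫ x, w x * g x| ≤ (∫ x, |w x|) * M := by
  rw [← integral_sub (hf.integrable_mul hw) (hg.integrable_mul hw), ← Real.norm_eq_abs,
    ← integral_mul_const]
  refine norm_integral_le_of_norm_le (hw.norm.mul_const M) (Eventually.of_forall fun x => ?_)
  rw [← mul_sub, norm_mul]
  exact mul_le_mul_of_nonneg_left (hM x) (norm_nonneg _)

lemma heatOp_sub (hα : 0 < α) (hp : PositiveDensities d α) {t : ℝ} (ht : 0 < t)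
    (hf : BoundedMeasurable f) (hg : BoundedMeasurable g) (c : ℝ) (x : Rd d) :
    HeatContent.heatOp α t (fun x => f x - c * g x) x
      = HeatContent.heatOp α t f x - c * HeatContent.heatOp α t g x := by
  obtain ⟨A, hA⟩ := hf.bounded
  obtain ⟨B, hB⟩ := hg.bounded
  simp only [HeatContent.heatOp]
  rw [← integral_const_mul, ← integral_sub
    (integrable_stableDensity_mul hα hp ht x hf.measurable hA)
    ((integrable_stableDensity_mul hα hp ht x hg.measurable hB).const_mul c)]
  congr 1; ext y; ring

end BoundedMeasurable

lemma FourierDecay.boundedMeasurable_lapPow (hα : 0 < α) {f : Rd d → ℝ} (hf : FourierDecay α f)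
    (j : ℕ) : BoundedMeasurable (lapPow α j f) :=
  ⟨(hf.continuous_lapPow hα j).measurable, _, FourierDecay.abs_lapPow_le j f⟩

lemma FourierDecay.boundedMeasurable (hα : 0 < α) {f : Rd d → ℝ} (hf : FourierDecay α f) :
    BoundedMeasurable f := by
  have := hf.boundedMeasurable_lapPow hα 0
  rwa [funext (hf.lapPow_zero hα)] at this

/-- One constant for all the Taylor expansions of the semigroup that are needed. -/
lemma FourierDecay.exists_taylor_bound (hα : 0 < α) {f : Rd d → ℝ} (hf : FourierDecay α f)
    (N : ℕ) : ∃ M : ℝ, 1 ≤ M ∧ (∀ j < N, ∀ x, |lapPow α j f x| ≤ M) ∧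
      ∀ n < N, ∀ u, 0 < u → ∀ x,
        |heatOp α u f x - ∑ j ∈ Finset.range n, (-u) ^ j / j.factorial * lapPow α j f x|
          ≤ M * u ^ n := by
  set c : ℕ → ℝ := fun n => (n + 3) * ∫ η, symb α η ^ n * ‖fourierReal f η‖ with hc
  have hI : ∀ n, 0 ≤ ∫ η, symb α η ^ n * ‖fourierReal f η‖ := fun n =>
    integral_nonneg fun η => mul_nonneg (pow_nonneg (symb_nonneg _) _) (norm_nonneg _)
  have hc0 : ∀ n, 0 ≤ c n := fun n => mul_nonneg (by positivity) (hI n)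
  have hle : ∀ n < N, c n ≤ 1 + ∑ i ∈ Finset.range N, c i := fun n hn => by
    have := Finset.single_le_sum (f := c) (fun i _ => hc0 i) (Finset.mem_range.mpr hn)
    linarith
  refine ⟨1 + ∑ n ∈ Finset.range N, c n, ?_, fun j hj x => ?_, fun n hn u hu x => ?_⟩
  · have := Finset.sum_nonneg (s := Finset.range N) (f := c) fun i _ => hc0 i
    linarith
  · refine (FourierDecay.abs_lapPow_le j f x).trans (le_trans ?_ (hle j hj))
    have : (0 : ℝ) ≤ j := by positivity
    have h1 := hI j
    simp only [hc]
    nlinarith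
  · exact (hf.abs_heatOp_sub_le hα n hu x).trans
      (mul_le_mul_of_nonneg_right (hle n hn) (by positivity))

/-- Comparison of products. -/
lemma abs_mul_sub_mul_le {x y x₀ y₀ A B δ ε : ℝ} (hx : |x - x₀| ≤ δ) (hy : |y - y₀| ≤ ε)
    (hA : |y| ≤ A) (hB : |x₀| ≤ B) : |x * y - x₀ * y₀| ≤ δ * A + B * ε := by
  have h : x * y - x₀ * y₀ = (x - x₀) * y + x₀ * (y - y₀) := by ring
  rw [h]
  refine (abs_add_le _ _).trans ?_
  rw [abs_mul, abs_mul]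
  have h1 := abs_nonneg (x - x₀)
  have h2 := abs_nonneg (y - y₀)
  have h3 := abs_nonneg y
  have h4 := abs_nonneg x₀
  gcongr
  · linarith
  · linarith

lemma integral_eq_linear_combination {F f₀ f₁ f₂ f₃ : Rd d → ℝ} (i₀ : Integrable f₀)
    (i₁ : Integrable f₁) (i₂ : Integrable f₂) (i₃ : Integrable f₃) (c₁ c₂ c₃ : ℝ)
    (h : ∀ x, F x = f₀ x + c₁ * f₁ x + c₂ * f₂ x + c₃ * f₃ x) :
    ∫ x, F x = (∫ x, f₀ x) + c₁ * (∫ x, f₁ x) + c₂ * (∫ x, f₂ x) + c₃ * ∫ x, f₃ x := by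
  have i01 : Integrable fun x => f₀ x + c₁ * f₁ x := i₀.add (i₁.const_mul c₁)
  have i012 : Integrable fun x => f₀ x + c₁ * f₁ x + c₂ * f₂ x := i01.add (i₂.const_mul c₂)
  simp_rw [h]
  rw [integral_add i012 (i₃.const_mul c₃), integral_add i01 (i₂.const_mul c₂),
    integral_add i₀ (i₁.const_mul c₁), integral_const_mul, integral_const_mul, integral_const_mul]

/-- Expansion of the two-point correlation to third order. -/
lemma exists_two_point_bound (hα : 0 < α) (hp : PositiveDensities d α) {V : Rd d → ℝ}
    (hV : FourierDecay α V) :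
    ∃ C : ℝ, ∀ t u : ℝ, 0 < u → u ≤ t →
      |(∫ x, V x * heatOp α u V x) - ((∫ x, V x * V x) - u * (∫ x, V x * lapPow α 1 V x)
        + u ^ 2 / 2 * (∫ x, V x * lapPow α 2 V x) - u ^ 3 / 6 * (∫ x, V x * lapPow α 3 V x))|
        ≤ C * t ^ 4 := by
  obtain ⟨M, hM1, -, hT⟩ := hV.exists_taylor_bound hα 5
  have hb := hV.boundedMeasurable hα
  have hl := hV.boundedMeasurable_lapPow hα
  refine ⟨(∫ x, |V x|) * M, fun t u hu hut => ?_⟩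
  have hG : BoundedMeasurable (fun x => ((V x - u * lapPow α 1 V x) + u ^ 2 / 2 * lapPow α 2 V x)
      - u ^ 3 / 6 * lapPow α 3 V x) :=
    ((hb.sub ((hl 1).const_mul _)).add ((hl 2).const_mul _)).sub ((hl 3).const_mul _)
  have h1 := (hb.heatOp hα hp hu).abs_integral_sub_le hG hV.integrable (M := M * u ^ 4)
    (fun x => by
      have := hT 4 (by norm_num) u hu x
      simp only [Finset.sum_range_succ, Finset.sum_range_zero, hV.lapPow_zero hα] at this
      refine (le_of_eq ?_).trans this
      congr 1
      norm_num [Nat.factorial]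
      ring)
  have e : ∫ x, V x * (((V x - u * lapPow α 1 V x) + u ^ 2 / 2 * lapPow α 2 V x)
      - u ^ 3 / 6 * lapPow α 3 V x) = (∫ x, V x * V x) - u * (∫ x, V x * lapPow α 1 V x)
        + u ^ 2 / 2 * (∫ x, V x * lapPow α 2 V x) - u ^ 3 / 6 * (∫ x, V x * lapPow α 3 V x) := by
    have h := integral_eq_linear_combination
      (F := fun x => V x * (((V x - u * lapPow α 1 V x) + u ^ 2 / 2 * lapPow α 2 V x)
        - u ^ 3 / 6 * lapPow α 3 V x))
      (hb.integrable_mul hV.integrable) ((hl 1).integrable_mul hV.integrable)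
      ((hl 2).integrable_mul hV.integrable) ((hl 3).integrable_mul hV.integrable)
      (-u) (u ^ 2 / 2) (-(u ^ 3 / 6)) (fun x => by ring)
    rw [h]; ring
  rw [e] at h1
  refine h1.trans ?_
  have : 0 ≤ ∫ x, |V x| := integral_nonneg fun x => abs_nonneg _
  rw [mul_assoc]
  gcongr

/-- Expansion of the three-point correlation to second order. -/
lemma exists_three_point_bound (hα : 0 < α) (hp : PositiveDensities d α) {V : Rd d → ℝ}
    (hV : FourierDecay α V) :
    ∃ C : ℝ, ∀ t a b : ℝ, t ≤ 1 → 0 < a → a ≤ t → 0 < b → b ≤ t →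
      |(∫ x, V x * heatOp α b (fun y => V y * heatOp α a V y) x)
        - ((∫ x, V x ^ 3) - (a + b) * (∫ x, V x ^ 2 * lapPow α 1 V x)
          + (a ^ 2 + b ^ 2) / 2 * (∫ x, V x ^ 2 * lapPow α 2 V x)
          + a * b * (∫ x, V x * lapPow α 1 V x ^ 2))| ≤ C * t ^ 3 := by
  obtain ⟨M, hM1, hL, hT⟩ := hV.exists_taylor_bound hα 5
  have hb := hV.boundedMeasurable hα
  have hl := hV.boundedMeasurable_lapPow hα
  have hVM : ∀ x, |V x| ≤ M := fun x => by
    rw [← hV.lapPow_zero hα x]; exact hL 0 (by norm_num) x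
  have hT3 : ∀ u, 0 < u → ∀ x,
      |heatOp α u V x - (V x - u * lapPow α 1 V x + u ^ 2 / 2 * lapPow α 2 V x)| ≤ M * u ^ 3 := by
    intro u hu x
    have := hT 3 (by norm_num) u hu x
    simp only [Finset.sum_range_succ, Finset.sum_range_zero, hV.lapPow_zero hα] at this
    refine (le_of_eq ?_).trans this
    congr 1
    norm_num [Nat.factorial]
    ring
  refine ⟨(∫ x, |V x|) * (6 * M ^ 2), fun t a b ht ha hat hb0 hbt => ?_⟩
  have ht0 : 0 < t := ha.trans_le hat
  obtain ⟨A, hA⟩ := hb.bounded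
  -- By symmetry of `P_b`, the correlation is `∫ V (P_a V) (P_b V)`, a product of one-step terms.
  have e0 : ∫ x, V x * heatOp α b (fun y => V y * heatOp α a V y) x
      = ∫ x, V x * (heatOp α a V x * heatOp α b V x) := by
    rw [← integral_heatOp_mul hα hp hb0 hb.measurable
      ((hb.heatOp hα hp ha).integrable_mul hV.integrable) hA]
    congr 1; ext x; ring
  have hG : BoundedMeasurable (fun x => ((V x * V x - (a + b) * (V x * lapPow α 1 V x))
      + (a ^ 2 + b ^ 2) / 2 * (V x * lapPow α 2 V x))
      + a * b * (lapPow α 1 V x * lapPow α 1 V x)) :=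
    (((hb.mul hb).sub ((hb.mul (hl 1)).const_mul _)).add ((hb.mul (hl 2)).const_mul _)).add
      (((hl 1).mul (hl 1)).const_mul _)
  have h1 := ((hb.heatOp hα hp ha).mul (hb.heatOp hα hp hb0)).abs_integral_sub_le hG hV.integrable
    (M := 6 * M ^ 2 * t ^ 3) (fun x => by
      have ha3 : |heatOp α a V x - (V x - a * lapPow α 1 V x + a ^ 2 / 2 * lapPow α 2 V x)|
          ≤ M * t ^ 3 := (hT3 a ha x).trans (by gcongr)
      have hb3 : |heatOp α b V x - (V x - b * lapPow α 1 V x + b ^ 2 / 2 * lapPow α 2 V x)|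
          ≤ M * t ^ 3 := (hT3 b hb0 x).trans (by gcongr)
      have hbM := abs_heatOp_le hα hp hb0 hVM x
      have hv := hVM x
      have hl1 := hL 1 (by norm_num) x
      have hl2 := hL 2 (by norm_num) x
      -- What remains is an inequality between real numbers.
      generalize heatOp α a V x = p at *
      generalize heatOp α b V x = q at *
      generalize V x = v at *
      generalize lapPow α 1 V x = l at *
      generalize lapPow α 2 V x = m at *
      have ha1 : a ≤ 1 := hat.trans ht
      have hx0 : |v - a * l + a ^ 2 / 2 * m| ≤ 3 * M := by
        have h1 : |a * l| ≤ 1 * M := by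
          rw [abs_mul, abs_of_pos ha]; gcongr
        have h2 : |a ^ 2 / 2 * m| ≤ 1 * M := by
          rw [abs_mul, abs_of_pos (by positivity)]; gcongr
          nlinarith
        calc _ ≤ |v| + |a * l| + |a ^ 2 / 2 * m| :=
              (abs_add_le _ _).trans (add_le_add_left (abs_sub _ _) _)
          _ ≤ _ := by linarith
      have h5 := abs_mul_sub_mul_le ha3 hb3 hbM hx0
      -- Terms of total degree at least three in `a`, `b` are dropped from the product.
      have h6 : |(v - a * l + a ^ 2 / 2 * m) * (v - b * l + b ^ 2 / 2 * m)
          - (((v * v - (a + b) * (v * l)) + (a ^ 2 + b ^ 2) / 2 * (v * m)) + a * b * (l * l))|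
          ≤ 2 * M ^ 2 * t ^ 3 := by
        have e : (v - a * l + a ^ 2 / 2 * m) * (v - b * l + b ^ 2 / 2 * m)
          - (((v * v - (a + b) * (v * l)) + (a ^ 2 + b ^ 2) / 2 * (v * m)) + a * b * (l * l))
          = -((a * b ^ 2 / 2 + a ^ 2 * b / 2) * (l * m)) + a ^ 2 * b ^ 2 / 4 * (m * m) := by ring
        rw [e]
        have hlm : |l * m| ≤ M ^ 2 := by rw [abs_mul, sq]; gcongr
        have hmm : |m * m| ≤ M ^ 2 := by rw [abs_mul, sq]; gcongr
        have hc1 : a * b ^ 2 / 2 + a ^ 2 * b / 2 ≤ t ^ 3 := by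
          have h1 : a * b ^ 2 ≤ t * t ^ 2 := by gcongr
          have h2 : a ^ 2 * b ≤ t ^ 2 * t := by gcongr
          nlinarith
        have hc2 : a ^ 2 * b ^ 2 / 4 ≤ t ^ 3 := by
          have h1 : a ^ 2 * b ^ 2 ≤ t ^ 2 * t ^ 2 := by gcongr
          have h2 : t ^ 2 * t ^ 2 ≤ t ^ 3 := by
            have : t ^ 3 * t ≤ t ^ 3 * 1 := by gcongr
            nlinarith
          have : 0 < t ^ 3 := by positivity
          linarith
        calc _ ≤ |(a * b ^ 2 / 2 + a ^ 2 * b / 2) * (l * m)| + |a ^ 2 * b ^ 2 / 4 * (m * m)| := by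
              refine (abs_add_le _ _).trans ?_
              rw [abs_neg]
          _ ≤ t ^ 3 * M ^ 2 + t ^ 3 * M ^ 2 := by
              rw [abs_mul, abs_mul (a ^ 2 * b ^ 2 / 4), abs_of_pos (a := a * b ^ 2 / 2 + _)
                (by positivity), abs_of_pos (a := a ^ 2 * b ^ 2 / 4) (by positivity)]
              gcongr
          _ = _ := by ring
      calc _ ≤ _ := abs_sub_le _ ((v - a * l + a ^ 2 / 2 * m) * (v - b * l + b ^ 2 / 2 * m)) _
        _ ≤ _ := add_le_add h5 h6
        _ = _ := by ring)
  have e : ∫ x, V x * (((V x * V x - (a + b) * (V x * lapPow α 1 V x))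
      + (a ^ 2 + b ^ 2) / 2 * (V x * lapPow α 2 V x))
      + a * b * (lapPow α 1 V x * lapPow α 1 V x)) =
      (∫ x, V x ^ 3) - (a + b) * (∫ x, V x ^ 2 * lapPow α 1 V x)
          + (a ^ 2 + b ^ 2) / 2 * (∫ x, V x ^ 2 * lapPow α 2 V x)
          + a * b * (∫ x, V x * lapPow α 1 V x ^ 2) := by
    have i0 : Integrable fun x => V x ^ 3 :=
      ((hb.mul hb).integrable_mul hV.integrable).congr
        (Eventually.of_forall fun x => by simp only; ring)
    have i1 : Integrable fun x => V x ^ 2 * lapPow α 1 V x :=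
      ((hb.mul (hl 1)).integrable_mul hV.integrable).congr
        (Eventually.of_forall fun x => by simp only; ring)
    have i2 : Integrable fun x => V x ^ 2 * lapPow α 2 V x :=
      ((hb.mul (hl 2)).integrable_mul hV.integrable).congr
        (Eventually.of_forall fun x => by simp only; ring)
    have i3 : Integrable fun x => V x * lapPow α 1 V x ^ 2 :=
      (((hl 1).mul (hl 1)).integrable_mul hV.integrable).congr
        (Eventually.of_forall fun x => by simp only; ring)
    rw [integral_eq_linear_combination i0 i1 i2 i3 (-(a + b)) ((a ^ 2 + b ^ 2) / 2) (a * b)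
      (fun x => by ring)]
    ring
  rw [e0]
  rw [e] at h1
  exact h1.trans_eq (by ring)

/-- Expansion of the four-point correlation to first order. -/
lemma exists_four_point_bound (hα : 0 < α) (hp : PositiveDensities d α) {V : Rd d → ℝ}
    (hV : FourierDecay α V) (hW : FourierDecay α (fun x => V x ^ 2)) :
    ∃ C : ℝ, ∀ t a b c : ℝ, t ≤ 1 → 0 < a → a ≤ t → 0 < b → b ≤ t → 0 < c → c ≤ t →
      |(∫ x, V x * heatOp α c (fun y => V y * heatOp α b (fun z => V z * heatOp α a V z) y) x)
        - ((∫ x, V x ^ 4) - (a + c) * (∫ x, V x ^ 3 * lapPow α 1 V x)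
          - b * (∫ x, V x ^ 2 * lapPow α 1 (fun y => V y ^ 2) x))| ≤ C * t ^ 2 := by
  obtain ⟨M₁, hM1, hL, hT⟩ := hV.exists_taylor_bound hα 5
  obtain ⟨M₂, hM2, hL', hT'⟩ := hW.exists_taylor_bound hα 5
  set M := max M₁ M₂ with hM
  have hM0 : 1 ≤ M := hM1.trans (le_max_left _ _)
  set W : Rd d → ℝ := fun x => V x ^ 2 with hWdef
  have hb := hV.boundedMeasurable hα
  have hl := hV.boundedMeasurable_lapPow hα 1
  have hbW := hW.boundedMeasurable hα
  have hlW := hW.boundedMeasurable_lapPow hα 1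
  have hVM : ∀ x, |V x| ≤ M := fun x => by
    rw [← hV.lapPow_zero hα x]; exact (hL 0 (by norm_num) x).trans (le_max_left _ _)
  have hWM : ∀ x, |W x| ≤ M := fun x => by
    rw [← hW.lapPow_zero hα x]; exact (hL' 0 (by norm_num) x).trans (le_max_right _ _)
  have hLM : ∀ x, |lapPow α 1 V x| ≤ M := fun x =>
    (hL 1 (by norm_num) x).trans (le_max_left _ _)
  have hLWM : ∀ x, |lapPow α 1 W x| ≤ M := fun x =>
    (hL' 1 (by norm_num) x).trans (le_max_right _ _)
  have hT2 : ∀ u, 0 < u → ∀ x,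
      |heatOp α u V x - (V x - u * lapPow α 1 V x)| ≤ M * u ^ 2 := by
    intro u hu x
    have := hT 2 (by norm_num) u hu x
    simp only [Finset.sum_range_succ, Finset.sum_range_zero, hV.lapPow_zero hα] at this
    refine (le_of_eq ?_).trans (this.trans (mul_le_mul_of_nonneg_right (le_max_left _ _)
      (pow_nonneg hu.le _)))
    congr 1
    norm_num [Nat.factorial]
    ring
  have hT2' : ∀ u, 0 < u → ∀ x,
      |heatOp α u W x - (W x - u * lapPow α 1 W x)| ≤ M * u ^ 2 := by
    intro u hu x
    have := hT' 2 (by norm_num) u hu x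
    simp only [Finset.sum_range_succ, Finset.sum_range_zero, hW.lapPow_zero hα] at this
    refine (le_of_eq ?_).trans (this.trans (mul_le_mul_of_nonneg_right (le_max_right _ _)
      (pow_nonneg hu.le _)))
    congr 1
    norm_num [Nat.factorial]
    ring
  have hT1' : ∀ u, 0 < u → ∀ x, |heatOp α u W x - W x| ≤ M * u := by
    intro u hu x
    have := hT' 1 (by norm_num) u hu x
    rw [pow_one] at this
    simp only [Finset.sum_range_succ, Finset.sum_range_zero, hW.lapPow_zero hα] at this
    refine (le_of_eq ?_).trans (this.trans (mul_le_mul_of_nonneg_right (le_max_right _ _)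
      hu.le))
    congr 1
    norm_num [Nat.factorial]
  have hI : 0 ≤ ∫ x, |V x| := integral_nonneg fun x => abs_nonneg _
  refine ⟨(∫ x, |V x|) * (9 * M ^ 3) + (∫ x, |V x * lapPow α 1 V x|) * M,
    fun t a b c ht ha hat hb0 hbt hc0 hct => ?_⟩
  have ht0 : 0 < t := ha.trans_le hat
  obtain ⟨A, hA⟩ := hb.bounded
  have hPa := hb.heatOp hα hp ha
  have hPc := hb.heatOp hα hp hc0
  have hVL := hb.mul hl
  have hinner := (hb.mul hPa).heatOp hα hp hb0
  have hPVL := hVL.heatOp hα hp hb0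
  -- By symmetry of `P_c`, the correlation is `∫ V (P_c V) (P_b (V P_a V))`.
  have e0 : ∫ x, V x * heatOp α c (fun y => V y * heatOp α b (fun z => V z * heatOp α a V z) y) x
      = ∫ x, V x * (heatOp α c V x * heatOp α b (fun z => V z * heatOp α a V z) x) := by
    rw [← integral_heatOp_mul hα hp hc0 hb.measurable (hinner.integrable_mul hV.integrable) hA]
    congr 1; ext x; ring
  -- The product `V (-Δ)^{α/2} V` is not expanded under `P_b`, for want of decay of its Fourier
  -- transform: symmetry moves `P_b` onto `V²` instead.
  have hG : BoundedMeasurable (fun x => ((V x * W x - b * (V x * lapPow α 1 W x))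
      - c * (lapPow α 1 V x * W x)) - a * (V x * heatOp α b (fun y => V y * lapPow α 1 V y) x)) :=
    (((hb.mul hbW).sub ((hb.mul hlW).const_mul _)).sub ((hl.mul hbW).const_mul _)).sub
      ((hb.mul hPVL).const_mul _)
  have h1 := (hPc.mul hinner).abs_integral_sub_le hG hV.integrable
    (M := 9 * M ^ 3 * t ^ 2) (fun x => by
      have hc2 : |heatOp α c V x - (V x - c * lapPow α 1 V x)| ≤ M * t ^ 2 :=
        (hT2 c hc0 x).trans (by gcongr)
      have hin : |heatOp α b (fun z => V z * heatOp α a V z) x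
          - heatOp α b (fun z => W z - a * (V z * lapPow α 1 V z)) x| ≤ M ^ 2 * t ^ 2 := by
        have hR := hbW.sub (hVL.const_mul a)
        obtain ⟨B₁, hB₁⟩ := (hb.mul hPa).bounded
        obtain ⟨B₂, hB₂⟩ := hR.bounded
        refine abs_heatOp_sub_le hα hp hb0 (hb.mul hPa).measurable hR.measurable hB₁ hB₂
          (fun y => ?_) x
        have e : V y * heatOp α a V y - (W y - a * (V y * lapPow α 1 V y))
            = V y * (heatOp α a V y - (V y - a * lapPow α 1 V y)) := by
          simp only [hWdef]; ring
        rw [e, abs_mul]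
        calc _ ≤ M * (M * a ^ 2) := mul_le_mul (hVM y) (hT2 a ha y) (abs_nonneg _) (by positivity)
          _ ≤ M * (M * t ^ 2) := by gcongr
          _ = _ := by ring
      rw [hbW.heatOp_sub hα hp hb0 hVL] at hin
      have hW2 : |heatOp α b W x - (W x - b * lapPow α 1 W x)| ≤ M * t ^ 2 :=
        (hT2' b hb0 x).trans (by gcongr)
      have hrM : |heatOp α b (fun y => V y * lapPow α 1 V y) x| ≤ M ^ 2 :=
        abs_heatOp_le hα hp hb0 (fun y => by
          rw [abs_mul, sq]
          exact mul_le_mul (hVM y) (hLM y) (abs_nonneg _) (by positivity)) x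
      have hqM : |heatOp α b (fun z => V z * heatOp α a V z) x| ≤ M ^ 2 :=
        abs_heatOp_le hα hp hb0 (fun y => by
          rw [abs_mul, sq]
          exact mul_le_mul (hVM y) (abs_heatOp_le hα hp ha hVM y) (abs_nonneg _)
            (by positivity)) x
      have hv := hVM x
      have hw := hWM x
      have hl1 := hLM x
      have hl2 := hLWM x
      generalize heatOp α b (fun z => V z * heatOp α a V z) x = q at *
      generalize heatOp α b (fun y => V y * lapPow α 1 V y) x = r at *
      generalize heatOp α b W x = s at *
      generalize heatOp α c V x = p at *
      generalize V x = v at *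
      generalize W x = w at *
      generalize lapPow α 1 V x = l at *
      generalize lapPow α 1 W x = m at *
      have hM12 : M ≤ M ^ 2 := by nlinarith
      have hM23 : M ^ 2 ≤ M ^ 3 := by
        have : M ^ 2 * 1 ≤ M ^ 2 * M := by gcongr
        nlinarith
      have hq : |q - (w - b * m - a * r)| ≤ 2 * M ^ 2 * t ^ 2 := by
        have e : q - (w - b * m - a * r) = (q - (s - a * r)) + (s - (w - b * m)) := by ring
        rw [e]
        refine (abs_add_le _ _).trans ?_
        have : M * t ^ 2 ≤ M ^ 2 * t ^ 2 := by gcongr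
        linarith
      have hx0 : |v - c * l| ≤ 2 * M := by
        refine (abs_sub _ _).trans ?_
        have : |c * l| ≤ 1 * M := by
          rw [abs_mul, abs_of_pos hc0]
          have := hct.trans ht
          gcongr
        linarith
      have h5 := abs_mul_sub_mul_le hc2 hq hqM hx0
      have h6 : |(v - c * l) * (w - b * m - a * r)
          - (((v * w - b * (v * m)) - c * (l * w)) - a * (v * r))| ≤ 2 * M ^ 3 * t ^ 2 := by
        have e : (v - c * l) * (w - b * m - a * r)
            - (((v * w - b * (v * m)) - c * (l * w)) - a * (v * r))
            = c * b * (l * m) + c * a * (l * r) := by ring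
        rw [e]
        have hlm : |l * m| ≤ M ^ 3 := by
          rw [abs_mul]
          calc _ ≤ M * M := by gcongr
            _ ≤ _ := by nlinarith
        have hlr : |l * r| ≤ M ^ 3 := by
          rw [abs_mul]
          calc _ ≤ M * M ^ 2 := by gcongr
            _ = _ := by ring
        calc _ ≤ |c * b * (l * m)| + |c * a * (l * r)| := abs_add_le _ _
          _ ≤ t * t * M ^ 3 + t * t * M ^ 3 := by
              rw [abs_mul (c * b), abs_mul (c * a), abs_of_pos (a := c * b) (by positivity),
                abs_of_pos (a := c * a) (by positivity)]
              gcongr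
          _ = _ := by ring
      calc _ ≤ _ := abs_sub_le _ ((v - c * l) * (w - b * m - a * r)) _
        _ ≤ _ := add_le_add h5 h6
        _ ≤ _ := by
            have : 0 ≤ M ^ 3 * t ^ 2 := by positivity
            nlinarith)
  -- The coefficient of `a`, after `P_b` has been moved onto `V²`.
  have h2 : |(∫ x, V x * lapPow α 1 V x * heatOp α b W x) - ∫ x, V x * lapPow α 1 V x * W x|
      ≤ (∫ x, |V x * lapPow α 1 V x|) * (M * t) :=
    (hbW.heatOp hα hp hb0).abs_integral_sub_le hbW (hl.integrable_mul hV.integrable)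
      (fun x => (hT1' b hb0 x).trans (by gcongr))
  have e3 : ∫ x, W x * heatOp α b (fun y => V y * lapPow α 1 V y) x
      = ∫ x, V x * lapPow α 1 V x * heatOp α b W x := by
    rw [← integral_heatOp_mul hα hp hb0 hbW.measurable (hl.integrable_mul hV.integrable) hWM]
    congr 1; ext x; ring
  have e4 : ∫ x, V x * lapPow α 1 V x * W x = ∫ x, V x ^ 3 * lapPow α 1 V x := by
    congr 1; ext x; simp only [hWdef]; ring
  have e : ∫ x, V x * (((V x * W x - b * (V x * lapPow α 1 W x))
      - c * (lapPow α 1 V x * W x)) - a * (V x * heatOp α b (fun y => V y * lapPow α 1 V y) x)) =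
      (∫ x, V x ^ 4) - b * (∫ x, V x ^ 2 * lapPow α 1 W x)
        - c * (∫ x, V x ^ 3 * lapPow α 1 V x)
        - a * ∫ x, W x * heatOp α b (fun y => V y * lapPow α 1 V y) x := by
    have i0 : Integrable fun x => V x ^ 4 :=
      ((hb.mul hbW).integrable_mul hV.integrable).congr
        (Eventually.of_forall fun x => by simp only [hWdef]; ring)
    have i1 : Integrable fun x => V x ^ 2 * lapPow α 1 W x :=
      ((hb.mul hlW).integrable_mul hV.integrable).congr
        (Eventually.of_forall fun x => by simp only; ring)
    have i2 : Integrable fun x => V x ^ 3 * lapPow α 1 V x :=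
      ((hl.mul hbW).integrable_mul hV.integrable).congr
        (Eventually.of_forall fun x => by simp only [hWdef]; ring)
    rw [integral_eq_linear_combination i0 i1 i2 (hPVL.integrable_mul hW.integrable) (-b) (-c) (-a)
      (fun x => by simp only [hWdef]; ring)]
    ring
  rw [e, e3] at h1
  rw [e4] at h2
  rw [e0]
  generalize ∫ x, V x * lapPow α 1 V x * heatOp α b W x = J at *
  generalize ∫ x, V x ^ 3 * lapPow α 1 V x = J0 at *
  have h3 : |a * (J - J0)| ≤ (∫ x, |V x * lapPow α 1 V x|) * M * t ^ 2 := by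
    rw [abs_mul, abs_of_pos ha]
    calc _ ≤ t * ((∫ x, |V x * lapPow α 1 V x|) * (M * t)) :=
          mul_le_mul hat h2 (abs_nonneg _) ht0.le
      _ = _ := by ring
  rw [abs_le] at h1 h3 ⊢
  constructor <;> nlinarith [h1.1, h1.2, h3.1, h3.2]

/-- The five-point correlation to order zero. -/
lemma exists_five_point_bound (hα : 0 < α) (hp : PositiveDensities d α) {V : Rd d → ℝ}
    (hV : FourierDecay α V) (hW : FourierDecay α (fun x => V x ^ 2)) :
    ∃ C : ℝ, ∀ t a b c e : ℝ, 0 < a → a ≤ t → 0 < b → b ≤ t → 0 < c → c ≤ t → 0 < e → e ≤ t →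
      |(∫ x, V x * heatOp α e (fun y => V y * heatOp α c (fun z => V z *
          heatOp α b (fun w => V w * heatOp α a V w) z) y) x) - ∫ x, V x ^ 5| ≤ C * t := by
  obtain ⟨M₁, hM1, hL, hT⟩ := hV.exists_taylor_bound hα 5
  obtain ⟨M₂, hM2, hL', hT'⟩ := hW.exists_taylor_bound hα 5
  set M := max M₁ M₂ with hM
  have hM0 : 1 ≤ M := hM1.trans (le_max_left _ _)
  set W : Rd d → ℝ := fun x => V x ^ 2 with hWdef
  have hb := hV.boundedMeasurable hα
  have hbW := hW.boundedMeasurable hα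
  have hVM : ∀ x, |V x| ≤ M := fun x => by
    rw [← hV.lapPow_zero hα x]; exact (hL 0 (by norm_num) x).trans (le_max_left _ _)
  have hWM : ∀ x, |W x| ≤ M := fun x => by
    rw [← hW.lapPow_zero hα x]; exact (hL' 0 (by norm_num) x).trans (le_max_right _ _)
  have hT1 : ∀ u, 0 < u → ∀ x, |heatOp α u V x - V x| ≤ M * u := by
    intro u hu x
    have := hT 1 (by norm_num) u hu x
    rw [pow_one] at this
    simp only [Finset.sum_range_succ, Finset.sum_range_zero, hV.lapPow_zero hα] at this
    refine (le_of_eq ?_).trans (this.trans (mul_le_mul_of_nonneg_right (le_max_left _ _)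
      hu.le))
    congr 1
    norm_num [Nat.factorial]
  have hT1' : ∀ u, 0 < u → ∀ x, |heatOp α u W x - W x| ≤ M * u := by
    intro u hu x
    have := hT' 1 (by norm_num) u hu x
    rw [pow_one] at this
    simp only [Finset.sum_range_succ, Finset.sum_range_zero, hW.lapPow_zero hα] at this
    refine (le_of_eq ?_).trans (this.trans (mul_le_mul_of_nonneg_right (le_max_right _ _)
      hu.le))
    congr 1
    norm_num [Nat.factorial]
  -- `P_b (V P_a V)` is uniformly close to `V²`
  have hpair : ∀ t a b, 0 < a → a ≤ t → 0 < b → b ≤ t → ∀ x,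
      |heatOp α b (fun w => V w * heatOp α a V w) x - W x| ≤ 2 * M ^ 2 * t := by
    intro t a b ha hat hb0 hbt x
    obtain ⟨B₁, hB₁⟩ := (hb.mul (hb.heatOp hα hp ha)).bounded
    have h1 : |heatOp α b (fun w => V w * heatOp α a V w) x - heatOp α b W x| ≤ M * (M * t) := by
      refine abs_heatOp_sub_le hα hp hb0 (hb.mul (hb.heatOp hα hp ha)).measurable hbW.measurable
        hB₁ hWM (fun y => ?_) x
      have e : V y * heatOp α a V y - W y = V y * (heatOp α a V y - V y) := by
        simp only [hWdef]; ring
      rw [e, abs_mul]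
      exact mul_le_mul (hVM y) ((hT1 a ha y).trans (by gcongr)) (abs_nonneg _) (by positivity)
    have ht0 : 0 < t := ha.trans_le hat
    have h2 : |heatOp α b W x - W x| ≤ M * (M * t) := (hT1' b hb0 x).trans (by
      calc M * b ≤ M * t := by gcongr
        _ ≤ M * (M * t) := by gcongr; nlinarith)
    calc _ ≤ _ := abs_sub_le _ (heatOp α b W x) _
      _ ≤ _ := add_le_add h1 h2
      _ = _ := by ring
  refine ⟨(∫ x, |V x|) * (4 * M ^ 4), fun t a b c e ha hat hb0 hbt hc0 hct he0 het => ?_⟩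
  have ht0 : 0 < t := ha.trans_le hat
  have h_in := (hb.mul (hb.heatOp hα hp ha)).heatOp hα hp hb0
  have h_out := (hb.mul (hb.heatOp hα hp he0)).heatOp hα hp hc0
  obtain ⟨A, hA⟩ := hb.bounded
  obtain ⟨A', hA'⟩ := (hb.mul (hb.heatOp hα hp he0)).bounded
  -- By symmetry of `P_e` and `P_c`, the correlation is `∫ V (P_c (V P_e V)) (P_b (V P_a V))`.
  have e0 : ∫ x, V x * heatOp α e (fun y => V y * heatOp α c (fun z => V z *
          heatOp α b (fun w => V w * heatOp α a V w) z) y) x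
      = ∫ x, V x * (heatOp α c (fun w => V w * heatOp α e V w) x *
          heatOp α b (fun w => V w * heatOp α a V w) x) := by
    rw [← integral_heatOp_mul hα hp he0 hb.measurable
      (((hb.mul h_in).heatOp hα hp hc0).integrable_mul hV.integrable) hA]
    have e1 := integral_heatOp_mul hα hp hc0 (hb.mul (hb.heatOp hα hp he0)).measurable
      (h_in.integrable_mul hV.integrable) hA'
    calc _ = ∫ x, V x * heatOp α e V x * heatOp α c (fun z => V z *
          heatOp α b (fun w => V w * heatOp α a V w) z) x := by congr 1; ext x; ring
      _ = _ := e1.symm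
      _ = _ := by congr 1; ext x; ring
  have h1 := (h_out.mul h_in).abs_integral_sub_le (hbW.mul hbW) hV.integrable
    (M := 4 * M ^ 4 * t) (fun x => by
      have hqM : |heatOp α b (fun z => V z * heatOp α a V z) x| ≤ M ^ 2 :=
        abs_heatOp_le hα hp hb0 (fun y => by
          rw [abs_mul, sq]
          exact mul_le_mul (hVM y) (abs_heatOp_le hα hp ha hVM y) (abs_nonneg _)
            (by positivity)) x
      refine (abs_mul_sub_mul_le (hpair t e c he0 het hc0 hct x) (hpair t a b ha hat hb0 hbt x)
        hqM (hWM x)).trans ?_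
      have : M * (2 * M ^ 2 * t) ≤ M ^ 2 * (2 * M ^ 2 * t) := by gcongr; nlinarith
      linarith)
  rw [e0]
  have e5 : ∫ x, V x ^ 5 = ∫ x, V x * (W x * W x) := by
    congr 1; ext x; simp only [hWdef]; ring
  rw [e5]
  exact h1.trans_eq (by ring)

end

section

/-! ### Integration over finite sequences -/

section Snoc

variable {E : Type*} [MeasureSpace E] {n : ℕ}

/-- Appending a last entry, with constant type family. -/
abbrev snoc {E : Type*} {n : ℕ} (z : Fin n → E) (w : E) : Fin (n + 1) → E :=
  Fin.snoc (α := fun _ => E) z w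

/-- Prepending a first entry, with constant type family. -/
abbrev cons {E : Type*} {n : ℕ} (w : E) (z : Fin n → E) : Fin (n + 1) → E :=
  Fin.cons (α := fun _ => E) w z

lemma measurableEmbedding_snoc :
    MeasurableEmbedding (fun q : E × (Fin n → E) => snoc q.2 q.1) := by
  have h := (MeasurableEquiv.piFinSuccAbove
    (fun _ : Fin (n + 1) => E) (Fin.last n)).symm.measurableEmbedding
  have e : ⇑(MeasurableEquiv.piFinSuccAbove (fun _ : Fin (n + 1) => E) (Fin.last n)).symm
      = fun q : E × (Fin n → E) => snoc q.2 q.1 := by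
    ext q i
    simp [MeasurableEquiv.piFinSuccAbove_symm_apply, Fin.insertNthEquiv]
  rwa [e] at h

lemma measurableEmbedding_cons :
    MeasurableEmbedding (fun q : E × (Fin n → E) => cons q.1 q.2) := by
  have h := (MeasurableEquiv.piFinSuccAbove
    (fun _ : Fin (n + 1) => E) 0).symm.measurableEmbedding
  have e : ⇑(MeasurableEquiv.piFinSuccAbove (fun _ : Fin (n + 1) => E) 0).symm
      = fun q : E × (Fin n → E) => cons q.1 q.2 := by
    ext q i
    simp [MeasurableEquiv.piFinSuccAbove_symm_apply, Fin.insertNthEquiv]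
  rwa [e] at h

variable [SigmaFinite (volume : Measure E)]

lemma measurePreserving_snoc :
    MeasurePreserving (fun q : E × (Fin n → E) => snoc q.2 q.1) := by
  have h := (volume_preserving_piFinSuccAbove (fun _ : Fin (n + 1) => E) (Fin.last n)).symm
  have e : ⇑(MeasurableEquiv.piFinSuccAbove (fun _ : Fin (n + 1) => E) (Fin.last n)).symm
      = fun q : E × (Fin n → E) => snoc q.2 q.1 := by
    ext q i
    simp [MeasurableEquiv.piFinSuccAbove_symm_apply, Fin.insertNthEquiv]
  rwa [e] at h

lemma measurePreserving_cons :
    MeasurePreserving (fun q : E × (Fin n → E) => cons q.1 q.2) := by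
  have h := (volume_preserving_piFinSuccAbove (fun _ : Fin (n + 1) => E) 0).symm
  have e : ⇑(MeasurableEquiv.piFinSuccAbove (fun _ : Fin (n + 1) => E) 0).symm
      = fun q : E × (Fin n → E) => cons q.1 q.2 := by
    ext q i
    simp [MeasurableEquiv.piFinSuccAbove_symm_apply, Fin.insertNthEquiv]
  rwa [e] at h

lemma integrable_snoc_iff {f : (Fin (n + 1) → E) → ℝ} :
    Integrable (fun q : E × (Fin n → E) => f (snoc q.2 q.1)) ↔ Integrable f :=
  measurePreserving_snoc.integrable_comp_emb measurableEmbedding_snoc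

lemma integral_snoc (f : (Fin (n + 1) → E) → ℝ) :
    ∫ q : E × (Fin n → E), f (snoc q.2 q.1) = ∫ z, f z :=
  measurePreserving_snoc.integral_comp measurableEmbedding_snoc f

lemma integrable_cons_iff {f : (Fin (n + 1) → E) → ℝ} :
    Integrable (fun q : E × (Fin n → E) => f (cons q.1 q.2)) ↔ Integrable f :=
  measurePreserving_cons.integrable_comp_emb measurableEmbedding_cons

lemma integral_cons (f : (Fin (n + 1) → E) → ℝ) :
    ∫ q : E × (Fin n → E), f (cons q.1 q.2) = ∫ z, f z :=
  measurePreserving_cons.integral_comp measurableEmbedding_cons f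

end Snoc

lemma integral_fin_zero {E : Type*} [MeasureSpace E] [SigmaFinite (volume : Measure E)]
    (f : (Fin 0 → E) → ℝ) : ∫ z, f z = f ![] := by
  have h : ∀ z : Fin 0 → E, f z = f ![] := fun z => by rw [Subsingleton.elim z ![]]
  simp only [h, integral_const]
  simp [measureReal_def, volume_pi, Measure.pi_of_empty _ ![]]

instance isFiniteMeasure_fin_zero {E : Type*} [MeasureSpace E]
    [SigmaFinite (volume : Measure E)] : IsFiniteMeasure (volume : Measure (Fin 0 → E)) := by
  rw [volume_pi, Measure.pi_of_empty _ ![]]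
  infer_instance

/-! ### Chains of transition densities -/

variable {d : ℕ} {α : ℝ}

/-- The product of the transition densities along a finite sequence of times and positions. -/
def chainDensity {d : ℕ} (α : ℝ) {n : ℕ} (τ : Fin (n + 1) → ℝ) (ζ : Fin (n + 1) → Rd d) : ℝ :=
  ∏ i : Fin n, stableDensity α (τ i.succ - τ i.castSucc) (ζ i.succ - ζ i.castSucc)

/-- The function obtained by alternately multiplying by a weight `u i` and running the semigroup
from the time `τ i` to the next one, the last of which is `t`. -/
def chainOp {d : ℕ} (α : ℝ) : (n : ℕ) → (Fin n → ℝ) → (Fin n → Rd d → ℝ) → ℝ → Rd d → ℝ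
  | 0, _, _, _ => fun _ => 1
  | n + 1, τ, u, t => heatOp α (t - τ (Fin.last n)) (fun w => u (Fin.last n) w *
      chainOp α n (fun i => τ i.castSucc) (fun i => u i.castSucc) (τ (Fin.last n)) w)

lemma chainDensity_snoc {n : ℕ} (τ : Fin (n + 1) → ℝ) (ζ : Fin (n + 1) → Rd d) (t : ℝ)
    (y : Rd d) :
    chainDensity α (snoc τ t) (snoc ζ y)
      = chainDensity α τ ζ * stableDensity α (t - τ (Fin.last n)) (y - ζ (Fin.last n)) := by
  rw [chainDensity, Fin.prod_univ_castSucc, chainDensity]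
  simp only [Fin.succ_castSucc, Fin.snoc_castSucc, Fin.succ_last, Fin.snoc_last]

lemma snoc_init {E : Type*} {n : ℕ} (τ : Fin (n + 1) → E) :
    snoc (fun i => τ i.castSucc) (τ (Fin.last n)) = τ :=
  Fin.snoc_init_self (α := fun _ => E) τ

lemma measurable_chainDensity (hα : 0 < α) (n : ℕ) :
    Measurable (fun q : (Fin (n + 1) → ℝ) × (Fin (n + 1) → Rd d) =>
      chainDensity α q.1 q.2) := by
  unfold chainDensity
  refine Finset.measurable_prod _ fun i _ => ?_
  exact (measurable_stableDensity hα).comp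
    (f := fun q : (Fin (n + 1) → ℝ) × (Fin (n + 1) → Rd d) =>
      (q.1 i.succ - q.1 i.castSucc, q.2 i.succ - q.2 i.castSucc)) (by fun_prop)

lemma chainDensity_nonneg (hp : PositiveDensities d α) {n : ℕ} {τ : Fin (n + 1) → ℝ}
    (hτ : StrictMono τ) (ζ : Fin (n + 1) → Rd d) : 0 ≤ chainDensity α τ ζ :=
  Finset.prod_nonneg fun _ _ =>
    (hp _ (sub_pos.mpr (hτ (Fin.castSucc_lt_succ))) _).le

lemma measurable_snoc {E : Type*} [MeasurableSpace E] (n : ℕ) :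
    Measurable (fun q : (Fin n → E) × E => snoc q.1 q.2) := by
  refine measurable_pi_lambda _ fun i => ?_
  refine Fin.lastCases ?_ (fun j => ?_) i
  · simp only [Fin.snoc_last]; exact measurable_snd
  · simp only [Fin.snoc_castSucc]; exact (measurable_pi_apply j).comp measurable_fst

lemma measurable_cons {E : Type*} [MeasurableSpace E] (n : ℕ) :
    Measurable (fun q : E × (Fin n → E) => cons q.1 q.2) := by
  refine measurable_pi_lambda _ fun i => ?_
  refine Fin.cases ?_ (fun j => ?_) i
  · simp only [Fin.cons_zero]; exact measurable_fst
  · simp only [Fin.cons_succ]; exact (measurable_pi_apply j).comp measurable_snd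

lemma measurable_chainDensity_prod (hα : 0 < α) {n : ℕ} (τ : Fin n → ℝ) (t : ℝ) :
    Measurable (fun q : Rd d × (Fin n → Rd d) => chainDensity α (snoc τ t) (snoc q.2 q.1)) := by
  have h1 : Measurable (fun q : Rd d × (Fin n → Rd d) => snoc q.2 q.1) :=
    (measurable_snoc n).comp (f := fun q : Rd d × (Fin n → Rd d) => (q.2, q.1)) measurable_swap
  exact (measurable_chainDensity hα n).comp
    (f := fun q : Rd d × (Fin n → Rd d) => (snoc τ t, snoc q.2 q.1)) (measurable_const.prodMk h1)

/-- Seen backwards from its end point, a chain of transition densities is a probability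
density. -/
lemma integrable_chainDensity (hα : 0 < α) (hp : PositiveDensities d α) (n : ℕ) :
    ∀ (τ : Fin n → ℝ) (t : ℝ), StrictMono (snoc τ t) → ∀ y : Rd d,
      Integrable (fun ζ : Fin n → Rd d => chainDensity α (snoc τ t) (snoc ζ y)) ∧
      ∫ ζ : Fin n → Rd d, chainDensity α (snoc τ t) (snoc ζ y) = 1 := by
  induction n with
  | zero =>
    intro τ t _ y
    rw [integral_fin_zero]
    simp [chainDensity]
  | succ n ih =>
    intro τ t hτ y
    set r := τ (Fin.last n) with hr
    set τ' : Fin n → ℝ := fun i => τ i.castSucc with hτ'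
    have hsn : snoc τ' r = τ := snoc_init τ
    have hmono : StrictMono (snoc τ' r) := by
      rw [hsn]
      intro i j hij
      have := hτ (Fin.castSucc_lt_castSucc_iff.mpr hij)
      simpa using this
    have hrt : 0 < t - r := by
      have := hτ (Fin.castSucc_lt_last (Fin.last n))
      simp only [Fin.snoc_castSucc, Fin.snoc_last] at this
      exact sub_pos.mpr this
    have hfac : ∀ q : Rd d × (Fin n → Rd d), chainDensity α (snoc τ t) (snoc (snoc q.2 q.1) y)
        = stableDensity α (t - r) (y - q.1) * chainDensity α (snoc τ' r) (snoc q.2 q.1) := by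
      intro q
      rw [chainDensity_snoc, hsn, mul_comm]
      simp only [Fin.snoc_last, hr]
    have hm : AEStronglyMeasurable (fun q : Rd d × (Fin n → Rd d) =>
        stableDensity α (t - r) (y - q.1) * chainDensity α (snoc τ' r) (snoc q.2 q.1))
        (volume.prod volume) :=
      ((((continuous_stableDensity hα hrt).measurable.comp
        (measurable_const.sub measurable_fst))).mul
        (measurable_chainDensity_prod hα τ' r)).aestronglyMeasurable
    have hI : Integrable (fun q : Rd d × (Fin n → Rd d) =>
        stableDensity α (t - r) (y - q.1) * chainDensity α (snoc τ' r) (snoc q.2 q.1))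
        (volume.prod volume) := by
      refine (integrable_prod_iff hm).mpr
        ⟨Eventually.of_forall fun w => 
          (ih τ' r hmono w).1.const_mul (stableDensity α (t - r) (y - w)), ?_⟩
      refine (integrable_stableDensity_sub hα hp hrt y).congr (Eventually.of_forall fun w => ?_)
      simp only [norm_mul, Real.norm_eq_abs, abs_of_pos (hp _ hrt _),
        abs_of_nonneg (chainDensity_nonneg hp hmono _)]
      rw [integral_const_mul, (ih τ' r hmono w).2, mul_one]
    refine ⟨integrable_snoc_iff.mp ?_, ?_⟩
    · simp_rw [hfac]; exact hI
    · rw [← integral_snoc]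
      simp_rw [hfac]
      rw [Measure.volume_eq_prod, integral_prod _ hI]
      simp_rw [integral_const_mul, (ih τ' r hmono _).2, mul_one]
      exact integral_stableDensity_sub hα hp hrt y

lemma measurable_prod_weights {n : ℕ} {u : Fin n → Rd d → ℝ}
    (hu : ∀ i, BoundedMeasurable (u i)) :
    Measurable (fun ζ : Fin n → Rd d => ∏ i, u i (ζ i)) :=
  Finset.measurable_prod _ fun i _ => (hu i).measurable.comp (measurable_pi_apply i)

lemma exists_bound_prod_weights {n : ℕ} {u : Fin n → Rd d → ℝ}
    (hu : ∀ i, BoundedMeasurable (u i)) :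
    ∃ M, ∀ ζ : Fin n → Rd d, |∏ i, u i (ζ i)| ≤ M := by
  choose M hM using fun i => (hu i).bounded
  refine ⟨∏ i, M i, fun ζ => ?_⟩
  rw [Finset.abs_prod]
  exact Finset.prod_le_prod (fun i _ => abs_nonneg _) fun i _ => hM i _

lemma integrable_weighted_chain (hα : 0 < α) (hp : PositiveDensities d α) {n : ℕ}
    {u : Fin n → Rd d → ℝ} (hu : ∀ i, BoundedMeasurable (u i)) {τ : Fin n → ℝ} {t : ℝ}
    (hτ : StrictMono (snoc τ t)) (y : Rd d) :
    Integrable (fun ζ : Fin n → Rd d =>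
      (∏ i, u i (ζ i)) * chainDensity α (snoc τ t) (snoc ζ y)) := by
  obtain ⟨M, hM⟩ := exists_bound_prod_weights hu
  exact (integrable_chainDensity hα hp n τ t hτ y).1.bdd_mul
    (measurable_prod_weights hu).aestronglyMeasurable (Eventually.of_forall hM)

lemma boundedMeasurable_chainOp (hα : 0 < α) (hp : PositiveDensities d α) (n : ℕ) :
    ∀ (u : Fin n → Rd d → ℝ), (∀ i, BoundedMeasurable (u i)) → ∀ (τ : Fin n → ℝ) (t : ℝ),
      StrictMono (snoc τ t) → BoundedMeasurable (chainOp α n τ u t) := by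
  induction n with
  | zero => intro u _ τ t _; exact BoundedMeasurable.const 1
  | succ n ih =>
    intro u hu τ t hτ
    have hmono : StrictMono (snoc (fun i => τ i.castSucc) (τ (Fin.last n))) := by
      rw [snoc_init]
      intro i j hij
      have := hτ (Fin.castSucc_lt_castSucc_iff.mpr hij)
      simpa using this
    have hrt : 0 < t - τ (Fin.last n) := by
      have := hτ (Fin.castSucc_lt_last (Fin.last n))
      simp only [Fin.snoc_castSucc, Fin.snoc_last] at this
      exact sub_pos.mpr this
    exact ((hu _).mul (ih _ (fun i => hu _) _ _ hmono)).heatOp hα hp hrt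

/-- Integrating a weighted chain over all but its end point. -/
lemma integral_weighted_chain (hα : 0 < α) (hp : PositiveDensities d α) (n : ℕ) :
    ∀ (u : Fin n → Rd d → ℝ), (∀ i, BoundedMeasurable (u i)) → ∀ (τ : Fin n → ℝ) (t : ℝ),
      StrictMono (snoc τ t) → ∀ y : Rd d,
      ∫ ζ : Fin n → Rd d, (∏ i, u i (ζ i)) * chainDensity α (snoc τ t) (snoc ζ y)
        = chainOp α n τ u t y := by
  induction n with
  | zero =>
    intro u _ τ t _ y
    rw [integral_fin_zero]
    simp [chainDensity, chainOp]
  | succ n ih =>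
    intro u hu τ t hτ y
    have hmono : StrictMono (snoc (fun i => τ i.castSucc) (τ (Fin.last n))) := by
      rw [snoc_init]
      intro i j hij
      have := hτ (Fin.castSucc_lt_castSucc_iff.mpr hij)
      simpa using this
    have hI := integrable_snoc_iff.mpr (integrable_weighted_chain hα hp hu hτ y)
    rw [← integral_snoc, Measure.volume_eq_prod, integral_prod _ hI, chainOp, heatOp]
    congr 1; ext w
    rw [← ih _ (fun i => hu _) _ _ hmono w, ← mul_assoc, ← integral_const_mul]
    congr 1; ext ζ
    rw [chainDensity_snoc, Fin.prod_univ_castSucc, snoc_init]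
    simp only [Fin.snoc_castSucc, Fin.snoc_last]
    ring

/-! ### Integration over ordered times -/

/-- Increasing sequences of `k` times in `(0, t)`. -/
def simplex (k : ℕ) (t : ℝ) : Set (Fin k → ℝ) := {s | StrictMono s ∧ ∀ i, s i ∈ Ioo 0 t}

lemma measurableSet_simplex (k : ℕ) (t : ℝ) : MeasurableSet (simplex k t) := by
  have h : simplex k t = (⋂ i, ⋂ j, ⋂ _ : i < j, {s : Fin k → ℝ | s i < s j}) ∩
      ⋂ i, {s : Fin k → ℝ | s i ∈ Ioo 0 t} := by
    ext s; simp [simplex, StrictMono]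
  rw [h]
  refine MeasurableSet.inter (MeasurableSet.iInter fun i => MeasurableSet.iInter fun j =>
    MeasurableSet.iInter fun _ => ?_) (MeasurableSet.iInter fun i => ?_)
  · exact measurableSet_lt (measurable_pi_apply i) (measurable_pi_apply j)
  · exact measurableSet_Ioo.preimage (measurable_pi_apply i)

lemma volume_simplex_le (k : ℕ) {t : ℝ} (ht : 0 ≤ t) :
    volume (simplex k t) ≤ ENNReal.ofReal (t ^ k) := by
  refine (measure_mono (t := Set.pi univ fun _ : Fin k => Ioo (0 : ℝ) t)
    (fun s hs i _ => hs.2 i)).trans ?_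
  rw [volume_pi_pi]
  simp [ENNReal.ofReal_pow ht]

instance isFiniteMeasure_simplex (k : ℕ) (t : ℝ) :
    IsFiniteMeasure (volume.restrict (simplex k t)) := by
  refine ⟨?_⟩
  rw [Measure.restrict_apply_univ]
  refine (measure_mono (t := Set.pi univ fun _ : Fin k => Ioo (0 : ℝ) t)
    (fun s hs i _ => hs.2 i)).trans_lt ?_
  rw [volume_pi_pi]
  simp

lemma strictMono_snoc_iff {n : ℕ} {s : Fin n → ℝ} {r : ℝ} :
    StrictMono (snoc s r) ↔ StrictMono s ∧ ∀ i, s i < r := by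
  constructor
  · intro h
    refine ⟨fun i j hij => ?_, fun i => ?_⟩
    · simpa using h (Fin.castSucc_lt_castSucc_iff.mpr hij)
    · simpa using h (Fin.castSucc_lt_last i)
  · rintro ⟨h1, h2⟩ i j hij
    revert hij
    refine Fin.lastCases ?_ (fun j' => ?_) j
    · refine Fin.lastCases (fun h => absurd h (lt_irrefl _)) (fun i' _ => ?_) i
      simpa using h2 i'
    · refine Fin.lastCases (fun h => absurd h (Fin.castSucc_lt_last j').asymm) (fun i' h => ?_) i
      simpa using h1 (Fin.castSucc_lt_castSucc_iff.mp h)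

lemma snoc_mem_simplex {k : ℕ} {s : Fin k → ℝ} {r t : ℝ} :
    snoc s r ∈ simplex (k + 1) t ↔ r ∈ Ioo 0 t ∧ s ∈ simplex k r := by
  simp only [simplex, mem_ofPred_eq, strictMono_snoc_iff, Fin.forall_fin_succ', Fin.snoc_castSucc,
    Fin.snoc_last, mem_Ioo]
  constructor
  · rintro ⟨⟨h1, h2⟩, h3, h4⟩
    exact ⟨h4, h1, fun i => ⟨(h3 i).1, h2 i⟩⟩
  · rintro ⟨h1, h2, h3⟩
    exact ⟨⟨h2, fun i => (h3 i).2⟩, fun i => ⟨(h3 i).1, (h3 i).2.trans h1.2⟩, h1⟩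

lemma integral_simplex_zero (t : ℝ) (F : (Fin 0 → ℝ) → ℝ) :
    ∫ s in simplex 0 t, F s = F ![] := by
  have : simplex 0 t = univ := by
    ext s; simp [simplex, Subsingleton.strictMono s]
  rw [this, Measure.restrict_univ, integral_fin_zero]

/-- Integration over the simplex, the last time being integrated last. -/
lemma integral_simplex_succ {k : ℕ} {t : ℝ} (ht : 0 ≤ t) {F : (Fin (k + 1) → ℝ) → ℝ}
    (hF : IntegrableOn F (simplex (k + 1) t)) :
    ∫ s in simplex (k + 1) t, F s
      = ∫ r in (0 : ℝ)..t, ∫ s in simplex k r, F (snoc s r) := by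
  have hI := (integrable_indicator_iff (measurableSet_simplex (k + 1) t)).mpr hF
  rw [← integral_indicator (measurableSet_simplex _ _), ← integral_snoc, Measure.volume_eq_prod,
    integral_prod _ (integrable_snoc_iff.mpr hI), intervalIntegral.integral_of_le ht,
    integral_Ioc_eq_integral_Ioo, ← integral_indicator measurableSet_Ioo]
  congr 1; ext r
  by_cases hr : r ∈ Ioo 0 t
  · rw [indicator_of_mem hr, ← integral_indicator (measurableSet_simplex _ _)]
    congr 1; ext s
    by_cases hs : s ∈ simplex k r
    · rw [indicator_of_mem hs, indicator_of_mem (snoc_mem_simplex.mpr ⟨hr, hs⟩)]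
    · rw [indicator_of_notMem hs, indicator_of_notMem fun h => hs (snoc_mem_simplex.mp h).2]
  · rw [indicator_of_notMem hr]
    have : ∀ s, (simplex (k + 1) t).indicator F (snoc s r) = 0 := fun s =>
      indicator_of_notMem (fun h => hr (snoc_mem_simplex.mp h).1) _
    simp [this]

end

section

/-! ### Path integrals along the bridge -/

variable {d : ℕ} {α : ℝ} {Ω : Type*}

/-- The values of `U` along the path during the open time interval `(0, t)`, and zero outside. -/
def observedPath (U : Rd d → ℝ) (t : ℝ) (X : ℝ → Ω → Rd d) (q : ℝ × Ω) : ℝ :=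
  (Ioo 0 t).indicator (fun r => U (X r q.2)) q.1

lemma abs_observedPath_le {U : Rd d → ℝ} {M : ℝ} (hM : ∀ x, |U x| ≤ M) (t : ℝ)
    (X : ℝ → Ω → Rd d) (q : ℝ × Ω) : |observedPath U t X q| ≤ M := by
  unfold observedPath
  by_cases h : q.1 ∈ Ioo 0 t
  · rw [indicator_of_mem h]; exact hM _
  · rw [indicator_of_notMem h, abs_zero]; exact (abs_nonneg _).trans (hM 0)

/-- The integral of a potential along the path. -/
def pathIntegral (U : Rd d → ℝ) (X : ℝ → Ω → Rd d) (t : ℝ) (ω : Ω) : ℝ :=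
  ∫ s in (0 : ℝ)..t, U (X s ω)

lemma pathIntegral_eq (U : Rd d → ℝ) (X : ℝ → Ω → Rd d) {t : ℝ} (ht : 0 ≤ t) (ω : Ω) :
    pathIntegral U X t ω = ∫ s in (0 : ℝ)..t, observedPath U t X (s, ω) := by
  refine intervalIntegral.integral_congr_Ioo_of_le ht fun s hs => ?_
  simp only [observedPath, indicator_of_mem hs]

lemma abs_pathIntegral_le {U : Rd d → ℝ} {M : ℝ} (hM : ∀ x, |U x| ≤ M) (X : ℝ → Ω → Rd d) {t : ℝ}
    (ht : 0 ≤ t) (ω : Ω) : |pathIntegral U X t ω| ≤ M * t := by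
  have := intervalIntegral.norm_integral_le_of_norm_le_const (a := 0) (b := t)
    (f := fun s => U (X s ω)) (C := M) fun s _ => hM _
  rwa [sub_zero, abs_of_nonneg ht] at this

variable [MeasurableSpace Ω]

lemma bridgeDensity_eq (t : ℝ) (x y : Rd d) {k : ℕ} (s : Fin k → ℝ) (z : Fin k → Rd d) :
    bridgeDensity α t x y s z
      = chainDensity α (snoc (cons 0 s) t) (snoc (cons x z) y) / stableDensity α t (y - x) := by
  rw [snoc, snoc, cons, cons, ← Fin.cons_snoc_eq_snoc_cons, ← Fin.cons_snoc_eq_snoc_cons]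
  rfl

/-- The stable densities are positive as soon as all bridges exist: the one-point bridge law would
vanish at a zero of the density, because division by zero gives zero. -/
lemma positiveDensities_of_bridges (hα : 0 < α) {X : ℝ → Ω → Rd d}
    {P : ℝ → Rd d → Rd d → Measure Ω}
    (hX : ∀ t : ℝ, 0 < t → ∀ x y : Rd d, IsStableBridge α t x y (P t x y) X) :
    PositiveDensities d α := by
  intro t ht
  refine stableDensity_pos_of_ne_zero hα ht fun x hx => ?_
  have h := hX t ht 0 x
  have := h.isProbabilityMeasure
  have hl := h.law 0 ![] (Subsingleton.strictMono _) (fun i => i.elim0)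
  have h0 : ∀ z : Fin 0 → Rd d, bridgeDensity α t 0 x ![] z = 0 := fun z => by
    rw [bridgeDensity_eq, sub_zero, hx, div_zero]
  simp only [h0, ENNReal.ofReal_zero] at hl
  have h1 := congrArg (fun μ => μ univ) hl
  simp only [withDensity_const, zero_smul, Measure.coe_zero, Pi.zero_apply] at h1
  rw [Measure.map_apply (measurable_pi_lambda _ fun i => i.elim0) MeasurableSet.univ,
    preimage_univ, measure_univ] at h1
  exact one_ne_zero h1

/-- Right-continuity makes the observed path jointly measurable: sample the path at the next point
of a finer and finer grid of times. -/
lemma measurable_observedPath {U : Rd d → ℝ} (hU : Continuous U) {t : ℝ} {x y : Rd d}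
    {P : Measure Ω} {X : ℝ → Ω → Rd d} (h : IsStableBridge α t x y P X) (ht : 0 < t) :
    Measurable (observedPath U t X) := by
  set τ : ℕ → ℕ → ℝ := fun n k => min t (((k : ℝ) + 1) / ((n : ℝ) + 1)) with hτ
  have hτm : ∀ n k, τ n k ∈ Icc 0 t := fun n k =>
    ⟨le_min ht.le (by positivity), min_le_left _ _⟩
  set g : ℕ → ℝ × Ω → ℝ := fun n q =>
    (Ioo 0 t).indicator (fun r => U (X (τ n ⌊r * ((n : ℝ) + 1)⌋₊) q.2)) q.1 with hg
  refine measurable_of_tendsto_metrizable (f := g) (fun n => ?_) ?_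
  · have h1 : Measurable (fun q : ℕ × Ω => U (X (τ n q.1) q.2)) :=
      measurable_from_prod_countable_right fun k =>
        hU.measurable.comp (h.measurable _ (hτm n k))
    have h2 : Measurable (fun q : ℝ × Ω => U (X (τ n ⌊q.1 * ((n : ℝ) + 1)⌋₊) q.2)) :=
      h1.comp (f := fun q : ℝ × Ω => (⌊q.1 * ((n : ℝ) + 1)⌋₊, q.2))
        ((Nat.measurable_floor.comp (measurable_fst.mul_const _)).prodMk measurable_snd)
    exact h2.indicator (measurable_fst measurableSet_Ioo)
  · refine tendsto_pi_nhds.mpr fun q => ?_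
    by_cases hq : q.1 ∈ Ioo 0 t
    · simp only [hg, observedPath, indicator_of_mem hq]
      refine (hU.tendsto _).comp ?_
      refine (h.rightCont q.2 q.1 ⟨hq.1.le, hq.2⟩).tendsto.comp ?_
      have hlow : ∀ n : ℕ, q.1 ≤ τ n ⌊q.1 * ((n : ℝ) + 1)⌋₊ := fun n => by
        refine le_min hq.2.le ?_
        rw [le_div_iff₀ (by positivity)]
        exact (Nat.lt_floor_add_one _).le
      refine tendsto_nhdsWithin_iff.mpr ⟨?_, Eventually.of_forall hlow⟩
      have hup : ∀ n : ℕ, τ n ⌊q.1 * ((n : ℝ) + 1)⌋₊ ≤ q.1 + 1 / ((n : ℝ) + 1) := fun n => by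
        refine (min_le_right _ _).trans ?_
        rw [add_div]
        refine add_le_add ?_ le_rfl
        rw [div_le_iff₀ (by positivity)]
        exact Nat.floor_le (mul_nonneg hq.1.le (by positivity))
      have hlim : Tendsto (fun n : ℕ => q.1 + 1 / ((n : ℝ) + 1)) atTop (𝓝 q.1) := by
        simpa using tendsto_one_div_add_atTop_nhds_zero_nat.const_add q.1
      exact tendsto_of_tendsto_of_tendsto_of_le_of_le tendsto_const_nhds hlim hlow hup
    · simp only [hg, observedPath, indicator_of_notMem hq]
      exact tendsto_const_nhds

lemma integrableOn_simplex_prod {φ : ℝ → ℝ} (hm : Measurable φ) {M : ℝ} (hM : ∀ s, |φ s| ≤ M)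
    (k : ℕ) (t : ℝ) : IntegrableOn (fun s : Fin k → ℝ => ∏ i, φ (s i)) (simplex k t) := by
  refine Integrable.of_bound (C := M ^ k) (Finset.measurable_prod _ fun i _ =>
    hm.comp (measurable_pi_apply i)).aestronglyMeasurable (Eventually.of_forall fun s => ?_)
  rw [Real.norm_eq_abs, Finset.abs_prod]
  refine (Finset.prod_le_prod (fun i _ => abs_nonneg _) fun i _ => hM _).trans ?_
  simp

/-- The integral of a product over ordered times is a divided power of the integral. -/
lemma integral_simplex_prod {φ : ℝ → ℝ} (hm : Measurable φ) {M : ℝ} (hM : ∀ s, |φ s| ≤ M)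
    {t : ℝ} (hφ : ∀ s ∈ Ioo 0 t, ContinuousWithinAt φ (Ici s) s) (k : ℕ) :
    ∀ r ∈ Icc 0 t, ∫ s in simplex k r, ∏ i, φ (s i)
      = (∫ s in (0 : ℝ)..r, φ s) ^ k / (k.factorial : ℝ) := by
  have hi : ∀ a b, IntervalIntegrable φ volume a b := fun a b =>
    (intervalIntegrable_const (c := M)).mono_fun hm.aestronglyMeasurable
      (Eventually.of_forall fun s => (hM s).trans (le_abs_self M))
  have hc : Continuous (fun r : ℝ => ∫ s in (0 : ℝ)..r, φ s) :=
    intervalIntegral.continuous_primitive hi 0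
  induction k with
  | zero => intro r _; rw [integral_simplex_zero]; simp
  | succ k ih =>
    intro r hr
    rw [integral_simplex_succ hr.1 (integrableOn_simplex_prod hm hM _ _)]
    have h1 : ∫ ρ in (0 : ℝ)..r, ∫ s in simplex k ρ, ∏ i, φ (snoc s ρ i)
        = ∫ ρ in (0 : ℝ)..r, (∫ s in (0 : ℝ)..ρ, φ s) ^ k / (k.factorial : ℝ) * φ ρ := by
      refine intervalIntegral.integral_congr fun ρ hρ => ?_
      rw [uIcc_of_le hr.1] at hρ
      simp only [Fin.prod_univ_castSucc, Fin.snoc_castSucc, Fin.snoc_last]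
      rw [integral_mul_const, ih ρ ⟨hρ.1, hρ.2.trans hr.2⟩]
    have hcp : Continuous (fun ρ : ℝ => (∫ s in (0 : ℝ)..ρ, φ s) ^ k / (k.factorial : ℝ)) :=
      (hc.pow k).div_const _
    rw [h1, intervalIntegral.integral_eq_sub_of_hasDeriv_right_of_le
      (f := fun ρ => (∫ s in (0 : ℝ)..ρ, φ s) ^ (k + 1) / ((k + 1).factorial : ℝ)) hr.1
      ((hc.pow _).div_const _).continuousOn (fun ρ hρ => ?_)
      ((hi 0 r).continuousOn_mul hcp.continuousOn)]
    · simp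
    · have hd : HasDerivWithinAt (fun ρ => ∫ s in (0 : ℝ)..ρ, φ s) (φ ρ) (Ioi ρ) ρ :=
        (intervalIntegral.integral_hasDerivWithinAt_right (s := Ici ρ) (t := Ioi ρ) (hi 0 ρ)
          (hm.stronglyMeasurable.stronglyMeasurableAtFilter)
          ((hφ ρ ⟨hρ.1, hρ.2.trans_le hr.2⟩).mono Ioi_subset_Ici_self)).mono Ioi_subset_Ici_self
      refine ((hd.pow (k + 1)).div_const _).congr_deriv ?_
      rw [Nat.factorial_succ]
      push_cast
      have : (k.factorial : ℝ) ≠ 0 := by positivity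
      have : (k : ℝ) + 1 ≠ 0 := by positivity
      field_simp

lemma integral_simplex_const (k : ℕ) {t : ℝ} (ht : 0 ≤ t) (c : ℝ) :
    ∫ _ in simplex k t, c = c * (t ^ k / (k.factorial : ℝ)) := by
  have h := integral_simplex_prod (φ := fun _ => 1) measurable_const (M := 1) (by simp) (t := t)
    (fun _ _ => continuousWithinAt_const) k t ⟨ht, le_rfl⟩
  have h2 : ∫ _ in simplex k t, c
      = c * ∫ s in simplex k t, ∏ i : Fin k, (fun _ => (1 : ℝ)) (s i) := by
    rw [← integral_const_mul]; simp
  rw [h2, h]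
  simp

lemma measurable_pathIntegral {U : Rd d → ℝ} (hU : Continuous U) {t : ℝ} {x y : Rd d}
    {P : Measure Ω} {X : ℝ → Ω → Rd d} (h : IsStableBridge α t x y P X) (ht : 0 < t) :
    Measurable (pathIntegral U X t) := by
  have h1 : pathIntegral U X t = fun ω => ∫ s in Ioc 0 t, observedPath U t X (s, ω) := by
    ext ω; rw [pathIntegral_eq U X ht.le, intervalIntegral.integral_of_le ht.le]
  rw [h1]
  exact ((measurable_observedPath hU h ht).comp measurable_swap).stronglyMeasurable
    |>.integral_prod_right'.measurable

lemma integrable_pathIntegral_pow {U : Rd d → ℝ} (hU : Continuous U) {M : ℝ}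
    (hM : ∀ x, |U x| ≤ M) {t : ℝ} {x y : Rd d} {P : Measure Ω} {X : ℝ → Ω → Rd d}
    (h : IsStableBridge α t x y P X) (ht : 0 < t) (k : ℕ) :
    Integrable (fun ω => pathIntegral U X t ω ^ k) P := by
  have := h.isProbabilityMeasure
  refine Integrable.of_bound (C := (M * t) ^ k)
    ((measurable_pathIntegral hU h ht).pow_const k).aestronglyMeasurable
    (Eventually.of_forall fun ω => ?_)
  rw [norm_pow]
  exact pow_le_pow_left₀ (norm_nonneg _) (abs_pathIntegral_le hM X ht.le ω) k

/-- The moments of the path integral, in terms of the finite-dimensional distributions. -/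
lemma integral_pathIntegral_pow {U : Rd d → ℝ} (hU : Continuous U) {M : ℝ}
    (hM : ∀ x, |U x| ≤ M) {t : ℝ} {x y : Rd d} {P : Measure Ω} {X : ℝ → Ω → Rd d}
    (h : IsStableBridge α t x y P X) (ht : 0 < t) (k : ℕ) :
    ∫ ω, pathIntegral U X t ω ^ k / (k.factorial : ℝ) ∂P
      = ∫ s in simplex k t, ∫ ω, ∏ i, U (X (s i) ω) ∂P := by
  have := h.isProbabilityMeasure
  have hm := measurable_observedPath hU h ht
  have h1 : ∀ ω, pathIntegral U X t ω ^ k / (k.factorial : ℝ)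
      = ∫ s in simplex k t, ∏ i, observedPath U t X (s i, ω) := by
    intro ω
    rw [pathIntegral_eq U X ht.le]
    refine (integral_simplex_prod (φ := fun s => observedPath U t X (s, ω)) (t := t)
      (hm.comp measurable_prodMk_right) (fun s => abs_observedPath_le hM t X _)
      (fun s hs => ?_) k t ⟨ht.le, le_rfl⟩).symm
    have h2 : ContinuousWithinAt (fun r => U (X r ω)) (Ici s) s :=
      hU.continuousAt.comp_continuousWithinAt (h.rightCont ω s ⟨hs.1.le, hs.2⟩)
    refine h2.congr_of_eventuallyEq ?_ ?_
    · filter_upwards [mem_nhdsWithin_of_mem_nhds (isOpen_Ioo.mem_nhds hs)] with r hr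
      simp only [observedPath, indicator_of_mem hr]
    · simp only [observedPath, indicator_of_mem hs]
  simp_rw [h1]
  rw [integral_integral_swap]
  · refine setIntegral_congr_fun (measurableSet_simplex k t) fun s hs => ?_
    refine integral_congr_ae (Eventually.of_forall fun ω => Finset.prod_congr rfl fun i _ => ?_)
    simp only [observedPath, indicator_of_mem (hs.2 i)]
  · refine Integrable.of_bound (C := M ^ k) (Measurable.aestronglyMeasurable ?_)
      (Eventually.of_forall fun q => ?_)
    · refine Finset.measurable_prod _ fun i _ => ?_
      exact hm.comp (f := fun q : Ω × (Fin k → ℝ) => (q.2 i, q.1))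
        (((measurable_pi_apply i).comp measurable_snd).prodMk measurable_fst)
    · rw [Function.uncurry, Real.norm_eq_abs, Finset.abs_prod]
      refine (Finset.prod_le_prod (fun i _ => abs_nonneg _)
        fun i _ => abs_observedPath_le hM t X _).trans ?_
      simp

/-- The integral of a product of weights against the chain of densities from `z.1` to `z.2` that
passes through intermediate points at the times `s`. -/
def pinnedChain (α : ℝ) (U : Rd d → ℝ) (t : ℝ) {k : ℕ} (s : Fin k → ℝ) (z : Rd d × Rd d) : ℝ :=
  ∫ ζ : Fin k → Rd d, (∏ i, U (ζ i)) *
    chainDensity α (snoc (cons 0 s) t) (snoc (cons z.1 ζ) z.2)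

lemma measurable_pinnedIntegrand (hα : 0 < α) {U : Rd d → ℝ} (hU : Measurable U) (t : ℝ) (k : ℕ) :
    Measurable (fun q : ((Fin k → ℝ) × (Rd d × Rd d)) × (Fin k → Rd d) =>
      (∏ i, U (q.2 i)) *
        chainDensity α (snoc (cons 0 q.1.1) t) (snoc (cons q.1.2.1 q.2) q.1.2.2)) := by
  refine Measurable.mul ?_ ?_
  · exact Finset.measurable_prod _ fun i _ =>
      hU.comp ((measurable_pi_apply i).comp measurable_snd)
  · have hs : Measurable (fun q : ((Fin k → ℝ) × (Rd d × Rd d)) × (Fin k → Rd d) =>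
        snoc (cons 0 q.1.1) t) :=
      (measurable_snoc (k + 1)).comp
        (f := fun q : ((Fin k → ℝ) × (Rd d × Rd d)) × (Fin k → Rd d) => (cons 0 q.1.1, t))
        (((measurable_cons k).comp
          (f := fun q : ((Fin k → ℝ) × (Rd d × Rd d)) × (Fin k → Rd d) => ((0 : ℝ), q.1.1))
          (measurable_const.prodMk (measurable_fst.comp measurable_fst))).prodMk measurable_const)
    have hz : Measurable (fun q : ((Fin k → ℝ) × (Rd d × Rd d)) × (Fin k → Rd d) =>
        snoc (cons q.1.2.1 q.2) q.1.2.2) :=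
      (measurable_snoc (k + 1)).comp
        (f := fun q : ((Fin k → ℝ) × (Rd d × Rd d)) × (Fin k → Rd d) =>
          (cons q.1.2.1 q.2, q.1.2.2))
        (((measurable_cons k).comp
          (f := fun q : ((Fin k → ℝ) × (Rd d × Rd d)) × (Fin k → Rd d) => (q.1.2.1, q.2))
          ((measurable_fst.comp (measurable_snd.comp measurable_fst)).prodMk
            measurable_snd)).prodMk (measurable_snd.comp (measurable_snd.comp measurable_fst)))
    exact (measurable_chainDensity hα (k + 1)).comp
      (f := fun q : ((Fin k → ℝ) × (Rd d × Rd d)) × (Fin k → Rd d) =>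
        (snoc (cons 0 q.1.1) t, snoc (cons q.1.2.1 q.2) q.1.2.2)) (hs.prodMk hz)

lemma stronglyMeasurable_pinnedChain (hα : 0 < α) {U : Rd d → ℝ} (hU : Measurable U) (t : ℝ)
    (k : ℕ) : StronglyMeasurable
      (fun q : (Fin k → ℝ) × (Rd d × Rd d) => pinnedChain α U t q.1 q.2) :=
  (measurable_pinnedIntegrand hα hU t k).stronglyMeasurable.integral_prod_right'

lemma strictMono_snoc_cons {k : ℕ} {s : Fin k → ℝ} {t : ℝ} (ht : 0 < t) (hs : s ∈ simplex k t) :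
    StrictMono (snoc (cons 0 s) t) := by
  refine strictMono_snoc_iff.mpr ⟨fun i j hij => ?_, fun i => ?_⟩
  · revert hij
    refine Fin.cases (fun h => absurd h (Fin.not_lt_zero _)) (fun j' => ?_) j
    refine Fin.cases (fun _ => ?_) (fun i' h => ?_) i
    · simpa using (hs.2 j').1
    · simpa using hs.1 (Fin.succ_lt_succ_iff.mp h)
  · refine Fin.cases ?_ (fun i' => ?_) i
    · simpa using ht
    · simpa using (hs.2 i').2

/-- The finite-dimensional distributions of the bridge, with the normalisation cleared. -/
lemma stableDensity_mul_integral_prod (hα : 0 < α) (hp : PositiveDensities d α) {U : Rd d → ℝ}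
    (hU : Continuous U) {t : ℝ} {x y : Rd d} {P : Measure Ω} {X : ℝ → Ω → Rd d}
    (h : IsStableBridge α t x y P X) (ht : 0 < t) {k : ℕ} {s : Fin k → ℝ}
    (hs : s ∈ simplex k t) :
    stableDensity α t (x - y) * ∫ ω, ∏ i, U (X (s i) ω) ∂P = pinnedChain α U t s (x, y) := by
  have hmX : Measurable (fun ω i => X (s i) ω) :=
    measurable_pi_lambda _ fun i => h.measurable _ (Ioo_subset_Icc_self (hs.2 i))
  have hmU : Measurable (fun ζ : Fin k → Rd d => ∏ i, U (ζ i)) :=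
    Finset.measurable_prod _ fun i _ => hU.measurable.comp (measurable_pi_apply i)
  have hmc : Measurable (fun ζ : Fin k → Rd d =>
      chainDensity α (snoc (cons 0 s) t) (snoc (cons x ζ) y)) := by
    have := (measurable_pinnedIntegrand hα (U := fun _ : Rd d => 1) measurable_const t k).comp
      (f := fun ζ : Fin k → Rd d => ((s, (x, y)), ζ)) measurable_prodMk_left
    simpa [Function.comp_def] using this
  have hpos := hp t ht (y - x)
  have hb : ∀ ζ, 0 ≤ bridgeDensity α t x y s ζ := fun ζ => by
    rw [bridgeDensity_eq]
    exact div_nonneg (chainDensity_nonneg hp (strictMono_snoc_cons ht hs) _) hpos.le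
  have hmb : Measurable (fun ζ => bridgeDensity α t x y s ζ) := by
    simp only [bridgeDensity_eq]; exact hmc.div_const _
  have h1 : ∫ ω, ∏ i, U (X (s i) ω) ∂P = ∫ ζ, ∏ i, U (ζ i) ∂(P.map fun ω i => X (s i) ω) :=
    (integral_map hmX.aemeasurable hmU.aestronglyMeasurable).symm
  rw [h1, h.law k s hs.1 hs.2, integral_withDensity_eq_integral_toReal_smul
    hmb.ennreal_ofReal (Eventually.of_forall fun _ => ENNReal.ofReal_lt_top),
    ← integral_const_mul, pinnedChain, stableDensity_sub_comm]
  refine integral_congr_ae (Eventually.of_forall fun ζ => ?_)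
  simp only [ENNReal.toReal_ofReal (hb ζ), smul_eq_mul]
  rw [bridgeDensity_eq]
  field_simp

/-! ### Integrals of the moments over all end points -/

lemma boundedMeasurable_cons_one {U : Rd d → ℝ} (hU : BoundedMeasurable U) (k : ℕ)
    (i : Fin (k + 1)) : BoundedMeasurable (cons (fun _ : Rd d => (1 : ℝ)) (fun _ : Fin k => U) i) :=
  Fin.cases (by simpa using BoundedMeasurable.const 1) (fun j => by simpa using hU) i

/-- The weights along a chain whose starting point carries no weight. -/
abbrev freeStart (U : Rd d → ℝ) (k : ℕ) : Fin (k + 1) → Rd d → ℝ :=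
  cons (fun _ : Rd d => (1 : ℝ)) (fun _ : Fin k => U)

lemma integrable_pinnedIntegrand (hα : 0 < α) (hp : PositiveDensities d α) {U : Rd d → ℝ}
    (hU : BoundedMeasurable U) {t : ℝ} (ht : 0 < t) {k : ℕ} {s : Fin k → ℝ}
    (hs : s ∈ simplex k t) (y : Rd d) :
    Integrable (fun q : Rd d × (Fin k → Rd d) => (∏ i, U (q.2 i)) *
      chainDensity α (snoc (cons 0 s) t) (snoc (cons q.1 q.2) y)) := by
  refine (integrable_cons_iff.mpr (integrable_weighted_chain hα hp
    (boundedMeasurable_cons_one hU k) (strictMono_snoc_cons ht hs) y)).congr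
    (Eventually.of_forall fun q => ?_)
  simp only [Fin.prod_univ_succ, Fin.cons_zero, Fin.cons_succ, one_mul]

/-- Integrating a chain over its free starting point leaves the semigroup. -/
lemma integral_pinnedChain_left (hα : 0 < α) (hp : PositiveDensities d α) {U : Rd d → ℝ}
    (hU : BoundedMeasurable U) {t : ℝ} (ht : 0 < t) {k : ℕ} {s : Fin k → ℝ}
    (hs : s ∈ simplex k t) (y : Rd d) :
    ∫ x, pinnedChain α U t s (x, y) = chainOp α (k + 1) (cons 0 s) (freeStart U k) t y := by
  unfold pinnedChain
  rw [integral_integral (f := fun (x : Rd d) (ζ : Fin k → Rd d) => (∏ i, U (ζ i)) *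
      chainDensity α (snoc (cons 0 s) t) (snoc (cons x ζ) y))
    (integrable_pinnedIntegrand hα hp hU ht hs y), ← integral_weighted_chain hα hp (k + 1) _
    (boundedMeasurable_cons_one hU k) _ _ (strictMono_snoc_cons ht hs) y, ← integral_cons,
    Measure.volume_eq_prod]
  refine integral_congr_ae (Eventually.of_forall fun q => ?_)
  simp only [Fin.prod_univ_succ, Fin.cons_zero, Fin.cons_succ, one_mul]

lemma abs_pinnedChain_le (hp : PositiveDensities d α) (U : Rd d → ℝ) {t : ℝ} (ht : 0 < t)
    {k : ℕ} {s : Fin k → ℝ} (hs : s ∈ simplex k t) (z : Rd d × Rd d) :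
    |pinnedChain α U t s z| ≤ pinnedChain α (fun x => |U x|) t s z := by
  refine abs_integral_le_integral_abs.trans (le_of_eq ?_)
  refine integral_congr_ae (Eventually.of_forall fun ζ => ?_)
  simp only [abs_mul, Finset.abs_prod,
    abs_of_nonneg (chainDensity_nonneg hp (strictMono_snoc_cons ht hs) _)]

/-- The function `P_{s_k - s_{k-1}} U ⋯ U P_{s_1 - s_0} U P_{s_0} 1`. -/
abbrev startedChain (α : ℝ) (U : Rd d → ℝ) {k : ℕ} (s : Fin (k + 1) → ℝ) : Rd d → ℝ :=
  chainOp α (k + 1) (fun i => (cons 0 s : Fin (k + 2) → ℝ) i.castSucc)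
    (fun i => freeStart U (k + 1) i.castSucc) (s (Fin.last k))

/-- The correlation integral `∫ U P_{s_k - s_{k-1}} U ⋯ P_{s_1 - s_0} U` of the stable semigroup
started from Lebesgue measure. -/
def correlation (α : ℝ) (U : Rd d → ℝ) {k : ℕ} (s : Fin (k + 1) → ℝ) : ℝ :=
  ∫ w, U w * startedChain α U s w

lemma abs_chainOp_le (hα : 0 < α) (hp : PositiveDensities d α) (n : ℕ) :
    ∀ (u : Fin n → Rd d → ℝ) (B : Fin n → ℝ), (∀ i, Measurable (u i)) →
      (∀ i x, |u i x| ≤ B i) → ∀ (τ : Fin n → ℝ) (t : ℝ), StrictMono (snoc τ t) →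
      ∀ x, |chainOp α n τ u t x| ≤ ∏ i, B i := by
  induction n with
  | zero => intro u B _ _ τ t _ x; simp [chainOp]
  | succ n ih =>
    intro u B hu hB τ t hτ x
    have hmono : StrictMono (snoc (fun i => τ i.castSucc) (τ (Fin.last n))) := by
      rw [snoc_init]
      exact (strictMono_snoc_iff.mp hτ).1
    refine abs_heatOp_le hα hp (sub_pos.mpr ((strictMono_snoc_iff.mp hτ).2 _)) (fun y => ?_) x
    rw [abs_mul, Fin.prod_univ_castSucc, mul_comm]
    exact mul_le_mul (ih _ _ (fun i => hu _) (fun i => hB _) _ _ hmono y) (hB _ y) (abs_nonneg _)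
      (Finset.prod_nonneg fun i _ => (abs_nonneg _).trans (hB _ 0))

lemma cons_last {E : Type*} {k : ℕ} (w : E) (s : Fin (k + 1) → E) :
    cons w s (Fin.last (k + 1)) = s (Fin.last k) := by
  rw [← Fin.succ_last]
  exact Fin.cons_succ _ _ _

lemma strictMono_snoc_cons_init {k : ℕ} {s : Fin (k + 1) → ℝ} {t : ℝ} (ht : 0 < t)
    (hs : s ∈ simplex (k + 1) t) :
    StrictMono (snoc (fun i => (cons 0 s : Fin (k + 2) → ℝ) i.castSucc) (s (Fin.last k))) := by
  have h := (strictMono_snoc_iff.mp (strictMono_snoc_cons ht hs)).1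
  rwa [← snoc_init (cons 0 s), cons_last] at h

/-- A bound for the correlations that is uniform in the times. -/
lemma exists_correlation_bound (hα : 0 < α) (hp : PositiveDensities d α) {U : Rd d → ℝ}
    (hU : BoundedMeasurable U) (hi : Integrable U) (k : ℕ) :
    ∃ C, ∀ t, 0 < t → ∀ s ∈ simplex (k + 1) t, |correlation α U s| ≤ C := by
  choose B hB using fun i => (boundedMeasurable_cons_one hU (k + 1) i).bounded
  refine ⟨∫ w, |U w| * ∏ i : Fin (k + 1), B i.castSucc, fun t ht s hs => ?_⟩
  rw [correlation, ← Real.norm_eq_abs]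
  refine norm_integral_le_of_norm_le (hi.norm.mul_const _) (Eventually.of_forall fun w => ?_)
  rw [norm_mul]
  exact mul_le_mul_of_nonneg_left (abs_chainOp_le hα hp _ _ (fun i => B i.castSucc)
    (fun _ => (boundedMeasurable_cons_one hU (k + 1) _).measurable) (fun i => hB _) _ _
    (strictMono_snoc_cons_init ht hs) w) (norm_nonneg _)

lemma integrable_heatOp (hα : 0 < α) (hp : PositiveDensities d α) {t : ℝ} (ht : 0 < t)
    {g : Rd d → ℝ} (hg : Integrable g) : Integrable (heatOp α t g) := by
  refine (integrable_mul_stableDensity_prod hα hp ht hg).integral_prod_right.congr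
    (Eventually.of_forall fun x => ?_)
  refine integral_congr_ae (Eventually.of_forall fun y => ?_)
  simp only [stableDensity_sub_comm t y x, mul_comm]

lemma integral_heatOp (hα : 0 < α) (hp : PositiveDensities d α) {t : ℝ} (ht : 0 < t)
    {g : Rd d → ℝ} (hg : Integrable g) : ∫ x, heatOp α t g x = ∫ x, g x := by
  have h := integral_heatOp_mul hα hp ht (f := fun _ => 1) measurable_const hg (M := 1) (by simp)
  rw [heatOp_const hα hp ht] at h
  simpa using h.symm

lemma chainOp_freeStart {k : ℕ} (U : Rd d → ℝ) (s : Fin (k + 1) → ℝ) (t : ℝ) :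
    chainOp α (k + 2) (cons 0 s) (freeStart U (k + 1)) t
      = heatOp α (t - s (Fin.last k)) (fun w => U w * startedChain α U s w) := by
  rw [chainOp, cons_last, freeStart, cons_last]

lemma integrable_correlation_integrand (hα : 0 < α) (hp : PositiveDensities d α) {U : Rd d → ℝ}
    (hU : BoundedMeasurable U) (hi : Integrable U) {t : ℝ} (ht : 0 < t) {k : ℕ}
    {s : Fin (k + 1) → ℝ} (hs : s ∈ simplex (k + 1) t) :
    Integrable (fun w => U w * startedChain α U s w) :=
  (boundedMeasurable_chainOp hα hp _ _ (fun _ => boundedMeasurable_cons_one hU (k + 1) _) _ _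
    (strictMono_snoc_cons_init ht hs)).integrable_mul hi

lemma BoundedMeasurable.abs {U : Rd d → ℝ} (hU : BoundedMeasurable U) :
    BoundedMeasurable (fun x => |U x|) :=
  ⟨hU.measurable.abs, hU.bounded.imp fun _ h x => by rw [abs_abs]; exact h x⟩

lemma integrable_pinnedChain (hα : 0 < α) (hp : PositiveDensities d α) {U : Rd d → ℝ}
    (hU : BoundedMeasurable U) (hi : Integrable U) {t : ℝ} (ht : 0 < t) {k : ℕ}
    {s : Fin (k + 1) → ℝ} (hs : s ∈ simplex (k + 1) t) :
    Integrable (pinnedChain α U t s) (volume.prod volume) := by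
  have hm : ∀ {U : Rd d → ℝ}, BoundedMeasurable U →
      StronglyMeasurable (pinnedChain α U t s) := fun hU =>
    (stronglyMeasurable_pinnedChain hα hU.measurable t (k + 1)).comp_measurable
      (g := fun z : Rd d × Rd d => (s, z)) measurable_prodMk_left
  have hx : ∀ {U : Rd d → ℝ}, BoundedMeasurable U → ∀ y,
      Integrable (fun x => pinnedChain α U t s (x, y)) := fun hU y =>
    (integrable_pinnedIntegrand hα hp hU ht hs y).integral_prod_left
  refine (integrable_prod_iff' (hm hU).aestronglyMeasurable).mpr
    ⟨Eventually.of_forall (hx hU), ?_⟩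
  have hd := integrable_heatOp hα hp (sub_pos.mpr (hs.2 (Fin.last k)).2)
    (integrable_correlation_integrand hα hp hU.abs hi.norm ht hs)
  rw [← chainOp_freeStart] at hd
  refine hd.mono' ((hm hU).norm.aestronglyMeasurable.prod_swap.integral_prod_right')
    (Eventually.of_forall fun y => ?_)
  rw [Real.norm_of_nonneg (integral_nonneg fun _ => norm_nonneg _),
    ← integral_pinnedChain_left hα hp hU.abs ht hs y]
  exact integral_mono (hx hU y).norm (hx hU.abs y) fun x => abs_pinnedChain_le hp U ht hs _

/-- Integrating a chain over both end points leaves the correlation integral: the semigroup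
preserves Lebesgue measure, so the last transition drops out. -/
lemma integral_pinnedChain (hα : 0 < α) (hp : PositiveDensities d α) {U : Rd d → ℝ}
    (hU : BoundedMeasurable U) (hi : Integrable U) {t : ℝ} (ht : 0 < t) {k : ℕ}
    {s : Fin (k + 1) → ℝ} (hs : s ∈ simplex (k + 1) t) :
    ∫ z, pinnedChain α U t s z = correlation α U s := by
  rw [Measure.volume_eq_prod, integral_prod_symm _ (integrable_pinnedChain hα hp hU hi ht hs)]
  simp_rw [integral_pinnedChain_left hα hp hU ht hs, chainOp_freeStart]
  exact integral_heatOp hα hp (sub_pos.mpr (hs.2 (Fin.last k)).2)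
    (integrable_correlation_integrand hα hp hU hi ht hs)

lemma integrable_pinnedChain_prod (hα : 0 < α) (hp : PositiveDensities d α) {U : Rd d → ℝ}
    (hU : BoundedMeasurable U) (hi : Integrable U) {t : ℝ} (ht : 0 < t) (k : ℕ) :
    Integrable (fun q : (Fin (k + 1) → ℝ) × (Rd d × Rd d) => pinnedChain α U t q.1 q.2)
      ((volume.restrict (simplex (k + 1) t)).prod volume) := by
  have hm := (stronglyMeasurable_pinnedChain hα hU.measurable t (k + 1)).aestronglyMeasurable
    (μ := (volume.restrict (simplex (k + 1) t)).prod volume)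
  have hmem := ae_restrict_mem (μ := volume) (measurableSet_simplex (k + 1) t)
  refine (integrable_prod_iff hm).mpr ⟨?_, ?_⟩
  · filter_upwards [hmem] with s hs
    exact integrable_pinnedChain hα hp hU hi ht hs
  · obtain ⟨C, hC⟩ := exists_correlation_bound hα hp hU.abs hi.norm k
    refine Integrable.of_bound (C := C) hm.norm.integral_prod_right' ?_
    filter_upwards [hmem] with s hs
    rw [Real.norm_of_nonneg (integral_nonneg fun _ => norm_nonneg _)]
    refine le_trans ?_ ((le_abs_self _).trans (hC t ht s hs))
    rw [← integral_pinnedChain hα hp hU.abs hi.norm ht hs]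
    exact integral_mono (integrable_pinnedChain hα hp hU hi ht hs).norm
      (integrable_pinnedChain hα hp hU.abs hi.norm ht hs) fun z => abs_pinnedChain_le hp U ht hs z

/-- The divided moments of the path integral, weighted by the transition density. -/
def bridgeMoment (α : ℝ) (U : Rd d → ℝ) (P : ℝ → Rd d → Rd d → Measure Ω) (X : ℝ → Ω → Rd d)
    (t : ℝ) (k : ℕ) (z : Rd d × Rd d) : ℝ :=
  stableDensity α t (z.1 - z.2) *
    ∫ ω, pathIntegral U X t ω ^ k / (k.factorial : ℝ) ∂(P t z.1 z.2)


end

section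

/-! ### The Taylor expansion of the Feynman-Kac kernel -/

variable {d : ℕ} {α : ℝ} {Ω : Type*} [MeasurableSpace Ω]

lemma startedChain_zero (hα : 0 < α) (hp : PositiveDensities d α) (U : Rd d → ℝ)
    {s : Fin 1 → ℝ} (hs : 0 < s 0) : startedChain α U s = fun _ => 1 := by
  have h : startedChain α U s = heatOp α (s 0 - 0) (fun _ => 1 * 1) := rfl
  rw [h, sub_zero, one_mul, heatOp_const hα hp hs]

lemma startedChain_succ (U : Rd d → ℝ) {k : ℕ} (s : Fin (k + 2) → ℝ) :
    startedChain α U s = heatOp α (s (Fin.last (k + 1)) - s (Fin.last k).castSucc)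
      (fun w => U w * startedChain α U (fun i => s i.castSucc) w) := by
  have hc : ∀ i : Fin (k + 2), (cons 0 s : Fin (k + 3) → ℝ) i.castSucc
      = (cons 0 (fun i => s i.castSucc) : Fin (k + 2) → ℝ) i := fun i =>
    Fin.cases rfl (fun j => rfl) i
  have hw : ∀ i : Fin (k + 2), freeStart U (k + 2) i.castSucc = freeStart U (k + 1) i := fun i =>
    Fin.cases rfl (fun j => rfl) i
  simp only [startedChain, hc, hw]
  rw [chainOp, cons_last]
  rw [freeStart, cons_last]

lemma bridgeMoment_eq (hα : 0 < α) (hp : PositiveDensities d α) {U : Rd d → ℝ}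
    (hU : Continuous U) {M : ℝ} (hM : ∀ x, |U x| ≤ M) {X : ℝ → Ω → Rd d}
    {P : ℝ → Rd d → Rd d → Measure Ω} {t : ℝ}
    (hX : ∀ x y : Rd d, IsStableBridge α t x y (P t x y) X) (ht : 0 < t) (k : ℕ)
    (z : Rd d × Rd d) :
    bridgeMoment α U P X t k z = ∫ s in simplex k t, pinnedChain α U t s z := by
  rw [bridgeMoment, integral_pathIntegral_pow hU hM (hX z.1 z.2) ht, ← integral_const_mul]
  exact setIntegral_congr_fun (measurableSet_simplex k t) fun s hs =>
    stableDensity_mul_integral_prod hα hp hU (hX z.1 z.2) ht hs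

lemma integrable_bridgeMoment (hα : 0 < α) (hp : PositiveDensities d α) {U : Rd d → ℝ}
    (hU : Continuous U) {M : ℝ} (hM : ∀ x, |U x| ≤ M) (hi : Integrable U) {X : ℝ → Ω → Rd d}
    {P : ℝ → Rd d → Rd d → Measure Ω} {t : ℝ}
    (hX : ∀ x y : Rd d, IsStableBridge α t x y (P t x y) X) (ht : 0 < t) (k : ℕ) :
    Integrable (bridgeMoment α U P X t (k + 1)) :=
  (integrable_pinnedChain_prod hα hp ⟨hU.measurable, M, hM⟩ hi ht k).integral_prod_right.congr
    (Eventually.of_forall fun z => (bridgeMoment_eq hα hp hU hM hX ht (k + 1) z).symm)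

/-- The moments, integrated over both end points, are correlations integrated over ordered times. -/
lemma integral_bridgeMoment (hα : 0 < α) (hp : PositiveDensities d α) {U : Rd d → ℝ}
    (hU : Continuous U) {M : ℝ} (hM : ∀ x, |U x| ≤ M) (hi : Integrable U) {X : ℝ → Ω → Rd d}
    {P : ℝ → Rd d → Rd d → Measure Ω} {t : ℝ}
    (hX : ∀ x y : Rd d, IsStableBridge α t x y (P t x y) X) (ht : 0 < t) (k : ℕ) :
    ∫ z, bridgeMoment α U P X t (k + 1) z = ∫ s in simplex (k + 1) t, correlation α U s := by
  have hb : BoundedMeasurable U := ⟨hU.measurable, M, hM⟩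
  simp_rw [bridgeMoment_eq hα hp hU hM hX ht]
  rw [← integral_integral_swap (f := fun s z => pinnedChain α U t s z)
    (integrable_pinnedChain_prod hα hp hb hi ht k)]
  exact setIntegral_congr_fun (measurableSet_simplex _ t) fun s hs =>
    integral_pinnedChain hα hp hb hi ht hs

lemma bridgeMoment_zero {U : Rd d → ℝ} {X : ℝ → Ω → Rd d} {P : ℝ → Rd d → Rd d → Measure Ω} {t : ℝ}
    (hX : ∀ x y : Rd d, IsStableBridge α t x y (P t x y) X) (z : Rd d × Rd d) :
    bridgeMoment α U P X t 0 z = stableDensity α t (z.1 - z.2) := by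
  have := (hX z.1 z.2).isProbabilityMeasure
  simp [bridgeMoment]

lemma aestronglyMeasurable_bridgeMoment (hα : 0 < α) (hp : PositiveDensities d α) {U : Rd d → ℝ}
    (hU : Continuous U) {M : ℝ} (hM : ∀ x, |U x| ≤ M) (hi : Integrable U) {X : ℝ → Ω → Rd d}
    {P : ℝ → Rd d → Rd d → Measure Ω} {t : ℝ}
    (hX : ∀ x y : Rd d, IsStableBridge α t x y (P t x y) X) (ht : 0 < t) (k : ℕ) :
    AEStronglyMeasurable (bridgeMoment α U P X t k) := by
  cases k with
  | zero =>
    have : bridgeMoment α U P X t 0 = fun z => stableDensity α t (z.1 - z.2) := by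
      ext z; exact bridgeMoment_zero hX z
    rw [this]
    exact ((continuous_stableDensity hα ht).comp
      (continuous_fst.sub continuous_snd)).aestronglyMeasurable
  | succ k => exact (integrable_bridgeMoment hα hp hU hM hi hX ht k).aestronglyMeasurable

lemma integral_pathIntegral_sum {U : Rd d → ℝ} (hU : Continuous U) {M : ℝ}
    (hM : ∀ x, |U x| ≤ M) {X : ℝ → Ω → Rd d} {P : ℝ → Rd d → Rd d → Measure Ω} {t : ℝ}
    (hX : ∀ x y : Rd d, IsStableBridge α t x y (P t x y) X) (ht : 0 < t) (n : ℕ)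
    (z : Rd d × Rd d) :
    stableDensity α t (z.1 - z.2) * ∫ ω, ∑ k ∈ Finset.range n,
        (-pathIntegral U X t ω) ^ k / (k.factorial : ℝ) ∂(P t z.1 z.2)
      = ∑ k ∈ Finset.range n, (-1) ^ k * bridgeMoment α U P X t k z := by
  have h1 : ∀ k : ℕ, ∀ ω, (-pathIntegral U X t ω) ^ k / (k.factorial : ℝ)
      = (-1) ^ k * (pathIntegral U X t ω ^ k / (k.factorial : ℝ)) := fun k ω => by
    rw [neg_pow]; ring
  simp_rw [h1]
  rw [integral_finsetSum _ fun k _ =>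
    ((integrable_pathIntegral_pow hU hM (hX z.1 z.2) ht k).div_const _).const_mul _,
    Finset.mul_sum]
  refine Finset.sum_congr rfl fun k _ => ?_
  rw [integral_const_mul, bridgeMoment]
  ring

lemma abs_exp_sub_sum_le (x : ℝ) (n : ℕ) :
    |Real.exp x - ∑ k ∈ Finset.range n, x ^ k / (k.factorial : ℝ)| ≤ |x| ^ n * Real.exp |x| := by
  have h := Complex.norm_exp_sub_sum_le_norm_mul_exp x n
  rw [Complex.norm_real, Real.norm_eq_abs] at h
  rw [← Real.norm_eq_abs, ← Complex.norm_real]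
  push_cast
  exact h

lemma integrable_exp_neg_pathIntegral {U : Rd d → ℝ} (hU : Continuous U) {M : ℝ}
    (hM : ∀ x, |U x| ≤ M) {t : ℝ} {x y : Rd d} {P : Measure Ω} {X : ℝ → Ω → Rd d}
    (h : IsStableBridge α t x y P X) (ht : 0 < t) :
    Integrable (fun ω => Real.exp (-pathIntegral U X t ω)) P := by
  have := h.isProbabilityMeasure
  refine Integrable.of_bound (C := Real.exp (M * t))
    (measurable_pathIntegral hU h ht).neg.exp.aestronglyMeasurable
    (Eventually.of_forall fun ω => ?_)
  rw [Real.norm_of_nonneg (Real.exp_nonneg _)]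
  exact Real.exp_le_exp.mpr ((neg_le_abs _).trans (abs_pathIntegral_le hM X ht.le ω))

/-- The Feynman-Kac kernel is the pointwise limit of its Taylor polynomials, hence measurable. -/
lemma aestronglyMeasurable_schrodingerKernel (hα : 0 < α) (hp : PositiveDensities d α)
    {U : Rd d → ℝ} (hU : Continuous U) {M : ℝ} (hM : ∀ x, |U x| ≤ M) (hi : Integrable U)
    {X : ℝ → Ω → Rd d} {P : ℝ → Rd d → Rd d → Measure Ω} {t : ℝ}
    (hX : ∀ x y : Rd d, IsStableBridge α t x y (P t x y) X) (ht : 0 < t) :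
    AEStronglyMeasurable (fun z : Rd d × Rd d => schrodingerKernel α U P X t z.1 z.2) := by
  refine aestronglyMeasurable_of_tendsto_ae atTop
    (f := fun n z => ∑ k ∈ Finset.range n, (-1) ^ k * bridgeMoment α U P X t k z) (fun n => ?_)
    (Eventually.of_forall fun z => ?_)
  · exact Finset.aestronglyMeasurable_fun_sum _ fun k _ =>
      (aestronglyMeasurable_bridgeMoment hα hp hU hM hi hX ht k).const_mul _
  · have := (hX z.1 z.2).isProbabilityMeasure
    simp_rw [← integral_pathIntegral_sum hU hM hX ht]
    refine Tendsto.const_mul _ ?_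
    refine tendsto_integral_of_dominated_convergence (fun _ => Real.exp (M * t)) (fun n => ?_)
      (integrable_const _) (fun n => Eventually.of_forall fun ω => ?_)
      (Eventually.of_forall fun ω => ?_)
    · exact (Finset.measurable_fun_sum _ fun k _ =>
        ((measurable_pathIntegral hU (hX z.1 z.2) ht).neg.pow_const k).div_const
          _).aestronglyMeasurable
    · refine (norm_sum_le _ _).trans ?_
      have h1 : ∀ k : ℕ, ‖(-pathIntegral U X t ω) ^ k / (k.factorial : ℝ)‖
          = |pathIntegral U X t ω| ^ k / (k.factorial : ℝ) := fun k => by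
        rw [norm_div, norm_pow, norm_neg, Real.norm_eq_abs, Real.norm_of_nonneg (by positivity)]
      simp_rw [h1]
      exact (Real.sum_le_exp_of_nonneg (abs_nonneg _) n).trans
        (Real.exp_le_exp.mpr (abs_pathIntegral_le hM X ht.le ω))
    · have := NormedSpace.expSeries_div_hasSum_exp (-pathIntegral U X t ω)
      rw [← Real.exp_eq_exp_ℝ] at this
      exact this.tendsto_sum_nat

lemma integral_correlation_one (hα : 0 < α) (hp : PositiveDensities d α) (V : Rd d → ℝ) {t : ℝ}
    (ht : 0 ≤ t) : ∫ s in simplex 1 t, correlation α V s = t * ∫ x, V x := by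
  have h1 : EqOn (fun s : Fin 1 → ℝ => correlation α V s) (fun _ => ∫ x, V x) (simplex 1 t) :=
    fun s hs => by simp only [correlation, startedChain_zero hα hp V (hs.2 0).1, mul_one]
  rw [setIntegral_congr_fun (measurableSet_simplex _ t) h1, integral_simplex_const 1 ht]
  simp [mul_comm]

lemma integral_bridgeMoment_one (hα : 0 < α) (hp : PositiveDensities d α) {U : Rd d → ℝ}
    (hU : Continuous U) {M : ℝ} (hM : ∀ x, |U x| ≤ M) (hi : Integrable U) {X : ℝ → Ω → Rd d}
    {P : ℝ → Rd d → Rd d → Measure Ω} {t : ℝ}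
    (hX : ∀ x y : Rd d, IsStableBridge α t x y (P t x y) X) (ht : 0 < t) :
    ∫ z, bridgeMoment α U P X t 1 z = t * ∫ x, U x := by
  rw [integral_bridgeMoment hα hp hU hM hi hX ht, integral_correlation_one hα hp U ht.le]

/-- The Taylor remainder of the Feynman-Kac kernel is dominated by the first moment of `|U|`. -/
lemma abs_schrodingerKernel_sub_sum_le (hp : PositiveDensities d α) {U : Rd d → ℝ}
    (hU : Continuous U) {M : ℝ} (hM : ∀ x, |U x| ≤ M) {X : ℝ → Ω → Rd d}
    {P : ℝ → Rd d → Rd d → Measure Ω} {t : ℝ}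
    (hX : ∀ x y : Rd d, IsStableBridge α t x y (P t x y) X) (ht : 0 < t) (n : ℕ)
    (z : Rd d × Rd d) :
    |schrodingerKernel α U P X t z.1 z.2
        - ∑ k ∈ Finset.range (n + 1), (-1) ^ k * bridgeMoment α U P X t k z|
      ≤ (M * t) ^ n * Real.exp (M * t) * bridgeMoment α (fun x => |U x|) P X t 1 z := by
  have hb := hX z.1 z.2
  rw [← integral_pathIntegral_sum hU hM hX ht, schrodingerKernel, ← mul_sub]
  have h1 := integrable_exp_neg_pathIntegral hU hM hb ht
  have h2 : Integrable (fun ω => ∑ k ∈ Finset.range (n + 1),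
      (-pathIntegral U X t ω) ^ k / (k.factorial : ℝ)) (P t z.1 z.2) :=
    integrable_finsetSum _ fun k _ => by
      have := ((integrable_pathIntegral_pow hU hM hb ht k).div_const
        (k.factorial : ℝ)).const_mul ((-1) ^ k)
      refine this.congr (Eventually.of_forall fun ω => ?_)
      simp only
      rw [neg_pow (pathIntegral U X t ω)]
      ring
  have h3 := integrable_pathIntegral_pow hU.abs (M := M) (fun x => by rw [abs_abs]; exact hM x)
    hb ht 1
  have h4 : (∫ ω, Real.exp (-∫ s in (0 : ℝ)..t, U (X s ω)) ∂(P t z.1 z.2))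
      = ∫ ω, Real.exp (-pathIntegral U X t ω) ∂(P t z.1 z.2) := rfl
  rw [h4, ← integral_sub h1 h2, abs_mul, abs_of_pos (hp t ht _), bridgeMoment, mul_left_comm]
  refine mul_le_mul_of_nonneg_left ?_ (hp t ht _).le
  rw [← integral_const_mul, ← Real.norm_eq_abs]
  refine norm_integral_le_of_norm_le ((h3.div_const _).const_mul _)
    (Eventually.of_forall fun ω => ?_)
  have hA := abs_pathIntegral_le hM X ht.le ω
  refine (abs_exp_sub_sum_le _ _).trans ?_
  rw [abs_neg, pow_succ, pow_one, Nat.factorial_one, Nat.cast_one, div_one]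
  calc |pathIntegral U X t ω| ^ n * |pathIntegral U X t ω| * Real.exp |pathIntegral U X t ω|
      = |pathIntegral U X t ω| ^ n * Real.exp |pathIntegral U X t ω| * |pathIntegral U X t ω| := by
        ring
    _ ≤ _ := by
        refine mul_le_mul (mul_le_mul (pow_le_pow_left₀ (abs_nonneg _) hA n)
          (Real.exp_le_exp.mpr hA) (Real.exp_nonneg _) ?_)
          (intervalIntegral.abs_integral_le_integral_abs ht.le) (abs_nonneg _) ?_
        · exact pow_nonneg ((abs_nonneg _).trans hA) n
        · exact mul_nonneg (pow_nonneg ((abs_nonneg _).trans hA) n) (Real.exp_nonneg _)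

lemma integrable_schrodingerKernel_sub_sum (hα : 0 < α) (hp : PositiveDensities d α)
    {U : Rd d → ℝ} (hU : Continuous U) {M : ℝ} (hM : ∀ x, |U x| ≤ M) (hi : Integrable U)
    {X : ℝ → Ω → Rd d} {P : ℝ → Rd d → Rd d → Measure Ω} {t : ℝ}
    (hX : ∀ x y : Rd d, IsStableBridge α t x y (P t x y) X) (ht : 0 < t) (n : ℕ) :
    Integrable (fun z : Rd d × Rd d => schrodingerKernel α U P X t z.1 z.2
        - ∑ k ∈ Finset.range (n + 1), (-1) ^ k * bridgeMoment α U P X t k z) := by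
  refine ((integrable_bridgeMoment hα hp hU.abs (M := M) (fun x => by rw [abs_abs]; exact hM x)
    hi.abs hX ht 0).const_mul ((M * t) ^ n * Real.exp (M * t))).mono' ?_
    (Eventually.of_forall (abs_schrodingerKernel_sub_sum_le hp hU hM hX ht n))
  exact (aestronglyMeasurable_schrodingerKernel hα hp hU hM hi hX ht).sub
    (Finset.aestronglyMeasurable_fun_sum _ fun k _ =>
      (aestronglyMeasurable_bridgeMoment hα hp hU hM hi hX ht k).const_mul _)

lemma abs_integral_schrodingerKernel_sub_sum_le (hα : 0 < α) (hp : PositiveDensities d α)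
    {U : Rd d → ℝ} (hU : Continuous U) {M : ℝ} (hM : ∀ x, |U x| ≤ M) (hi : Integrable U)
    {X : ℝ → Ω → Rd d} {P : ℝ → Rd d → Rd d → Measure Ω} {t : ℝ}
    (hX : ∀ x y : Rd d, IsStableBridge α t x y (P t x y) X) (ht : 0 < t) (n : ℕ) :
    |∫ z : Rd d × Rd d, (schrodingerKernel α U P X t z.1 z.2
        - ∑ k ∈ Finset.range (n + 1), (-1) ^ k * bridgeMoment α U P X t k z)|
      ≤ (M * t) ^ n * Real.exp (M * t) * (t * ∫ x, |U x|) := by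
  have hM' : ∀ x, |(|U x|)| ≤ M := fun x => by rw [abs_abs]; exact hM x
  rw [← integral_bridgeMoment_one hα hp hU.abs hM' hi.abs hX ht, ← integral_const_mul,
    ← Real.norm_eq_abs]
  exact norm_integral_le_of_norm_le
    ((integrable_bridgeMoment hα hp hU.abs hM' hi.abs hX ht 0).const_mul _)
    (Eventually.of_forall (abs_schrodingerKernel_sub_sum_le hp hU hM hX ht n))

/-- The heat content is the alternating sum of the integrated moments, up to a Taylor
remainder. -/
lemma abs_heatContent_sub_sum_le (hα : 0 < α) (hp : PositiveDensities d α)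
    {U : Rd d → ℝ} (hU : Continuous U) {M : ℝ} (hM : ∀ x, |U x| ≤ M) (hi : Integrable U)
    {X : ℝ → Ω → Rd d} {P : ℝ → Rd d → Rd d → Measure Ω} {t : ℝ}
    (hX : ∀ x y : Rd d, IsStableBridge α t x y (P t x y) X) (ht : 0 < t) (n : ℕ) :
    |heatContent α U P X t - ∑ k ∈ Finset.range n,
        (-1) ^ (k + 1) * ∫ s in simplex (k + 1) t, correlation α U s|
      ≤ (M * t) ^ n * Real.exp (M * t) * (t * ∫ x, |U x|) := by
  have hs : Integrable (fun z => ∑ k ∈ Finset.range n,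
      (-1) ^ (k + 1) * bridgeMoment α U P X t (k + 1) z) :=
    integrable_finsetSum _ fun k _ =>
      (integrable_bridgeMoment hα hp hU hM hi hX ht k).const_mul _
  have h1 : heatContent α U P X t = ∫ z : Rd d × Rd d,
      ((schrodingerKernel α U P X t z.1 z.2
        - ∑ k ∈ Finset.range (n + 1), (-1) ^ k * bridgeMoment α U P X t k z)
      + ∑ k ∈ Finset.range n, (-1) ^ (k + 1) * bridgeMoment α U P X t (k + 1) z) := by
    rw [heatContent]
    congr 1; ext z
    rw [Finset.sum_range_succ', bridgeMoment_zero hX]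
    ring
  rw [h1, integral_add (integrable_schrodingerKernel_sub_sum hα hp hU hM hi hX ht n) hs,
    integral_finsetSum _ fun k _ =>
      (integrable_bridgeMoment hα hp hU hM hi hX ht k).const_mul _]
  simp_rw [integral_const_mul, integral_bridgeMoment hα hp hU hM hi hX ht]
  rw [add_sub_cancel_right]
  exact abs_integral_schrodingerKernel_sub_sum_le hα hp hU hM hi hX ht n

end

section

/-! ### Polynomials integrated over the simplices -/

lemma integrableOn_simplex_of_continuous {k : ℕ} {F : (Fin k → ℝ) → ℝ} (hF : Continuous F)
    (t : ℝ) : IntegrableOn F (simplex k t) :=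
  (hF.continuousOn.integrableOn_compact
    (isCompact_Icc (a := fun _ : Fin k => (0 : ℝ)) (b := fun _ => t))).mono_set
    fun _ hs => ⟨fun i => (hs.2 i).1.le, fun i => (hs.2 i).2.le⟩

lemma integral_simplex_two {t : ℝ} (ht : 0 ≤ t) {g : ℝ → ℝ → ℝ}
    (hg : Continuous (fun q : ℝ × ℝ => g q.1 q.2)) :
    ∫ s in simplex 2 t, g (s 0) (s 1) = ∫ r₁ in (0 : ℝ)..t, ∫ r₀ in (0 : ℝ)..r₁, g r₀ r₁ := by
  refine (integral_simplex_succ ht (F := fun s : Fin 2 → ℝ => g (s 0) (s 1))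
    (integrableOn_simplex_of_continuous
      (hg.comp (f := fun s : Fin 2 → ℝ => (s 0, s 1)) (by fun_prop)) t)).trans ?_
  refine intervalIntegral.integral_congr fun r hr => ?_
  rw [uIcc_of_le ht] at hr
  have h : ∀ s : Fin 1 → ℝ, g (snoc s r 0) (snoc s r 1) = g (s 0) r := fun _ => rfl
  simp only [h]
  refine (integral_simplex_succ hr.1 (F := fun s : Fin 1 → ℝ => g (s 0) r)
    (integrableOn_simplex_of_continuous
      (hg.comp (f := fun s : Fin 1 → ℝ => (s 0, r)) (by fun_prop)) r)).trans ?_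
  simp_rw [integral_simplex_zero]
  rfl

lemma integral_simplex_three {t : ℝ} (ht : 0 ≤ t) {g : ℝ → ℝ → ℝ → ℝ}
    (hg : Continuous (fun q : ℝ × ℝ × ℝ => g q.1 q.2.1 q.2.2)) :
    ∫ s in simplex 3 t, g (s 0) (s 1) (s 2)
      = ∫ r₂ in (0 : ℝ)..t, ∫ r₁ in (0 : ℝ)..r₂, ∫ r₀ in (0 : ℝ)..r₁, g r₀ r₁ r₂ := by
  refine (integral_simplex_succ ht (F := fun s : Fin 3 → ℝ => g (s 0) (s 1) (s 2))
    (integrableOn_simplex_of_continuous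
      (hg.comp (f := fun s : Fin 3 → ℝ => (s 0, s 1, s 2)) (by fun_prop)) t)).trans ?_
  refine intervalIntegral.integral_congr fun r hr => ?_
  rw [uIcc_of_le ht] at hr
  exact integral_simplex_two hr.1 (g := fun a b => g a b r)
    (hg.comp (f := fun q : ℝ × ℝ => (q.1, q.2, r)) (by fun_prop))

lemma integral_simplex_four {t : ℝ} (ht : 0 ≤ t) {g : ℝ → ℝ → ℝ → ℝ → ℝ}
    (hg : Continuous (fun q : ℝ × ℝ × ℝ × ℝ => g q.1 q.2.1 q.2.2.1 q.2.2.2)) :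
    ∫ s in simplex 4 t, g (s 0) (s 1) (s 2) (s 3)
      = ∫ r₃ in (0 : ℝ)..t, ∫ r₂ in (0 : ℝ)..r₃, ∫ r₁ in (0 : ℝ)..r₂, ∫ r₀ in (0 : ℝ)..r₁,
        g r₀ r₁ r₂ r₃ := by
  refine (integral_simplex_succ ht (F := fun s : Fin 4 → ℝ => g (s 0) (s 1) (s 2) (s 3))
    (integrableOn_simplex_of_continuous
      (hg.comp (f := fun s : Fin 4 → ℝ => (s 0, s 1, s 2, s 3)) (by fun_prop)) t)).trans ?_
  refine intervalIntegral.integral_congr fun r hr => ?_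
  rw [uIcc_of_le ht] at hr
  exact integral_simplex_three hr.1 (g := fun a b c => g a b c r)
    (hg.comp (f := fun q : ℝ × ℝ × ℝ => (q.1, q.2.1, q.2.2, r)) (by fun_prop))

lemma integral_quartic {f : ℝ → ℝ} (r c₀ c₁ c₂ c₃ c₄ : ℝ)
    (hf : ∀ x, f x = c₀ + c₁ * x + c₂ * x ^ 2 + c₃ * x ^ 3 + c₄ * x ^ 4) :
    ∫ x in (0 : ℝ)..r, f x
      = c₀ * r + c₁ * r ^ 2 / 2 + c₂ * r ^ 3 / 3 + c₃ * r ^ 4 / 4 + c₄ * r ^ 5 / 5 := by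
  have hd : ∀ x ∈ uIcc 0 r, HasDerivAt (fun x => c₀ * x + c₁ * x ^ 2 / 2 + c₂ * x ^ 3 / 3
      + c₃ * x ^ 4 / 4 + c₄ * x ^ 5 / 5) (f x) x := by
    intro x _
    have := ((((((hasDerivAt_id x).const_mul c₀).add
      (((hasDerivAt_pow 2 x).const_mul c₁).div_const 2)).add
      (((hasDerivAt_pow 3 x).const_mul c₂).div_const 3)).add
      (((hasDerivAt_pow 4 x).const_mul c₃).div_const 4)).add
      (((hasDerivAt_pow 5 x).const_mul c₄).div_const 5))
    refine this.congr_deriv ?_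
    rw [hf]; push_cast; ring
  have hfc : Continuous f := by
    have : f = fun x => c₀ + c₁ * x + c₂ * x ^ 2 + c₃ * x ^ 3 + c₄ * x ^ 4 := funext hf
    rw [this]; fun_prop
  rw [intervalIntegral.integral_eq_sub_of_hasDerivAt hd (hfc.intervalIntegrable _ _)]
  ring

lemma integral_simplex_two_poly {t : ℝ} (ht : 0 ≤ t) (A B C D : ℝ) :
    ∫ s in simplex 2 t, (A - (s 1 - s 0) * B + (s 1 - s 0) ^ 2 / 2 * C - (s 1 - s 0) ^ 3 / 6 * D)
      = A * t ^ 2 / 2 - B * t ^ 3 / 6 + C * t ^ 4 / 24 - D * t ^ 5 / 120 := by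
  rw [integral_simplex_two ht (g := fun a b =>
    A - (b - a) * B + (b - a) ^ 2 / 2 * C - (b - a) ^ 3 / 6 * D) (by fun_prop)]
  have h : ∀ b : ℝ, ∫ a in (0 : ℝ)..b,
      (A - (b - a) * B + (b - a) ^ 2 / 2 * C - (b - a) ^ 3 / 6 * D)
      = A * b - B * b ^ 2 / 2 + C * b ^ 3 / 6 - D * b ^ 4 / 24 := fun b => by
    rw [integral_quartic b (A - b * B + b ^ 2 / 2 * C - b ^ 3 / 6 * D)
      (B - b * C + b ^ 2 / 2 * D) (C / 2 - b / 2 * D) (D / 6) 0 (fun x => by ring)]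
    ring
  simp_rw [h]
  rw [integral_quartic t 0 A (-B / 2) (C / 6) (-D / 24) (fun x => by ring)]
  ring

lemma integral_simplex_three_poly {t : ℝ} (ht : 0 ≤ t) (A B C D : ℝ) :
    ∫ s in simplex 3 t, (A - ((s 1 - s 0) + (s 2 - s 1)) * B
        + ((s 1 - s 0) ^ 2 + (s 2 - s 1) ^ 2) / 2 * C + (s 1 - s 0) * (s 2 - s 1) * D)
      = A * t ^ 3 / 6 - B * t ^ 4 / 12 + C * t ^ 5 / 60 + D * t ^ 5 / 120 := by
  rw [integral_simplex_three ht (g := fun a b c => A - ((b - a) + (c - b)) * B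
        + ((b - a) ^ 2 + (c - b) ^ 2) / 2 * C + (b - a) * (c - b) * D) (by fun_prop)]
  have h1 : ∀ c b : ℝ, ∫ a in (0 : ℝ)..b, (A - ((b - a) + (c - b)) * B
        + ((b - a) ^ 2 + (c - b) ^ 2) / 2 * C + (b - a) * (c - b) * D)
      = A * b - (b ^ 2 / 2 + (c - b) * b) * B + (b ^ 3 / 3 + (c - b) ^ 2 * b) / 2 * C
        + b ^ 2 / 2 * (c - b) * D := fun c b => by
    rw [integral_quartic b (A - c * B + (b ^ 2 + (c - b) ^ 2) / 2 * C + b * (c - b) * D)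
      (B - b * C - (c - b) * D) (C / 2) 0 0 (fun x => by ring)]
    ring
  have h2 : ∀ c : ℝ, ∫ b in (0 : ℝ)..c,
      (A * b - (b ^ 2 / 2 + (c - b) * b) * B + (b ^ 3 / 3 + (c - b) ^ 2 * b) / 2 * C
        + b ^ 2 / 2 * (c - b) * D)
      = A * c ^ 2 / 2 - B * c ^ 3 / 3 + C * c ^ 4 / 12 + D * c ^ 4 / 24 := fun c => by
    rw [integral_quartic c 0 (A - c * B + c ^ 2 / 2 * C) (B / 2 - c * C + c / 2 * D)
      (2 / 3 * C - D / 2) 0 (fun x => by ring)]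
    ring
  simp_rw [h1, h2]
  rw [integral_quartic t 0 0 (A / 2) (-B / 3) (C / 12 + D / 24) (fun x => by ring)]
  ring

lemma integral_simplex_four_poly {t : ℝ} (ht : 0 ≤ t) (A B D : ℝ) :
    ∫ s in simplex 4 t, (A - ((s 1 - s 0) + (s 3 - s 2)) * B - (s 2 - s 1) * D)
      = A * t ^ 4 / 24 - B * t ^ 5 / 60 - D * t ^ 5 / 120 := by
  rw [integral_simplex_four ht (g := fun a b c e =>
    A - ((b - a) + (e - c)) * B - (c - b) * D) (by fun_prop)]
  have h1 : ∀ e c b : ℝ, ∫ a in (0 : ℝ)..b, (A - ((b - a) + (e - c)) * B - (c - b) * D)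
      = A * b - (b ^ 2 / 2 + (e - c) * b) * B - (c - b) * b * D := fun e c b => by
    rw [integral_quartic b (A - (b + (e - c)) * B - (c - b) * D) B 0 0 0 (fun x => by ring)]
    ring
  have h2 : ∀ e c : ℝ, ∫ b in (0 : ℝ)..c,
      (A * b - (b ^ 2 / 2 + (e - c) * b) * B - (c - b) * b * D)
      = A * c ^ 2 / 2 - (c ^ 3 / 6 + (e - c) * c ^ 2 / 2) * B - c ^ 3 / 6 * D := fun e c => by
    rw [integral_quartic c 0 (A - (e - c) * B - c * D) (-B / 2 + D) 0 0 (fun x => by ring)]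
    ring
  have h3 : ∀ e : ℝ, ∫ c in (0 : ℝ)..e,
      (A * c ^ 2 / 2 - (c ^ 3 / 6 + (e - c) * c ^ 2 / 2) * B - c ^ 3 / 6 * D)
      = A * e ^ 3 / 6 - B * e ^ 4 / 12 - D * e ^ 4 / 24 := fun e => by
    rw [integral_quartic e 0 0 (A / 2 - e / 2 * B) (B / 3 - D / 6) 0 (fun x => by ring)]
    ring
  simp_rw [h1, h2, h3]
  rw [integral_quartic t 0 0 0 (A / 6) (-B / 12 - D / 24) (fun x => by ring)]
  ring

/-! ### Integrated correlations -/

variable {d : ℕ} {α : ℝ}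

lemma integrableOn_correlation (hα : 0 < α) (hp : PositiveDensities d α) {U : Rd d → ℝ}
    (hU : BoundedMeasurable U) (hi : Integrable U) {t : ℝ} (ht : 0 < t) (k : ℕ) :
    IntegrableOn (correlation α U) (simplex (k + 1) t) := by
  refine (integrable_pinnedChain_prod hα hp hU hi ht k).integral_prod_left.congr ?_
  filter_upwards [ae_restrict_mem (measurableSet_simplex (k + 1) t)] with s hs
  exact integral_pinnedChain hα hp hU hi ht hs

/-- A pointwise error of order `t ^ m` is improved by the volume of the simplex, which is
of order `t ^ k`. -/
lemma abs_integral_simplex_sub_le {k m : ℕ} {t C : ℝ} (ht : 0 ≤ t) {F G : (Fin k → ℝ) → ℝ}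
    (hF : IntegrableOn F (simplex k t)) (hG : Continuous G)
    (h : ∀ s ∈ simplex k t, |F s - G s| ≤ C * t ^ m) :
    |(∫ s in simplex k t, F s) - ∫ s in simplex k t, G s| ≤ |C| * t ^ (m + k) := by
  rw [← integral_sub hF (integrableOn_simplex_of_continuous hG t), ← Real.norm_eq_abs]
  have hv := volume_simplex_le k ht
  have h1 : ‖∫ s in simplex k t, (F s - G s)‖ ≤ |C| * t ^ m * volume.real (simplex k t) :=
    norm_setIntegral_le_of_norm_le_const (hv.trans_lt ENNReal.ofReal_lt_top) fun s hs =>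
      (h s hs).trans (mul_le_mul_of_nonneg_right (le_abs_self C) (by positivity))
  refine h1.trans ?_
  rw [pow_add, ← mul_assoc]
  exact mul_le_mul_of_nonneg_left (ENNReal.toReal_le_of_le_ofReal (by positivity) hv)
    (by positivity)

lemma gap_mem {k : ℕ} {s : Fin k → ℝ} {t : ℝ} (hs : s ∈ simplex k t) {i j : Fin k} (hij : i < j) :
    0 < s j - s i ∧ s j - s i ≤ t :=
  ⟨sub_pos.mpr (hs.1 hij), by linarith [(hs.2 i).1, (hs.2 j).2]⟩

lemma startedChain_one (hα : 0 < α) (hp : PositiveDensities d α) (U : Rd d → ℝ)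
    {s : Fin 2 → ℝ} (hs : 0 < s 0) : startedChain α U s = heatOp α (s 1 - s 0) U := by
  rw [startedChain_succ, startedChain_zero hα hp U (s := fun i => s i.castSucc) hs]
  simp only [mul_one]
  rfl

lemma startedChain_two (hα : 0 < α) (hp : PositiveDensities d α) (U : Rd d → ℝ)
    {s : Fin 3 → ℝ} (hs : 0 < s 0) : startedChain α U s
      = heatOp α (s 2 - s 1) (fun w => U w * heatOp α (s 1 - s 0) U w) := by
  rw [startedChain_succ, startedChain_one hα hp U (s := fun i => s i.castSucc) hs]
  rfl

lemma startedChain_three (hα : 0 < α) (hp : PositiveDensities d α) (U : Rd d → ℝ)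
    {s : Fin 4 → ℝ} (hs : 0 < s 0) : startedChain α U s
      = heatOp α (s 3 - s 2) (fun w => U w *
          heatOp α (s 2 - s 1) (fun w => U w * heatOp α (s 1 - s 0) U w) w) := by
  rw [startedChain_succ, startedChain_two hα hp U (s := fun i => s i.castSucc) hs]
  rfl

lemma startedChain_four (hα : 0 < α) (hp : PositiveDensities d α) (U : Rd d → ℝ)
    {s : Fin 5 → ℝ} (hs : 0 < s 0) : startedChain α U s
      = heatOp α (s 4 - s 3) (fun w => U w * heatOp α (s 3 - s 2) (fun w => U w *
          heatOp α (s 2 - s 1) (fun w => U w * heatOp α (s 1 - s 0) U w) w) w) := by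
  rw [startedChain_succ, startedChain_three hα hp U (s := fun i => s i.castSucc) hs]
  rfl

variable {V : Rd d → ℝ}

lemma exists_integral_correlation_two (hα : 0 < α) (hp : PositiveDensities d α)
    (hV : FourierDecay α V) :
    ∃ C, ∀ t, 0 < t → |(∫ s in simplex 2 t, correlation α V s)
      - ((∫ x, V x * V x) * t ^ 2 / 2 - (∫ x, V x * lapPow α 1 V x) * t ^ 3 / 6
        + (∫ x, V x * lapPow α 2 V x) * t ^ 4 / 24 - (∫ x, V x * lapPow α 3 V x) * t ^ 5 / 120)|
      ≤ C * t ^ 6 := by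
  obtain ⟨C, hC⟩ := exists_two_point_bound hα hp hV
  refine ⟨|C|, fun t ht => ?_⟩
  rw [← integral_simplex_two_poly ht.le]
  refine abs_integral_simplex_sub_le (m := 4) ht.le
    (integrableOn_correlation hα hp (hV.boundedMeasurable hα) hV.integrable ht 1) (by fun_prop)
    fun s hs => ?_
  rw [correlation, startedChain_one hα hp V (hs.2 0).1]
  have h := gap_mem hs (i := 0) (j := 1) (by decide)
  exact hC t _ h.1 h.2

lemma exists_integral_correlation_three (hα : 0 < α) (hp : PositiveDensities d α)
    (hV : FourierDecay α V) :
    ∃ C, ∀ t, 0 < t → t ≤ 1 → |(∫ s in simplex 3 t, correlation α V s)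
      - ((∫ x, V x ^ 3) * t ^ 3 / 6 - (∫ x, V x ^ 2 * lapPow α 1 V x) * t ^ 4 / 12
        + (∫ x, V x ^ 2 * lapPow α 2 V x) * t ^ 5 / 60
        + (∫ x, V x * lapPow α 1 V x ^ 2) * t ^ 5 / 120)| ≤ C * t ^ 6 := by
  obtain ⟨C, hC⟩ := exists_three_point_bound hα hp hV
  refine ⟨|C|, fun t ht ht1 => ?_⟩
  rw [← integral_simplex_three_poly ht.le]
  refine abs_integral_simplex_sub_le (m := 3) ht.le
    (integrableOn_correlation hα hp (hV.boundedMeasurable hα) hV.integrable ht 2) (by fun_prop)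
    fun s hs => ?_
  rw [correlation, startedChain_two hα hp V (hs.2 0).1]
  have h := gap_mem hs (i := 0) (j := 1) (by decide)
  have h' := gap_mem hs (i := 1) (j := 2) (by decide)
  exact hC t _ _ ht1 h.1 h.2 h'.1 h'.2

lemma exists_integral_correlation_four (hα : 0 < α) (hp : PositiveDensities d α)
    (hV : FourierDecay α V) (hW : FourierDecay α (fun x => V x ^ 2)) :
    ∃ C, ∀ t, 0 < t → t ≤ 1 → |(∫ s in simplex 4 t, correlation α V s)
      - ((∫ x, V x ^ 4) * t ^ 4 / 24 - (∫ x, V x ^ 3 * lapPow α 1 V x) * t ^ 5 / 60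
        - (∫ x, V x ^ 2 * lapPow α 1 (fun y => V y ^ 2) x) * t ^ 5 / 120)| ≤ C * t ^ 6 := by
  obtain ⟨C, hC⟩ := exists_four_point_bound hα hp hV hW
  refine ⟨|C|, fun t ht ht1 => ?_⟩
  rw [← integral_simplex_four_poly ht.le]
  refine abs_integral_simplex_sub_le (m := 2) ht.le
    (integrableOn_correlation hα hp (hV.boundedMeasurable hα) hV.integrable ht 3) (by fun_prop)
    fun s hs => ?_
  rw [correlation, startedChain_three hα hp V (hs.2 0).1]
  have h := gap_mem hs (i := 0) (j := 1) (by decide)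
  have h' := gap_mem hs (i := 1) (j := 2) (by decide)
  have h'' := gap_mem hs (i := 2) (j := 3) (by decide)
  exact hC t _ _ _ ht1 h.1 h.2 h'.1 h'.2 h''.1 h''.2

lemma exists_integral_correlation_five (hα : 0 < α) (hp : PositiveDensities d α)
    (hV : FourierDecay α V) (hW : FourierDecay α (fun x => V x ^ 2)) :
    ∃ C, ∀ t, 0 < t → |(∫ s in simplex 5 t, correlation α V s)
      - (∫ x, V x ^ 5) * t ^ 5 / 120| ≤ C * t ^ 6 := by
  obtain ⟨C, hC⟩ := exists_five_point_bound hα hp hV hW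
  refine ⟨|C|, fun t ht => ?_⟩
  have hc : (∫ x, V x ^ 5) * t ^ 5 / 120 = ∫ _ in simplex 5 t, ∫ x, V x ^ 5 := by
    rw [integral_simplex_const 5 ht.le, mul_div_assoc]
    norm_num [Nat.factorial]
  rw [hc]
  refine abs_integral_simplex_sub_le (m := 1) ht.le
    (integrableOn_correlation hα hp (hV.boundedMeasurable hα) hV.integrable ht 4) continuous_const
    fun s hs => ?_
  rw [correlation, startedChain_four hα hp V (hs.2 0).1, pow_one]
  have h := gap_mem hs (i := 0) (j := 1) (by decide)
  have h' := gap_mem hs (i := 1) (j := 2) (by decide)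
  have h'' := gap_mem hs (i := 2) (j := 3) (by decide)
  have h₃ := gap_mem hs (i := 3) (j := 4) (by decide)
  exact hC t _ _ _ _ h.1 h.2 h'.1 h'.2 h''.1 h''.2 h₃.1 h₃.2

end

section

/-! ### The expansion of the heat content -/

variable {d : ℕ} {α : ℝ}

lemma exists_schwartz_sq (V : 𝓢(Rd d, ℝ)) : ∃ W : 𝓢(Rd d, ℝ), ⇑W = fun x => V x ^ 2 :=
  ⟨SchwartzMap.smulLeftCLM ℝ V V, by
    ext x
    rw [SchwartzMap.smulLeftCLM_apply_apply V.hasTemperateGrowth, smul_eq_mul, sq]⟩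

/-- The expansion with all coefficients expressed through the powers of the fractional
Laplacian. -/
lemma exists_heatContent_expansion (hα : 0 < α) (hp : PositiveDensities d α) (V : 𝓢(Rd d, ℝ))
    {Ω : Type*} [MeasurableSpace Ω] {X : ℝ → Ω → Rd d} {P : ℝ → Rd d → Rd d → Measure Ω}
    (hX : ∀ t : ℝ, 0 < t → ∀ x y : Rd d, IsStableBridge α t x y (P t x y) X) :
    ∃ C, ∀ t, 0 < t → t ≤ 1 → |heatContent α V P X t -
      (-(t * ∫ x, V x)
        + ((∫ x, V x * V x) * t ^ 2 / 2 - (∫ x, V x * lapPow α 1 V x) * t ^ 3 / 6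
          + (∫ x, V x * lapPow α 2 V x) * t ^ 4 / 24 - (∫ x, V x * lapPow α 3 V x) * t ^ 5 / 120)
        - ((∫ x, V x ^ 3) * t ^ 3 / 6 - (∫ x, V x ^ 2 * lapPow α 1 V x) * t ^ 4 / 12
          + (∫ x, V x ^ 2 * lapPow α 2 V x) * t ^ 5 / 60
          + (∫ x, V x * lapPow α 1 V x ^ 2) * t ^ 5 / 120)
        + ((∫ x, V x ^ 4) * t ^ 4 / 24 - (∫ x, V x ^ 3 * lapPow α 1 V x) * t ^ 5 / 60
          - (∫ x, V x ^ 2 * lapPow α 1 (fun y => V y ^ 2) x) * t ^ 5 / 120)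
        - (∫ x, V x ^ 5) * t ^ 5 / 120)| ≤ C * t ^ 6 := by
  have hV := fourierDecay_schwartz hα V
  have hW : FourierDecay α (fun x => V x ^ 2) := by
    obtain ⟨W, hW⟩ := exists_schwartz_sq V
    rw [← hW]; exact fourierDecay_schwartz hα W
  obtain ⟨M, hM⟩ := (hV.boundedMeasurable hα).bounded
  have hM0 : 0 ≤ M := (abs_nonneg _).trans (hM 0)
  obtain ⟨C₂, h₂⟩ := exists_integral_correlation_two hα hp hV
  obtain ⟨C₃, h₃⟩ := exists_integral_correlation_three hα hp hV
  obtain ⟨C₄, h₄⟩ := exists_integral_correlation_four hα hp hV hW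
  obtain ⟨C₅, h₅⟩ := exists_integral_correlation_five hα hp hV hW
  refine ⟨M ^ 5 * Real.exp M * (∫ x, |V x|) + C₂ + C₃ + C₄ + C₅, fun t ht ht1 => ?_⟩
  have h := abs_heatContent_sub_sum_le hα hp V.continuous hM hV.integrable (hX t ht) ht 5
  have hr : (M * t) ^ 5 * Real.exp (M * t) * (t * ∫ x, |V x|)
      ≤ M ^ 5 * Real.exp M * (∫ x, |V x|) * t ^ 6 := by
    have h0 : 0 ≤ ∫ x, |V x| := integral_nonneg fun _ => abs_nonneg _
    have he : Real.exp (M * t) ≤ Real.exp M :=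
      Real.exp_le_exp.mpr (mul_le_of_le_one_right hM0 ht1)
    calc (M * t) ^ 5 * Real.exp (M * t) * (t * ∫ x, |V x|)
        = M ^ 5 * (∫ x, |V x|) * t ^ 6 * Real.exp (M * t) := by ring
      _ ≤ M ^ 5 * (∫ x, |V x|) * t ^ 6 * Real.exp M :=
        mul_le_mul_of_nonneg_left he (by positivity)
      _ = _ := by ring
  have h := h.trans hr
  simp only [Finset.sum_range_succ, Finset.sum_range_zero, zero_add, Nat.reduceAdd,
    integral_correlation_one hα hp V ht.le] at h
  have g₂ := h₂ t ht
  have g₃ := h₃ t ht ht1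
  have g₄ := h₄ t ht ht1
  have g₅ := h₅ t ht
  rw [abs_le] at h g₂ g₃ g₄ g₅ ⊢
  constructor <;> linarith [h.1, h.2, g₂.1, g₂.2, g₃.1, g₃.2, g₄.1, g₄.2, g₅.1, g₅.2]

end

end HeatContent

end

theorem theorem3 {d : ℕ} [NeZero d] {α : ℝ} (hα0 : 0 < α) (hα2 : α ≤ 2)
    (V : 𝓢(HeatContent.Rd d, ℝ))
    {Ω : Type*} [MeasurableSpace Ω] (X : ℝ → Ω → HeatContent.Rd d)
    (P : ℝ → HeatContent.Rd d → HeatContent.Rd d → Measure Ω)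
    (hX : ∀ t : ℝ, 0 < t → ∀ x y : HeatContent.Rd d,
      HeatContent.IsStableBridge α t x y (P t x y) X) :
    (∀ t : ℝ, 0 < t → Integrable (fun z : HeatContent.Rd d × HeatContent.Rd d =>
      HeatContent.schrodingerKernel α V P X t z.1 z.2
        - HeatContent.stableDensity α t (z.1 - z.2))) ∧
    (fun t : ℝ => HeatContent.heatContent α V P X t -
      (-t * (∫ θ, V θ)
        + t ^ 2 / (Nat.factorial 2 : ℝ) * (∫ θ, V θ ^ 2)
        - t ^ 3 / (Nat.factorial 3 : ℝ) * ((∫ θ, V θ ^ 3) + HeatContent.dirichletForm α V)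
        + t ^ 4 / (Nat.factorial 4 : ℝ) *
          ((∫ θ, V θ ^ 4)
            + 2 * (∫ θ, V θ ^ 2 * HeatContent.fracLaplacian α V θ)
            + ∫ θ, |HeatContent.fracLaplacian α V θ| ^ 2)
        - t ^ 5 / (Nat.factorial 5 : ℝ) *
          ((∫ θ, V θ ^ 5)
            + 2 * (∫ θ, V θ ^ 3 * HeatContent.fracLaplacian α V θ)
            + 2 * (∫ θ, V θ ^ 2 *
                HeatContent.fracLaplacian α (HeatContent.fracLaplacian α V) θ)
            + (∫ θ, V θ * |HeatContent.fracLaplacian α V θ| ^ 2)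
            + HeatContent.dirichletForm α (HeatContent.fracLaplacian α V)
            + HeatContent.dirichletForm α (fun θ => V θ ^ 2))))
      =O[𝓝[>] 0] (fun t : ℝ => t ^ 6) := by
  have hp := HeatContent.positiveDensities_of_bridges hα0 hX
  have hV := HeatContent.fourierDecay_schwartz hα0 V
  have hL := HeatContent.integrable_lapPow_one hα0 hα2 hp V
  have hLV := hV.of_lapPow_one hα0 hL
  obtain ⟨M, hM⟩ := (hV.boundedMeasurable hα0).bounded
  refine ⟨fun t ht => ?_, ?_⟩
  · refine (HeatContent.integrable_schrodingerKernel_sub_sum hα0 hp V.continuous hM hV.integrable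
      (hX t ht) ht 0).congr (Eventually.of_forall fun z => ?_)
    simp [HeatContent.bridgeMoment_zero (hX t ht)]
  · obtain ⟨C, hC⟩ := HeatContent.exists_heatContent_expansion hα0 hp V hX
    refine Asymptotics.IsBigO.of_bound C ?_
    filter_upwards [Ioc_mem_nhdsGT (zero_lt_one (α := ℝ))] with t ht
    have h := hC t ht.1 ht.2
    obtain ⟨W, hW⟩ := HeatContent.exists_schwartz_sq V
    have e1 : HeatContent.dirichletForm α (fun θ => V θ ^ 2)
        = ∫ x, V x ^ 2 * HeatContent.lapPow α 1 (fun y => V y ^ 2) x := by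
      have := HeatContent.dirichletForm_schwartz hα0 hα2 W
      rwa [hW] at this
    have e2 : ∫ x, V x * HeatContent.lapPow α 2 V x = ∫ x, HeatContent.lapPow α 1 V x ^ 2 := by
      rw [← hV.lapPow_lapPow_one hα0 hL 1, hV.integral_mul_lapPow_comm hα0 hLV 1]
      simp only [sq]
    simp only [HeatContent.fracLaplacian_eq_lapPow, sq_abs,
      HeatContent.dirichletForm_schwartz hα0 hα2 V,
      HeatContent.dirichletForm_lapPow_one hα0 hα2 V hL, hV.lapPow_lapPow_one hα0 hL, e1]
    rw [Real.norm_eq_abs, Real.norm_of_nonneg (by have := ht.1; positivity)]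
    refine le_of_eq_of_le (congrArg _ ?_) h
    rw [e2]
    simp only [← sq, Nat.factorial]
    push_cast
    ring
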